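/- Let $R$ be a commutative noetherian ring and let $H\xrightarrow{\varphi}G\xrightarrow{\psi}F$ be a complex ($\psi\varphi=0$) of finite free $R$-modules of ranks $l,n,m$, with $1\le l\le n$ and $r:=n-m\ge 1$. Let $I_\varphi$ and $I_\psi$ be the ideals generated by the $l\times l$ minors of a matrix of $\varphi$ and the $m\times m$ minors of a matrix of $\psi$; put $h=\operatorname{grade} I_\varphi$, $g=\operatorname{grade} I_\psi$ (the grade of the unit ideal is $\infty$), and $C=\operatorname{Coker}\psi$. Let $\bigwedge$, $S$, $D$ denote exterior, symmetric and divided powers (negative powers are $0$), let $h_1,\dots,h_l$ and $f_1,\dots,f_m$ be bases of $H$ and $F$ with dual bases $h_j^*$, $f_j^*$, and fix an integer $t\ge 0$. Consider the bicomplex $\mathcal C(t)$ with $$C^{p,q}=\begin{cases}D_{t-p}(H)\otimes\bigwedge^{p-q}G\otimes S_q(F), & 0\le p\le t,\\ S_{p-t-1}(H^*)\otimes\bigwedge^{p+l-1-q}G\otimes S_q(F), & p>t,\end{cases}\qquad q\ge 0.$$ Its column maps $\partial_\psi:C^{p,q}\to C^{p,q+1}$ are $x\otimes y\otimes z\mapsto\sum_j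 x\otimes(y\leftharpoonup\psi^*(f_j^*))\otimes zf_j$, where $y_1\wedge\dots\wedge y_k\leftharpoonup a=\sum_i(-1)^{i-1}a(y_i)\,y_1\wedge\dots\widehat{y_i}\dots\wedge y_k$. Its row maps $C^{p,q}\to C^{p+1,q}$ are as follows. For $p<t$ the row map is $x_1^{(k_1)}\cdots x_s^{(k_s)}\otimes y\otimes z\mapsto\sum_j x_1^{(k_1)}\cdots x_j^{(k_j-1)}\cdots x_s^{(k_s)}\otimes\varphi(x_j)\wedge y\otimes z$. For $p>t$ it is $x\otimes y\otimes z\mapsto\sum_j h_j^*x\otimes\varphi(h_j)\wedge y\otimes z$. For $p=t$ it is $(-1)^{(l+1)q}$ times left multiplication by $\varphi(h_1)\wedge\dots\wedge\varphi(h_l)$ on the factor $\bigwedge G$. All squares anticommute. Put $N^p=\operatorname{Ker}(C^{p,0}\to C^{p,1})$; the row maps make $\mathcal N(t):0\to N^0\to N^1\to\cdots$ a complex, and $\bar H^p$ denotes its homology at $N^p$. Let $H_\psi^{p,q}$ be the homology at $C^{p,q}$ of the column $0\to N^p\to C^{p,0}\to C^{p,1}\to\cdots$. **Theorem 2.2.**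 Assume $1\le r\le g$. Then $\bar H^i=0$ for $0\le i\le\min(2,h-1)$. Moreover: (a) For $i$ odd, $3\le i<\min(h-1,2r,2t+2)$, there is a natural exact sequence $$0\to\bar H^i\to D_{t-\frac{i-1}2}(H)\otimes S_{\frac{i-1}2}(C)\to H_\psi^{\frac{i+1}2,\frac{i-1}2}\to\bar H^{i+1}\to0.$$ (b) Suppose that $l>1$. (i) If $3\le 2t+1<h$, then there is a natural isomorphism $\bar H^{2t+1}\cong D_0(H)\otimes S_t(C)$. (ii) $\bar H^i=0$ for $2t+2\le i<\min(h,2t+l+1)$. (iii) If $2t+l+1<h$, then there is a natural isomorphism $\bar H^{2t+l+1}\cong H_\psi^{t+1,t+l-1}$. (c) For $i-l$ even, $2t+l+2\le i<\min(h-1,2r-l+2)$, there is a natural exact sequence $$0\to\bar H^i\to S_{\frac{i-l}2-t-1}(H^*)\otimes S_{\frac{i+l}2-1}(C)\to H_\psi^{\frac{i-l}2+1,\frac{i+l}2-1}\to\bar H^{i+1}\to0.$$ Here "natural" means the following. The middle maps in (a) and (c) are induced by the row map $C^{p-1,q}\to C^{p,q}$, where $H_\psi^{p,q}$ is the third term,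 and where $A\otimes S_q(C)$, the second term, is the quotient of $A\otimes S_q(F)=C^{p-1,q}$. The maps $\bar H^i\to A\otimes S_q(C)$ in (a), (b)(i), (c) (with $q=t$ in (b)(i)) and $H_\psi^{p,q}\to\bar H^{p+q+1}$ in (a), (b)(iii), (c) are the staircase maps of the bicomplex: the class of a cycle $x\in N^i$ corresponds to the class of $z\in C^{i-1-q,q}$ when there are $y_j\in C^{i-1-j,j}$ $(0\le j\le q)$ with $y_q=z$ such that $x$ is the image of $y_0$ under the row map and, for $j<q$, the image of $y_j$ under the column map equals the image of $y_{j+1}$ under the row map. -/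

import Mathlib

open scoped TensorProduct

noncomputable section

namespace KoszulBicomplex

/-! ### Grade and ideals of minors -/

/-- The grade of an ideal `I` of a noetherian ring: the supremum of the lengths of the (weakly)
`R`-regular sequences with entries in `I`.  If `I` is a proper ideal, every weakly regular sequence
in `I` is regular and this is the common length of the maximal `R`-regular sequences in `I`;
if `I = R` the value is `∞`. -/
def idealGrade {R : Type*} [CommRing R] (I : Ideal R) : ℕ∞ :=
  ⨆ (rs : List R) (_ : (∀ x ∈ rs, x ∈ I) ∧ RingTheory.Sequence.IsWeaklyRegular R rs),
    (rs.length : ℕ∞)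

/-- The ideal generated by the `k × k` minors of a matrix.  (Choices of rows or columns with
repetitions only contribute the generator `0`.) -/
def minorIdeal {R : Type*} [CommRing R] {a b : ℕ} (A : Matrix (Fin a) (Fin b) R) (k : ℕ) :
    Ideal R :=
  Ideal.span {x | ∃ (e : Fin k → Fin a) (f : Fin k → Fin b), x = (A.submatrix e f).det}

/-! ### Graded pieces of symmetric and divided power algebras -/

/-- `S_k(M)`, the degree `k` part of the symmetric algebra `S(M)`. -/
def symPow (R : Type*) [CommRing R] (M : Type*) [AddCommGroup M] [Module R M] (k : ℕ) :
    Submodule R (SymmetricAlgebra R M) :=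
  LinearMap.range (SymmetricAlgebra.ι R M) ^ k

/-- `D_k(M)`, the degree `k` part of the divided power algebra `D(M)`: it is spanned by the products
`x₁^(k₁) ⋯ x_p^(k_p)` with `k₁ + ⋯ + k_p = k`. -/
def divPow (R : Type*) [CommRing R] (M : Type*) [AddCommGroup M] [Module R M] (k : ℕ) :
    Submodule R (DividedPowerAlgebra R M) :=
  Submodule.span R {x | ∃ s : Multiset (ℕ × M), (s.map Prod.fst).sum = k ∧
    x = (s.map fun u => DividedPowerAlgebra.dp R u.1 u.2).prod}

section Maps

variable {R : Type*} [CommRing R]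

/-- The algebra homomorphism `S(M) → S(N)` induced by a linear map `M → N`. -/
def symMap {M N : Type*} [AddCommGroup M] [Module R M] [AddCommGroup N] [Module R N]
    (f : M →ₗ[R] N) : SymmetricAlgebra R M →ₐ[R] SymmetricAlgebra R N :=
  SymmetricAlgebra.lift (SymmetricAlgebra.ι R N ∘ₗ f)

theorem symMap_mem {M N : Type*} [AddCommGroup M] [Module R M] [AddCommGroup N] [Module R N]
    (f : M →ₗ[R] N) (k : ℕ) : ∀ x ∈ symPow R M k, (symMap f).toLinearMap x ∈ symPow R N k := by
  have h : (symPow R M k).map (symMap f).toLinearMap ≤ symPow R N k := by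
    unfold symPow
    rw [Submodule.map_pow]
    refine pow_le_pow_left' ?_ k
    rintro _ ⟨_, ⟨x, rfl⟩, rfl⟩
    exact ⟨f x, by simp [symMap]⟩
  intro x hx
  exact h (Submodule.mem_map_of_mem hx)

/-- The map `S_k(M) → S_k(N)` induced by a linear map `M → N`. -/
def symPowMap {M N : Type*} [AddCommGroup M] [Module R M] [AddCommGroup N] [Module R N]
    (f : M →ₗ[R] N) (k : ℕ) : symPow R M k →ₗ[R] symPow R N k :=
  (symMap f).toLinearMap.restrict (symMap_mem f k)

/-- The algebra homomorphism `D(M) → D(M)[ε]`, `x^(k) ↦ x^(k) + ε a(x) x^(k-1)`, for a linear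
form `a` on `M`. -/
def dpDerivHom {M : Type*} [AddCommGroup M] [Module R M] (a : Module.Dual R M) :
    DividedPowerAlgebra R M →ₐ[R] DualNumber (DividedPowerAlgebra R M) :=
  DividedPowerAlgebra.lift'
    (f := fun u => TrivSqZeroExt.inl (DividedPowerAlgebra.dp R u.1 u.2) +
      TrivSqZeroExt.inr (match u.1 with
        | 0 => 0
        | k + 1 => a u.2 • DividedPowerAlgebra.dp R k u.2))
    (fun x => by
      ext <;> simp [DividedPowerAlgebra.dp_zero])
    (fun k c x => by
      cases k with
      | zero => ext <;> simp [DividedPowerAlgebra.dp_zero]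
      | succ k =>
        ext
        · simp [DividedPowerAlgebra.dp_smul]
        · simp only [TrivSqZeroExt.snd_add, TrivSqZeroExt.snd_inl, TrivSqZeroExt.snd_inr,
            TrivSqZeroExt.snd_smul, zero_add, DividedPowerAlgebra.dp_smul, map_smul, smul_eq_mul,
            smul_smul]
          congr 1
          ring)
    (fun k p x => by
      cases k with
      | zero => cases p <;> ext <;> simp [DividedPowerAlgebra.dp_zero]
      | succ k =>
        cases p with
        | zero => ext <;> simp [DividedPowerAlgebra.dp_zero]
        | succ p =>
          ext
          · simp [DividedPowerAlgebra.dp_mul]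
          · have e : k + 1 + (p + 1) = k + p + 1 + 1 := by omega
            have h1 := DividedPowerAlgebra.dp_mul (R := R) (n := k + 1) (p := p) (m := x)
            have h2 := DividedPowerAlgebra.dp_mul (R := R) (n := k) (p := p + 1) (m := x)
            have e1 : k + 1 + p = k + p + 1 := by omega
            have e2 : k + (p + 1) = k + p + 1 := by omega
            rw [e1] at h1
            rw [e2] at h2
            have hc : (k + p + 1 + 1).choose (k + 1) =
                (k + p + 1).choose k + (k + p + 1).choose (k + 1) :=
              Nat.choose_succ_succ _ _
            simp only [e, TrivSqZeroExt.snd_add, TrivSqZeroExt.snd_inl, TrivSqZeroExt.snd_inr,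
              TrivSqZeroExt.snd_mul, TrivSqZeroExt.fst_add, TrivSqZeroExt.fst_inl,
              TrivSqZeroExt.fst_inr, TrivSqZeroExt.snd_smul, zero_add, add_zero, smul_eq_mul,
              MulOpposite.smul_eq_mul_unop, MulOpposite.unop_op, mul_smul_comm, smul_mul_assoc,
              h1, h2, hc, add_smul, smul_add]
            rw [smul_comm (a x), smul_comm (a x), add_comm, show (k + 1).add p = k + p + 1 from e1]
            simp)
    (fun k x y => by
      cases k with
      | zero => ext <;> simp [DividedPowerAlgebra.dp_zero]
      | succ k =>
        ext
        · simp [DividedPowerAlgebra.dp_add, TrivSqZeroExt.fst_sum]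
        · simp only [TrivSqZeroExt.snd_add, TrivSqZeroExt.snd_inl, TrivSqZeroExt.snd_inr,
            TrivSqZeroExt.snd_sum, TrivSqZeroExt.snd_mul, TrivSqZeroExt.fst_add,
            TrivSqZeroExt.fst_inl, TrivSqZeroExt.fst_inr, zero_add, add_zero, smul_eq_mul,
            MulOpposite.smul_eq_mul_unop, MulOpposite.unop_op, map_add,
            DividedPowerAlgebra.dp_add, add_smul, Finset.sum_add_distrib]
          rw [Finset.Nat.sum_antidiagonal_succ', Finset.Nat.sum_antidiagonal_succ]
          simp only [mul_zero, zero_mul, zero_add, Finset.smul_sum, mul_smul_comm,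
            smul_mul_assoc]
          rw [add_comm])

/-- For a linear form `a` on `M`, the derivation of `D(M)` with
`x^(k) ↦ a(x) x^(k-1)` (and `x^(0) ↦ 0`). -/
def dpContract {M : Type*} [AddCommGroup M] [Module R M] (a : Module.Dual R M) :
    DividedPowerAlgebra R M →ₗ[R] DividedPowerAlgebra R M where
  toFun x := (dpDerivHom a x).snd
  map_add' x y := by simp
  map_smul' c x := by simp

/-- The projection `D(M) → D_0(M) = R`. -/
def dpAug (R : Type*) [CommRing R] (M : Type*) [AddCommGroup M] [Module R M] :
    DividedPowerAlgebra R M →ₐ[R] R :=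
  DividedPowerAlgebra.lift' (f := fun u => if u.1 = 0 then 1 else 0)
    (fun x => by simp)
    (fun k c x => by
      by_cases h : k = 0 <;> simp [h])
    (fun k p x => by
      by_cases h : k = 0 <;> by_cases h' : p = 0 <;> simp [h, h'])
    (fun k x y => by
      cases k with
      | zero => simp
      | succ k =>
        rw [Finset.Nat.sum_antidiagonal_succ]
        simp)

end Maps

section Bicomplex

variable (R : Type*) [CommRing R]

/-- The submodule of `X ⊗ Y ⊗ Z` spanned by the `a ⊗ b ⊗ c` with `a ∈ A`, `b ∈ B`, `c ∈ C`.  When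
`A`, `B`, `C` are graded pieces of the graded algebras `X`, `Y`, `Z` (hence direct summands), this
is the tensor product `A ⊗ B ⊗ C`. -/
def tensorPiece {R : Type*} [CommRing R] {X Y Z : Type*} [AddCommGroup X] [Module R X]
    [AddCommGroup Y] [Module R Y] [AddCommGroup Z] [Module R Z]
    (A : Submodule R X) (B : Submodule R Y) (C : Submodule R Z) :
    Submodule R (X ⊗[R] (Y ⊗[R] Z)) :=
  LinearMap.range (TensorProduct.map A.subtype (TensorProduct.map B.subtype C.subtype))

variable (H G F : Type*) [AddCommGroup H] [Module R H] [AddCommGroup G] [Module R G]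
  [AddCommGroup F] [Module R F]

/-- `D(H) ⊗ ⋀G ⊗ S(F)`. -/
abbrev WestTotal : Type _ :=
  DividedPowerAlgebra R H ⊗[R] (ExteriorAlgebra R G ⊗[R] SymmetricAlgebra R F)

/-- `S(H*) ⊗ ⋀G ⊗ S(F)`. -/
abbrev EastTotal : Type _ :=
  SymmetricAlgebra R (Module.Dual R H) ⊗[R] (ExteriorAlgebra R G ⊗[R] SymmetricAlgebra R F)

/-- The module `(D(H) ⊗ ⋀G ⊗ S(F)) × (S(H*) ⊗ ⋀G ⊗ S(F))`, which contains all the modules of the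
bicomplexes as submodules. -/
def Total : Type _ := WestTotal R H G F × EastTotal R H G F

instance instAddCommGroupTotal : AddCommGroup (Total R H G F) :=
  inferInstanceAs (AddCommGroup (WestTotal R H G F × EastTotal R H G F))

instance instModuleTotal : Module R (Total R H G F) :=
  inferInstanceAs (Module R (WestTotal R H G F × EastTotal R H G F))

/-- The inclusion of `D(H) ⊗ ⋀G ⊗ S(F)` into the total module. -/
def inWest : WestTotal R H G F →ₗ[R] Total R H G F :=
  LinearMap.inl R (WestTotal R H G F) (EastTotal R H G F)

/-- The inclusion of `S(H*) ⊗ ⋀G ⊗ S(F)` into the total module. -/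
def inEast : EastTotal R H G F →ₗ[R] Total R H G F :=
  LinearMap.inr R (WestTotal R H G F) (EastTotal R H G F)

/-- The projection of the total module onto `D(H) ⊗ ⋀G ⊗ S(F)`. -/
def outWest : Total R H G F →ₗ[R] WestTotal R H G F :=
  LinearMap.fst R (WestTotal R H G F) (EastTotal R H G F)

/-- The projection of the total module onto `S(H*) ⊗ ⋀G ⊗ S(F)`. -/
def outEast : Total R H G F →ₗ[R] EastTotal R H G F :=
  LinearMap.snd R (WestTotal R H G F) (EastTotal R H G F)

/-- The module `C^{p,q}` of the lower part `𝒞(t)` (for `t ≥ 0`) of the Koszul bicomplex, where `l`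
is the rank of `H`: it is `D_{t-p}(H) ⊗ ⋀^{p-q} G ⊗ S_q(F)` if `p ≤ t`, and
`S_{p-t-1}(H*) ⊗ ⋀^{p+l-1-q} G ⊗ S_q(F)` if `p > t`; exterior powers with negative exponent
are `0`. -/
def cell (l t p q : ℕ) : Submodule R (Total R H G F) :=
  if p ≤ t then
    if q ≤ p then
      (tensorPiece (divPow R H (t - p)) (⋀[R]^(p - q) G) (symPow R F q)).map
        (inWest R H G F)
    else ⊥
  else
    if q + 1 ≤ p + l then
      (tensorPiece (symPow R (Module.Dual R H) (p - t - 1)) (⋀[R]^(p + l - 1 - q) G)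
        (symPow R F q)).map (inEast R H G F)
    else ⊥

variable {R H G F}

/-- `∂_ψ` on `⋀G ⊗ S(F)`: `y ⊗ z ↦ ∑ⱼ (y ← ψ*(fⱼ*)) ⊗ z fⱼ`.  The contraction by a linear form `a` is
`y₁ ∧ ⋯ ∧ y_k ↦ ∑ᵢ (-1)^(i-1) a(yᵢ) y₁ ∧ ⋯ ŷᵢ ⋯ ∧ y_k`. -/
def dPsi {m : ℕ} (bF : Module.Basis (Fin m) R F) (ψ : G →ₗ[R] F) :
    ExteriorAlgebra R G ⊗[R] SymmetricAlgebra R F →ₗ[R]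
      ExteriorAlgebra R G ⊗[R] SymmetricAlgebra R F :=
  ∑ j, TensorProduct.map (CliffordAlgebra.contractLeft (bF.coord j ∘ₗ ψ))
    (LinearMap.mulLeft R (SymmetricAlgebra.ι R F (bF j)))

/-- The column maps `∂_ψ : C^{p,q} → C^{p,q+1}`. -/
def colMap (H : Type*) [AddCommGroup H] [Module R H] {m : ℕ} (bF : Module.Basis (Fin m) R F)
    (ψ : G →ₗ[R] F) : Total R H G F →ₗ[R] Total R H G F :=
  inWest R H G F ∘ₗ TensorProduct.map LinearMap.id (dPsi bF ψ) ∘ₗ outWest R H G F +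
    inEast R H G F ∘ₗ TensorProduct.map LinearMap.id (dPsi bF ψ) ∘ₗ outEast R H G F

/-- `y ⊗ z ↦ (w ∧ y) ⊗ z` on `⋀G ⊗ S(F)`. -/
def wedgeLeft (F : Type*) [AddCommGroup F] [Module R F] (w : ExteriorAlgebra R G) :
    ExteriorAlgebra R G ⊗[R] SymmetricAlgebra R F →ₗ[R]
      ExteriorAlgebra R G ⊗[R] SymmetricAlgebra R F :=
  TensorProduct.map (LinearMap.mulLeft R w) LinearMap.id

/-- `d_φ` on `D(H) ⊗ ⋀G ⊗ S(F)`: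
`x₁^(k₁) ⋯ x_p^(k_p) ⊗ y ⊗ z ↦ ∑ⱼ x₁^(k₁) ⋯ xⱼ^(kⱼ-1) ⋯ x_p^(k_p) ⊗ φ(xⱼ) ∧ y ⊗ z`, written with the
dual bases `h₁, …, h_l` and `h₁*, …, h_l*`. -/
def dPhiWest (F : Type*) [AddCommGroup F] [Module R F] {l : ℕ} (bH : Module.Basis (Fin l) R H)
    (φ : H →ₗ[R] G) : WestTotal R H G F →ₗ[R] WestTotal R H G F :=
  ∑ j, TensorProduct.map (dpContract (bH.coord j))
    (wedgeLeft F (ExteriorAlgebra.ι R (φ (bH j))))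

/-- `d_φ` on `S(H*) ⊗ ⋀G ⊗ S(F)`: `x ⊗ y ⊗ z ↦ ∑ⱼ hⱼ* x ⊗ φ(hⱼ) ∧ y ⊗ z`. -/
def dPhiEast (F : Type*) [AddCommGroup F] [Module R F] {l : ℕ} (bH : Module.Basis (Fin l) R H)
    (φ : H →ₗ[R] G) : EastTotal R H G F →ₗ[R] EastTotal R H G F :=
  ∑ j, TensorProduct.map (LinearMap.mulLeft R (SymmetricAlgebra.ι R _ (bH.coord j)))
    (wedgeLeft F (ExteriorAlgebra.ι R (φ (bH j))))

/-- `ν^φ`, from `D_0(H) ⊗ ⋀G ⊗ S(F)` to `S_0(H*) ⊗ ⋀G ⊗ S(F)`: left multiplication by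
`φ(h₁) ∧ ⋯ ∧ φ(h_l)`, extended by `0` to the `D_k(H) ⊗ ⋀G ⊗ S(F)` with `k > 0`. -/
def nuPhi (F : Type*) [AddCommGroup F] [Module R F] {l : ℕ} (bH : Module.Basis (Fin l) R H)
    (φ : H →ₗ[R] G) : WestTotal R H G F →ₗ[R] EastTotal R H G F :=
  TensorProduct.map
    (Algebra.linearMap R (SymmetricAlgebra R (Module.Dual R H)) ∘ₗ (dpAug R H).toLinearMap)
    (wedgeLeft F (ExteriorAlgebra.ιMulti R l fun j => φ (bH j)))

/-- The row maps `C^{p,q} → C^{p+1,q}` of the `q`-th row: `d_φ` if `p ≠ t`, and `± ν^φ` if `p = t`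
(note that `d_φ` vanishes on `D_0(H) ⊗ ⋀G ⊗ S(F)`, and `ν^φ` on `D_k(H) ⊗ ⋀G ⊗ S(F)` for `k > 0`).
The sign is such that all squares of the bicomplex anticommute. -/
def rowMap {l : ℕ} (bH : Module.Basis (Fin l) R H) (φ : H →ₗ[R] G) (q : ℕ) :
    Total R H G F →ₗ[R] Total R H G F :=
  inWest R H G F ∘ₗ dPhiWest F bH φ ∘ₗ outWest R H G F +
    ((-1 : R) ^ ((l + 1) * q)) • (inEast R H G F ∘ₗ nuPhi F bH φ ∘ₗ outWest R H G F) +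
    inEast R H G F ∘ₗ dPhiEast F bH φ ∘ₗ outEast R H G F

variable {l m : ℕ} (bH : Module.Basis (Fin l) R H) (bF : Module.Basis (Fin m) R F)
  (φ : H →ₗ[R] G) (ψ : G →ₗ[R] F) (t : ℕ)

/-! ### The kernel complex `𝒩(t)` and its homology -/

/-- `N^p = Ker (∂_ψ : C^{p,0} → C^{p,1})`. -/
def kerN (H : Type*) [AddCommGroup H] [Module R H] (l : ℕ) {m : ℕ}
    (bF : Module.Basis (Fin m) R F) (ψ : G →ₗ[R] F) (t p : ℕ) : Submodule R (Total R H G F) :=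
  cell R H G F l t p 0 ⊓ LinearMap.ker (colMap H bF ψ)

/-- The cycles of `𝒩(t)` at `N^p`. -/
def cyclesN (p : ℕ) : Submodule R (Total R H G F) :=
  kerN H l bF ψ t p ⊓ LinearMap.ker (rowMap bH φ 0)

/-- The boundaries of `𝒩(t)` at `N^p`. -/
def boundariesN : ℕ → Submodule R (Total R H G F)
  | 0 => ⊥
  | p + 1 => (kerN H l bF ψ t p).map (rowMap bH φ 0)

/-- The homology `H̄^p` of the complex `𝒩(t)` at `N^p`. -/
abbrev HBar (p : ℕ) : Type _ :=
  cyclesN bH bF φ ψ t p ⧸ (boundariesN bH bF φ ψ t p).submoduleOf (cyclesN bH bF φ ψ t p)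

/-! ### The column homology -/

/-- The cycles of the `p`-th column at `C^{p,q}`. -/
def cyclesPsi (H : Type*) [AddCommGroup H] [Module R H] (l : ℕ) {m : ℕ}
    (bF : Module.Basis (Fin m) R F) (ψ : G →ₗ[R] F) (t p q : ℕ) : Submodule R (Total R H G F) :=
  cell R H G F l t p q ⊓ LinearMap.ker (colMap H bF ψ)

/-- The boundaries at `C^{p,q}` of the `p`-th column `0 → N^p → C^{p,0} → C^{p,1} → ⋯`. -/
def boundariesPsi (H : Type*) [AddCommGroup H] [Module R H] (l : ℕ) {m : ℕ}
    (bF : Module.Basis (Fin m) R F) (ψ : G →ₗ[R] F) (t p : ℕ) : ℕ → Submodule R (Total R H G F)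
  | 0 => kerN H l bF ψ t p
  | q + 1 => (cell R H G F l t p q).map (colMap H bF ψ)

/-- The column homology `H_ψ^{p,q}` at `C^{p,q}`. -/
abbrev HPsi (H : Type*) [AddCommGroup H] [Module R H] (l : ℕ) {m : ℕ}
    (bF : Module.Basis (Fin m) R F) (ψ : G →ₗ[R] F) (t p q : ℕ) : Type _ :=
  cyclesPsi H l bF ψ t p q ⧸
    (boundariesPsi H l bF ψ t p q).submoduleOf (cyclesPsi H l bF ψ t p q)

/-! ### The corner modules and the natural maps -/

/-- `C = Coker ψ`. -/
abbrev Coker (ψ : G →ₗ[R] F) : Type _ := F ⧸ LinearMap.range ψ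

/-- `D_a(H) ⊗ S_k(F) = D_a(H) ⊗ ⋀^0 G ⊗ S_k(F)`, as a part of the total module. -/
def westCorner (H G F : Type*) [AddCommGroup H] [Module R H] [AddCommGroup G] [Module R G]
    [AddCommGroup F] [Module R F] (a k : ℕ) :
    divPow R H a ⊗[R] symPow R F k →ₗ[R] Total R H G F :=
  inWest R H G F ∘ₗ
    TensorProduct.map (divPow R H a).subtype
      (TensorProduct.mk R (ExteriorAlgebra R G) (SymmetricAlgebra R F) 1 ∘ₗ (symPow R F k).subtype)

/-- `S_a(H*) ⊗ S_k(F) = S_a(H*) ⊗ ⋀^0 G ⊗ S_k(F)`, as a part of the total module. -/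
def eastCorner (H G F : Type*) [AddCommGroup H] [Module R H] [AddCommGroup G] [Module R G]
    [AddCommGroup F] [Module R F] (a k : ℕ) :
    symPow R (Module.Dual R H) a ⊗[R] symPow R F k →ₗ[R] Total R H G F :=
  inEast R H G F ∘ₗ
    TensorProduct.map (symPow R (Module.Dual R H) a).subtype
      (TensorProduct.mk R (ExteriorAlgebra R G) (SymmetricAlgebra R F) 1 ∘ₗ (symPow R F k).subtype)

/-- The canonical map `A ⊗ S_k(F) → A ⊗ S_k(C)`, `C = Coker ψ`. -/
def toCoker (A : Type*) [AddCommMonoid A] [Module R A] (ψ : G →ₗ[R] F) (k : ℕ) :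
    A ⊗[R] symPow R F k →ₗ[R] A ⊗[R] symPow R (Coker ψ) k :=
  TensorProduct.map LinearMap.id (symPowMap (LinearMap.range ψ).mkQ k)

/-- The staircase relation between elements `x` of `C^{i,0}` and `z` of `C^{i-1-q,q}`: there are
`yⱼ ∈ C^{i-1-j,j}`, `0 ≤ j ≤ q`, with `x = d y₀`, `∂ yⱼ = d yⱼ₊₁` for `j < q`, and `y_q = z`, where
`d` and `∂` are the row and column maps. -/
def Staircase (i q : ℕ) (x z : Total R H G F) : Prop :=
  ∃ y : ℕ → Total R H G F, (∀ j ≤ q, y j ∈ cell R H G F l t (i - 1 - j) j) ∧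
    rowMap bH φ 0 (y 0) = x ∧
    (∀ j < q, colMap H bF ψ (y j) = rowMap bH φ (j + 1) (y (j + 1))) ∧ y q = z

/-- `f : H̄^i → A ⊗ S_q(C)` is the staircase map: it sends the class of a cycle `x ∈ N^i` to the class
of an element of `A ⊗ S_q(F) ⊆ C^{i-1-q,q}` at the other end of a staircase starting at `x`. -/
def IsStaircaseToCorner {A : Type*} [AddCommMonoid A] [Module R A] (i q : ℕ)
    (incl : A ⊗[R] symPow R F q →ₗ[R] Total R H G F)
    (f : HBar bH bF φ ψ t i → A ⊗[R] symPow R (Coker ψ) q) : Prop :=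
  ∀ (x : cyclesN bH bF φ ψ t i) (c : A ⊗[R] symPow R (Coker ψ) q),
    f (Submodule.Quotient.mk x) = c ↔
      ∃ w : A ⊗[R] symPow R F q, toCoker A ψ q w = c ∧
        Staircase bH bF φ ψ t i q (x : Total R H G F) (incl w)

/-- `g : A ⊗ S_q(C) → H_ψ^{p,q}` is the map induced by the row map `C^{p-1,q} → C^{p,q}` on
`A ⊗ S_q(F) = C^{p-1,q}`. -/
def IsInducedByRowMap {A : Type*} [AddCommMonoid A] [Module R A] (p q : ℕ)
    (incl : A ⊗[R] symPow R F q →ₗ[R] Total R H G F)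
    (g : A ⊗[R] symPow R (Coker ψ) q → HPsi H l bF ψ t p q) : Prop :=
  ∀ w : A ⊗[R] symPow R F q, ∃ z : cyclesPsi H l bF ψ t p q,
    (z : Total R H G F) = rowMap bH φ q (incl w) ∧
      g (toCoker A ψ q w) = Submodule.Quotient.mk z

/-- `e : H_ψ^{p,q} → H̄^i`, where `i = p + q + 1`, is the staircase map: it sends the class of a cycle
`z ∈ C^{p,q}` to the class of a cycle `x` at the other end of a staircase ending at `z`. -/
def IsStaircaseFromColumn (p q i : ℕ) (e : HPsi H l bF ψ t p q → HBar bH bF φ ψ t i) : Prop :=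
  ∀ (z : cyclesPsi H l bF ψ t p q) (c : HBar bH bF φ ψ t i),
    e (Submodule.Quotient.mk z) = c ↔
      ∃ x : cyclesN bH bF φ ψ t i, Submodule.Quotient.mk x = c ∧
        Staircase bH bF φ ψ t i q (x : Total R H G F) (z : Total R H G F)

/-- There is a natural exact sequence
`0 → H̄^i → A ⊗ S_q(C) → H_ψ^{p,q} → H̄^{i+1} → 0` (where `i = p + q` and `A ⊗ S_q(F) = C^{p-1,q}` via
`incl`): its first and third map are the staircase maps of the bicomplex, the one in the middle is
induced by the row map `C^{p-1,q} → C^{p,q}`. -/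
def HasNaturalSequence {A : Type*} [AddCommMonoid A] [Module R A] (i p q : ℕ)
    (incl : A ⊗[R] symPow R F q →ₗ[R] Total R H G F) : Prop :=
  ∃ (f : HBar bH bF φ ψ t i →ₗ[R] A ⊗[R] symPow R (Coker ψ) q)
    (g : A ⊗[R] symPow R (Coker ψ) q →ₗ[R] HPsi H l bF ψ t p q)
    (e : HPsi H l bF ψ t p q →ₗ[R] HBar bH bF φ ψ t (i + 1)),
    Function.Injective f ∧ Function.Exact f g ∧ Function.Exact g e ∧ Function.Surjective e ∧
    IsStaircaseToCorner bH bF φ ψ t i q incl f ∧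
    IsInducedByRowMap bH bF φ ψ t p q incl g ∧
    IsStaircaseFromColumn bH bF φ ψ t p q (i + 1) e

end Bicomplex

end KoszulBicomplex

end

/-! ### Acyclicity below the grade of an ideal which kills the homology -/

noncomputable section

namespace KoszulBicomplex

open RingTheory.Sequence

/-! The rows and the columns of the bicomplex are Koszul complexes, and the theorem comes from
comparing the ranges in which they are exact.

Both have differentials of the form `∑ A j * θ j` or `∑ B j * θ j`, where `A j` and `B j` lower and
raise monomials and the `θ j` anticommute: exterior multiplication by φ(hⱼ) in the rows, contraction
by ψ*(fⱼ*) in the columns. A maximal minor δ of φ or ψ yields, through the adjugate matrix,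
operators `ι j` with θᵢιⱼ + ιⱼθᵢ = δ for i = j and 0 otherwise. The homotopies Bⱼιⱼ, respectively
Aⱼιⱼ, then show that a power of δ kills the homology, even where a lowering and a raising complex
are spliced by the product of all θⱼ. All modules are flat, so the acyclicity lemma
`seq_exact_of_isWeaklyRegular` converts this into exactness in all positions below the grade.

For the rows this gives exactness at C^{p,q} whenever p < h (`row_exact`). In a column D ⊗ ⋀^{k-q}G
⊗ S_q(F) with k > r it gives exactness for q below the grade (`colEnd_exact_of_large`). If k ≤ r,
the column is first prolonged to the left by r-k+1 terms (`colEnd_exact_of_small`), and q + (r-k) +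
1 < r amounts to k - q ≥ 2. Altogether columns are exact in the relevant range where the exterior
exponent is at least 2 (`column_exact`). For l > 1 the ideal I_φ lies in the radical of I_ψ
(`minorIdeal_le_radical`), so that h may replace g as the bound on q; hence r does not bound the
intermediate range.

The rest is a chase. By exactness of the rows, a cycle of N^i climbs a staircase along the
antidiagonal p + q = i - 1. If the staircase can be stopped at an element killed by the column map,
at a place where the column is exact, the cycle is a boundary. If it reaches a corner, where the
exterior exponent is 0, the obstruction is a class in A ⊗ S_q(C), the cokernel of the column map. On
the next antidiagonal the last relevant cell has exponent 1, and the obstruction there is the column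
homology H_ψ. The row map from the corner into that cell joins the two obstructions to a four-term
exact sequence. -/

/-- The boundaries at position `p` of a complex of submodules `K 0 → K 1 → ⋯`, preceded by `0`. -/
def bdry {R T : Type*} [CommRing R] [AddCommGroup T] [Module R T] (K : ℕ → Submodule R T)
    (d : ℕ → T →ₗ[R] T) : ℕ → Submodule R T
  | 0 => ⊥
  | p + 1 => (K p).map (d p)

/-- The boundaries at position `p` of a complex `K 0 → K 1 → ⋯`, preceded by `0`. -/
def seqBdry {R : Type*} [CommRing R] {K : ℕ → Type*} [∀ i, AddCommGroup (K i)]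
    [∀ i, Module R (K i)] (d : ∀ i, K i →ₗ[R] K (i + 1)) : ∀ i, Submodule R (K i)
  | 0 => ⊥
  | i + 1 => LinearMap.range (d i)

theorem quotSMulTop_mk_eq_zero {R M : Type*} [CommRing R] [AddCommGroup M] [Module R M] {x : R}
    {z : M} : (Submodule.Quotient.mk z : QuotSMulTop x M) = 0 ↔ ∃ w, z = x • w := by
  rw [Submodule.Quotient.mk_eq_zero, Submodule.mem_smul_pointwise_iff_exists]
  constructor
  · rintro ⟨w, -, rfl⟩; exact ⟨w, rfl⟩
  · rintro ⟨w, rfl⟩; exact ⟨w, trivial, rfl⟩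

theorem quotSMulTop_mk_eq_mk {R M : Type*} [CommRing R] [AddCommGroup M] [Module R M] {x : R}
    {z z' : M} : (Submodule.Quotient.mk z : QuotSMulTop x M) = Submodule.Quotient.mk z' ↔
      ∃ w, z = z' + x • w := by
  rw [← sub_eq_zero, ← Submodule.Quotient.mk_sub, quotSMulTop_mk_eq_zero]
  simp [sub_eq_iff_eq_add']

/-- **Acyclicity lemma.** A complex of modules on which a sequence is weakly regular, and whose
homology is killed by powers of the members of the sequence, is exact in the first positions. -/
theorem seq_exact_of_isWeaklyRegular {R : Type*} [CommRing R] (rs : List R) :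
    ∀ (K : ℕ → Type*) [∀ i, AddCommGroup (K i)] [∀ i, Module R (K i)]
      (d : ∀ i, K i →ₗ[R] K (i + 1)) (_ : ∀ i z, d (i + 1) (d i z) = 0)
      (_ : ∀ i, IsWeaklyRegular (K i) rs)
      (_ : ∀ x ∈ rs, ∀ i, ∃ N : ℕ, ∀ z, d i z = 0 → x ^ N • z ∈ seqBdry d i),
      ∀ i < rs.length, ∀ z, d i z = 0 → z ∈ seqBdry d i := by
  induction rs with
  | nil => intro K _ _ d _ _ _ i hi; simp at hi
  | cons x xs ih =>
    intro K _ _ d hdd hreg hkill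
    have hx : ∀ i, IsSMulRegular (K i) x := fun i =>
      ((isWeaklyRegular_cons_iff _ _ _).1 (hreg i)).1
    have hxs : ∀ i, IsWeaklyRegular (QuotSMulTop x (K i)) xs := fun i =>
      ((isWeaklyRegular_cons_iff _ _ _).1 (hreg i)).2
    let d' : ∀ i, QuotSMulTop x (K i) →ₗ[R] QuotSMulTop x (K (i + 1)) := fun i =>
      QuotSMulTop.map x (d i)
    have hd' : ∀ i z, d' i (Submodule.Quotient.mk z) = Submodule.Quotient.mk (d i z) :=
      fun i z => rfl
    have key := ih (fun i => QuotSMulTop x (K i)) d'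
      (by
        intro i z
        obtain ⟨z, rfl⟩ := Submodule.Quotient.mk_surjective _ z
        rw [hd', hd', hdd, Submodule.Quotient.mk_zero])
      hxs
      (by
        intro y hy i
        obtain ⟨N₁, h₁⟩ := hkill y (List.mem_cons_of_mem _ hy) i
        obtain ⟨N₂, h₂⟩ := hkill y (List.mem_cons_of_mem _ hy) (i + 1)
        -- If d z = x w, then w is a cycle by regularity of x, and y^N₂ w = d v for some v. Hence
        -- y^N₂ z - x v is a cycle of the original complex, which y^N₁ turns into a boundary.
        refine ⟨N₁ + N₂, fun z hz => ?_⟩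
        obtain ⟨z, rfl⟩ := Submodule.Quotient.mk_surjective _ z
        rw [hd', quotSMulTop_mk_eq_zero] at hz
        obtain ⟨w, hw⟩ := hz
        have hdw : d (i + 1) w = 0 := by
          apply hx (i + 1 + 1)
          change x • d (i + 1) w = x • 0
          rw [← map_smul, ← hw, hdd, smul_zero]
        obtain ⟨v, hv⟩ := h₂ w hdw
        have hc : d i (y ^ N₂ • z - x • v) = 0 := by
          rw [map_sub, map_smul, map_smul, hw, hv, smul_comm, sub_self]
        have hb := h₁ _ hc
        have e : y ^ (N₁ + N₂) • z = y ^ N₁ • (y ^ N₂ • z - x • v) + x • (y ^ N₁ • v) := by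
          rw [smul_sub, smul_smul, ← pow_add, smul_comm x, sub_add_cancel]
        cases i with
        | zero =>
          rw [seqBdry, Submodule.mem_bot] at hb ⊢
          rw [← Submodule.Quotient.mk_smul, quotSMulTop_mk_eq_zero, e, hb, zero_add]
          exact ⟨_, rfl⟩
        | succ i =>
          obtain ⟨u, hu⟩ := hb
          refine ⟨Submodule.Quotient.mk u, ?_⟩
          rw [hd', hu, ← Submodule.Quotient.mk_smul, e]
          symm
          rw [quotSMulTop_mk_eq_mk]
          exact ⟨_, rfl⟩)
    -- Multiplication by x is injective on the homology at position i because the homology of K/xK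
    -- at i - 1 vanishes by induction. This shift gains the one position by which `x :: xs` is
    -- longer than `xs`.
    have inj : ∀ i < xs.length + 1, ∀ z, d i z = 0 → x • z ∈ seqBdry d i → z ∈ seqBdry d i := by
      intro i hi z hz hxz
      cases i with
      | zero =>
        rw [seqBdry, Submodule.mem_bot] at hxz ⊢
        exact hx 0 (hxz.trans (smul_zero x).symm)
      | succ i =>
        obtain ⟨w, hw⟩ := hxz
        have h1 : d' i (Submodule.Quotient.mk w) = 0 := by
          rw [hd', quotSMulTop_mk_eq_zero]; exact ⟨z, hw⟩
        have h2 := key i (by omega) _ h1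
        have h3 : ∃ v : K i, v ∈ seqBdry d i ∧ ∃ u, w = v + x • u := by
          cases i with
          | zero =>
            rw [seqBdry, Submodule.mem_bot, quotSMulTop_mk_eq_zero] at h2
            obtain ⟨u, hu⟩ := h2
            exact ⟨0, zero_mem _, u, by rw [hu, zero_add]⟩
          | succ i =>
            obtain ⟨v, hv⟩ := h2
            obtain ⟨v, rfl⟩ := Submodule.Quotient.mk_surjective _ v
            rw [hd'] at hv
            obtain ⟨u, hu⟩ := quotSMulTop_mk_eq_mk.1 hv.symm
            exact ⟨d i v, ⟨v, rfl⟩, u, hu⟩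
        obtain ⟨v, hv, u, rfl⟩ := h3
        have hdv : d i v = 0 := by
          cases i with
          | zero => rw [seqBdry, Submodule.mem_bot] at hv; rw [hv, map_zero]
          | succ i => obtain ⟨v, rfl⟩ := hv; exact hdd _ _
        refine ⟨u, hx (i + 1) ?_⟩
        change x • d i u = x • z
        rw [← hw, map_add, hdv, zero_add, map_smul]
    intro i hi z hz
    -- A power of x kills the homology, on which x acts injectively.
    obtain ⟨N, hN⟩ := hkill x List.mem_cons_self i
    replace hN := hN z hz
    induction N with
    | zero => simpa using hN
    | succ N ihN =>
      refine ihN (inj i (by simpa using hi) _ ?_ ?_)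
      · rw [map_smul, hz, smul_zero]
      · rwa [smul_smul, ← pow_succ']

theorem isWeaklyRegular_of_flat {R M : Type*} [CommRing R] [AddCommGroup M] [Module R M]
    [Module.Flat R M] {rs : List R} (h : IsWeaklyRegular R rs) : IsWeaklyRegular M rs :=
  (LinearEquiv.isWeaklyRegular_congr (TensorProduct.lid R M) rs).1
    (h.isWeaklyRegular_rTensor (M₂ := M))

/-- A complex of flat submodules, whose homology is killed by powers of the elements of an ideal
`I`, is exact in the positions below the grade of `I`. -/
theorem exact_of_lt_idealGrade {R T : Type*} [CommRing R] [AddCommGroup T] [Module R T]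
    {K : ℕ → Submodule R T} {d : ℕ → T →ₗ[R] T} (hK : ∀ p, ∀ x ∈ K p, d p x ∈ K (p + 1))
    (hdd : ∀ p, ∀ x ∈ K p, d (p + 1) (d p x) = 0) (hflat : ∀ p, Module.Flat R (K p))
    {I : Ideal R}
    (hkill : ∀ y ∈ I, ∀ p, ∃ N : ℕ, ∀ x ∈ K p, d p x = 0 → y ^ N • x ∈ bdry K d p)
    {p : ℕ} (hp : (p : ℕ∞) < idealGrade I) : ∀ x ∈ K p, d p x = 0 → x ∈ bdry K d p := by
  rw [idealGrade, lt_iSup_iff] at hp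
  obtain ⟨rs, hp⟩ := hp
  rw [lt_iSup_iff] at hp
  obtain ⟨⟨hI, hrs⟩, hp⟩ := hp
  let d' : ∀ i, K i →ₗ[R] K (i + 1) := fun i => (d i).restrict (hK i)
  have hd' : ∀ i z, (d' i z : T) = d i z := fun i z => rfl
  have hb : ∀ i (z : K i), z ∈ seqBdry d' i ↔ (z : T) ∈ bdry K d i := by
    intro i z
    cases i with
    | zero => simp [seqBdry, bdry]
    | succ i =>
      constructor
      · rintro ⟨w, rfl⟩
        exact ⟨w, w.2, rfl⟩
      · rintro ⟨w, hw, hwz⟩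
        exact ⟨⟨w, hw⟩, Subtype.ext hwz⟩
  intro x hx hdx
  have := seq_exact_of_isWeaklyRegular rs (fun i => K i) d'
    (fun i z => Subtype.ext (hdd i z z.2)) (fun i => isWeaklyRegular_of_flat hrs)
    (fun y hy i => by
      obtain ⟨N, hN⟩ := hkill y (hI y hy) i
      refine ⟨N, fun z hz => (hb _ _).2 (hN z z.2 ?_)⟩
      rw [← hd', hz]; rfl)
    p (by exact_mod_cast hp) ⟨x, hx⟩ (Subtype.ext hdx)
  exact (hb _ _).1 this

/-- The elements of a ring, some power of which maps a submodule `Z` into a submodule `B`, form an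
ideal. -/
theorem exists_pow_smul_mem_of_mem_span {R T : Type*} [CommRing R] [AddCommGroup T] [Module R T]
    {Z : Set T} {B : Submodule R T} {S : Set R}
    (hS : ∀ y ∈ S, ∃ N : ℕ, ∀ x ∈ Z, y ^ N • x ∈ B) {y : R} (hy : y ∈ (Ideal.span S).radical) :
    ∃ N : ℕ, ∀ x ∈ Z, y ^ N • x ∈ B := by
  -- A power of y lying in this colon ideal provides one exponent that serves all of Z at once.
  let a : Ideal R :=
    { carrier := {y | ∀ x ∈ Z, y • x ∈ B}
      add_mem' := fun ha hb x hx => by rw [add_smul]; exact B.add_mem (ha x hx) (hb x hx)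
      zero_mem' := fun x _ => by rw [zero_smul]; exact B.zero_mem
      smul_mem' := fun c y hy x hx => by
        rw [smul_eq_mul, mul_smul]; exact B.smul_mem _ (hy x hx) }
  have h1 : Ideal.span S ≤ a.radical := by
    rw [Ideal.span_le]
    intro y hy
    obtain ⟨N, hN⟩ := hS y hy
    exact ⟨N, hN⟩
  have h2 : (Ideal.span S).radical ≤ a.radical := by
    rw [← Ideal.radical_idem a]; exact Ideal.radical_mono h1
  obtain ⟨N, hN⟩ := h2 hy
  exact ⟨N, hN⟩

end KoszulBicomplex

end

/-! ### Homotopies for Koszul complexes, in terms of abstract operators -/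

noncomputable section

namespace KoszulBicomplex

/-- Each sⱼ is a homotopy between c and πⱼ for the differential ∑ dᵢ, and homotopies compose. The
subgroup 𝒮 records where the composed homotopy maps to, so that degrees can be controlled later. -/
theorem exists_homotopy {E : Type*} [Ring E] {l : ℕ} {d s π : Fin l → E} {c : E}
    (hc : ∀ x, Commute c x)
    (h1 : ∀ i j, d i * s j + s j * d i = if i = j then c - π j else 0)
    (h2 : ∀ i j, π j * d i = d i * π j) (𝒮 : AddSubgroup E) (hs : ∀ n j, c ^ n * s j ∈ 𝒮)
    (hπ : ∀ j, ∀ x ∈ 𝒮, π j * x ∈ 𝒮) (L : List (Fin l)) :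
    ∃ S ∈ 𝒮, (∑ i, d i) * S + S * (∑ i, d i) = c ^ L.length - (L.map π).prod := by
  have hD : ∀ j, (∑ i, d i) * s j + s j * (∑ i, d i) = c - π j := by
    intro j
    rw [Finset.sum_mul, Finset.mul_sum, ← Finset.sum_add_distrib]
    simp [h1]
  have hπD : ∀ j, π j * (∑ i, d i) = (∑ i, d i) * π j := by
    intro j
    rw [Finset.sum_mul, Finset.mul_sum]
    exact Finset.sum_congr rfl fun i _ => h2 i j
  induction L with
  | nil => exact ⟨0, zero_mem _, by simp⟩
  | cons j L ih =>
    obtain ⟨S, hS, e⟩ := ih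
    -- With n = `L.length` and Π the product over L, this reflects c^(n+1) - πⱼΠ = c^n (c - πⱼ) + πⱼ
    -- (c^n - Π).
    refine ⟨c ^ L.length * s j + π j * S, add_mem (hs _ _) (hπ _ _ hS), ?_⟩
    have e1 : (∑ i, d i) * (c ^ L.length * s j) = c ^ L.length * ((∑ i, d i) * s j) := by
      rw [← mul_assoc, ← ((hc (∑ i, d i)).pow_left _).eq, mul_assoc]
    have e2 : (∑ i, d i) * (π j * S) = π j * ((∑ i, d i) * S) := by
      rw [← mul_assoc, ← hπD, mul_assoc]
    calc (∑ i, d i) * (c ^ L.length * s j + π j * S)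
          + (c ^ L.length * s j + π j * S) * (∑ i, d i)
        = c ^ L.length * ((∑ i, d i) * s j + s j * (∑ i, d i))
          + π j * ((∑ i, d i) * S + S * (∑ i, d i)) := by
          rw [mul_add, add_mul, e1, e2, mul_add, mul_add, mul_assoc, mul_assoc]; abel
      _ = c ^ (j :: L).length - ((j :: L).map π).prod := by
          rw [hD, e, List.length_cons, List.map_cons, List.prod_cons, mul_sub, mul_sub, pow_succ,
            ((hc (π j)).pow_left _).eq]
          abel

theorem list_map_mul_prod {E α : Type*} [Monoid E] {e ρ : α → E}
    (h : ∀ i j, Commute (e i) (ρ j)) (L : List α) :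
    (L.map fun j => e j * ρ j).prod = (L.map ρ).prod * (L.map e).prod := by
  induction L with
  | nil => simp
  | cons j L ih =>
    simp only [List.map_cons, List.prod_cons, ih]
    have : Commute (e j) (ρ j * (L.map ρ).prod) :=
      (h j j).mul_right (Commute.list_prod_right _ _ (by simpa using fun a _ => h j a))
    rw [mul_assoc, ← mul_assoc (ρ j), ← mul_assoc (e j), this.eq]
    simp only [mul_assoc]

theorem list_prod_mul_of_anti {E α : Type*} [Ring E] {θ : α → E} {y : E}
    (h : ∀ i, θ i * y = -(y * θ i)) (L : List α) :
    (L.map θ).prod * y = (-1) ^ L.length * (y * (L.map θ).prod) := by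
  induction L with
  | nil => simp
  | cons i L ih =>
    simp only [List.map_cons, List.prod_cons, List.length_cons]
    rw [mul_assoc, ih, ← mul_assoc, ((Commute.neg_one_right (θ i)).pow_right L.length).eq,
      mul_assoc, ← mul_assoc (θ i), h i, pow_succ]
    simp [mul_assoc]

theorem list_prod_mul_eq_zero {E α : Type*} [Ring E] {θ : α → E} (h1 : ∀ i, θ i * θ i = 0)
    (h2 : ∀ i j, θ i * θ j = -(θ j * θ i)) {L : List α} {j : α} (hj : j ∈ L) :
    (L.map θ).prod * θ j = 0 := by
  induction L with
  | nil => simp at hj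
  | cons i L ih =>
    rw [List.map_cons, List.prod_cons, mul_assoc]
    rcases List.mem_cons.1 hj with rfl | hj
    · rw [list_prod_mul_of_anti fun i => h2 i j, ← mul_assoc,
        ((Commute.neg_one_right (θ j)).pow_right L.length).eq, mul_assoc, ← mul_assoc (θ j), h1,
        zero_mul, mul_zero]
    · rw [ih hj, mul_zero]

theorem mul_list_prod_eq_zero {E α : Type*} [Ring E] {θ : α → E} (h1 : ∀ i, θ i * θ i = 0)
    (h2 : ∀ i j, θ i * θ j = -(θ j * θ i)) {L : List α} {j : α} (hj : j ∈ L) :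
    θ j * (L.map θ).prod = 0 := by
  have h := list_prod_mul_eq_zero h1 h2 hj
  rw [list_prod_mul_of_anti fun i => h2 i j] at h
  rcases neg_one_pow_eq_or E L.length with h' | h' <;> simpa [h'] using h

theorem sum_mul_self_eq_zero {E : Type*} [Ring E] {l : ℕ} {C θ : Fin l → E}
    (hC : ∀ i j, Commute (C i) (C j)) (hCθ : ∀ i j, Commute (C i) (θ j))
    (h1 : ∀ i, θ i * θ i = 0) (h2 : ∀ i j, θ i * θ j = -(θ j * θ i)) :
    (∑ j, C j * θ j) * (∑ j, C j * θ j) = 0 := by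
  have e : ∀ i j, C i * θ i * (C j * θ j) = C i * C j * (θ i * θ j) := fun i j => by
    rw [mul_assoc, ← mul_assoc (θ i), ← (hCθ j i).eq]; simp only [mul_assoc]
  rw [Finset.sum_mul_sum, ← Finset.sum_product']
  -- The terms (i,j) and (j,i) cancel, since the Cᵢ commute and the θᵢ anticommute; the diagonal
  -- terms vanish because θᵢ² = 0.
  refine Finset.sum_involution (fun a _ => a.swap) ?_ ?_ ?_ ?_
  · rintro ⟨i, j⟩ _
    simp only [Prod.swap, e]
    rw [(hC i j).eq, h2 i j]
    simp
  · rintro ⟨i, j⟩ _ hne heq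
    simp only [Prod.swap, Prod.mk.injEq] at heq
    obtain ⟨rfl, -⟩ := heq
    apply hne
    simp [e, h1]
  · intros; simp
  · rintro ⟨i, j⟩ _; rfl

theorem sum_mul_sum_anti {E : Type*} [Ring E] {l m : ℕ} {C θ : Fin l → E} {C' θ' : Fin m → E}
    (hC : ∀ i j, Commute (C i) (C' j)) (h1 : ∀ i j, Commute (C i) (θ' j))
    (h2 : ∀ i j, Commute (θ i) (C' j)) (h3 : ∀ i j, θ i * θ' j = -(θ' j * θ i)) :
    (∑ i, C i * θ i) * (∑ j, C' j * θ' j) = -((∑ j, C' j * θ' j) * (∑ i, C i * θ i)) := by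
  rw [Finset.sum_mul_sum, Finset.sum_mul_sum, Finset.sum_comm, ← Finset.sum_neg_distrib]
  refine Finset.sum_congr rfl fun j _ => ?_
  rw [← Finset.sum_neg_distrib]
  refine Finset.sum_congr rfl fun i _ => ?_
  calc C i * θ i * (C' j * θ' j) = C i * (θ i * C' j) * θ' j := by simp only [mul_assoc]
    _ = (C i * C' j) * (θ i * θ' j) := by rw [(h2 i j).eq]; simp only [mul_assoc]
    _ = -(C' j * (C i * θ' j) * θ i) := by rw [(hC i j).eq, h3]; simp only [mul_assoc, mul_neg]
    _ = -(C' j * θ' j * (C i * θ i)) := by rw [(h1 i j).eq]; simp only [mul_assoc]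

theorem mul_sum_anti {E : Type*} [Ring E] {m : ℕ} {x : E} {C θ : Fin m → E}
    (hC : ∀ j, Commute x (C j)) (h : ∀ j, x * θ j = -(θ j * x)) :
    x * (∑ j, C j * θ j) = -((∑ j, C j * θ j) * x) := by
  rw [Finset.mul_sum, Finset.sum_mul, ← Finset.sum_neg_distrib]
  refine Finset.sum_congr rfl fun j _ => ?_
  rw [← mul_assoc, (hC j).eq, mul_assoc, h, mul_neg, mul_assoc]

/-- Lowering and raising operators `A j`, `B j`, which commute with the anticommuting operators
`θ j`, contracted to the scalar `δ` by the operators `ι j`. -/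
structure IsKoszulSystem {R E : Type*} [CommRing R] [Ring E] [Algebra R E] {l : ℕ} (δ : R)
    (A B θ ι : Fin l → E) : Prop where
  lower_raise : ∀ j, A j * B j = 1
  lower_comm : ∀ i j, Commute (A i) (A j)
  raise_comm : ∀ i j, Commute (B i) (B j)
  lower_raise_comm : ∀ i j, i ≠ j → Commute (A i) (B j)
  theta_sq : ∀ j, θ j * θ j = 0
  theta_anti : ∀ i j, θ i * θ j = -(θ j * θ i)
  clifford : ∀ i j, θ i * ι j + ι j * θ i = if i = j then algebraMap R E δ else 0
  lower_theta : ∀ i j, Commute (A i) (θ j)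
  lower_iota : ∀ i j, Commute (A i) (ι j)
  raise_theta : ∀ i j, Commute (B i) (θ j)
  raise_iota : ∀ i j, Commute (B i) (ι j)

namespace IsKoszulSystem

section Ring

variable {R E : Type*} [CommRing R] [Ring E] [Algebra R E] {l : ℕ} {δ : R}
  {A B θ ι : Fin l → E} (h : IsKoszulSystem δ A B θ ι)

include h

theorem iota_theta (i j : Fin l) :
    ι j * θ i = (if i = j then algebraMap R E δ else 0) - θ i * ι j := by
  rw [← h.clifford i j]; abel

/-- Contracting and raising in the variable j is a homotopy for the lowering complex: AⱼBⱼ = 1,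
whereas BⱼAⱼ misses 1 by the projection onto the monomials free of variable j. For i ≠ j all
coefficients commute, and the Clifford relation gives 0. -/
theorem west_homotopy (i j : Fin l) :
    A i * θ i * (B j * ι j) + B j * ι j * (A i * θ i) =
      if i = j then algebraMap R E δ - (1 - B j * A j) * (ι j * θ j) else 0 := by
  have e1 : A i * θ i * (B j * ι j) = A i * B j * (θ i * ι j) := by
    rw [mul_assoc, ← mul_assoc (θ i), ← (h.raise_theta j i).eq]; simp only [mul_assoc]
  have e2 : B j * ι j * (A i * θ i) = B j * A i * (ι j * θ i) := by
    rw [mul_assoc, ← mul_assoc (ι j), ← (h.lower_iota i j).eq]; simp only [mul_assoc]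
  rw [e1, e2]
  split_ifs with hij
  · subst hij
    rw [h.lower_raise, one_mul, sub_mul, one_mul, eq_sub_of_add_eq (h.clifford i i),
      if_pos rfl]
    abel
  · rw [(h.lower_raise_comm i j hij).eq, ← mul_add, h.clifford, if_neg hij, mul_zero]

/-- The mirror image for the raising complex, with homotopy Aⱼιⱼ. The same projection remains, now
accompanied by θⱼιⱼ in place of ιⱼθⱼ. -/
theorem east_homotopy (i j : Fin l) :
    B i * θ i * (A j * ι j) + A j * ι j * (B i * θ i) =
      if i = j then algebraMap R E δ - (1 - B j * A j) * (θ j * ι j) else 0 := by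
  have e1 : B i * θ i * (A j * ι j) = B i * A j * (θ i * ι j) := by
    rw [mul_assoc, ← mul_assoc (θ i), ← (h.lower_theta j i).eq]; simp only [mul_assoc]
  have e2 : A j * ι j * (B i * θ i) = A j * B i * (ι j * θ i) := by
    rw [mul_assoc, ← mul_assoc (ι j), ← (h.raise_iota i j).eq]; simp only [mul_assoc]
  rw [e1, e2]
  split_ifs with hij
  · subst hij
    rw [h.lower_raise, one_mul, sub_mul, one_mul, h.iota_theta, if_pos rfl]
    abel
  · rw [(h.lower_raise_comm j i (Ne.symm hij)).eq, ← mul_add, h.clifford, if_neg hij, mul_zero]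

theorem commute_one_sub_theta (i j : Fin l) : Commute (1 - B i * A i) (θ j) :=
  (Commute.one_left _).sub_left ((h.raise_theta i j).mul_left (h.lower_theta i j))

theorem commute_one_sub_iota (i j : Fin l) : Commute (1 - B i * A i) (ι j) :=
  (Commute.one_left _).sub_left ((h.raise_iota i j).mul_left (h.lower_iota i j))

theorem theta_commute_iota_theta {i j : Fin l} (hij : i ≠ j) : Commute (θ i) (ι j * θ j) := by
  change θ i * (ι j * θ j) = ι j * θ j * θ i
  rw [← mul_assoc, eq_sub_of_add_eq (h.clifford i j), if_neg hij, zero_sub, mul_assoc (ι j),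
    h.theta_anti j i]
  simp [mul_assoc]

theorem theta_commute_theta_iota {i j : Fin l} (hij : i ≠ j) : Commute (θ i) (θ j * ι j) := by
  change θ i * (θ j * ι j) = θ j * ι j * θ i
  rw [← mul_assoc, h.theta_anti i j, mul_assoc (θ j), h.iota_theta, if_neg hij]
  simp [mul_assoc]

theorem lower_commute_one_sub {i j : Fin l} (hij : i ≠ j) : Commute (A i) (1 - B j * A j) :=
  (Commute.one_right _).sub_right ((h.lower_raise_comm i j hij).mul_right (h.lower_comm i j))

theorem raise_commute_one_sub {i j : Fin l} (hij : i ≠ j) : Commute (B i) (1 - B j * A j) :=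
  (Commute.one_right _).sub_right
    ((h.raise_comm i j).mul_right (h.lower_raise_comm j i hij.symm).symm)

theorem lower_mul_one_sub (j : Fin l) : A j * (1 - B j * A j) = 0 := by
  rw [mul_sub, mul_one, ← mul_assoc, h.lower_raise, one_mul, sub_self]

theorem one_sub_mul_raise (j : Fin l) : (1 - B j * A j) * B j = 0 := by
  rw [sub_mul, one_mul, mul_assoc, h.lower_raise, mul_one, sub_self]

/-- For i = j both products vanish, one by θᵢ² = 0 and the other by Aᵢ(1 - BᵢAᵢ) = 0. For i ≠ j the
sign arises twice, so θᵢ commutes with ιⱼθⱼ. -/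
theorem west_commute (i j : Fin l) :
    (1 - B j * A j) * (ι j * θ j) * (A i * θ i) = A i * θ i * ((1 - B j * A j) * (ι j * θ j)) := by
  by_cases hij : i = j
  · subst hij
    have e1 : (1 - B i * A i) * (ι i * θ i) * (A i * θ i) = 0 := by
      rw [mul_assoc, mul_assoc (ι i), ← mul_assoc (θ i) (A i), ← (h.lower_theta i i).eq,
        mul_assoc (A i), h.theta_sq, mul_zero, mul_zero, mul_zero]
    have e2 : A i * θ i * ((1 - B i * A i) * (ι i * θ i)) = 0 := by
      rw [mul_assoc, ← mul_assoc (θ i), ← (h.commute_one_sub_theta i i).eq, mul_assoc,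
        ← mul_assoc (A i), h.lower_mul_one_sub, zero_mul]
    rw [e1, e2]
  · have c1 : Commute (A i) ((1 - B j * A j) * (ι j * θ j)) :=
      (h.lower_commute_one_sub hij).mul_right ((h.lower_iota i j).mul_right (h.lower_theta i j))
    have c2 : Commute (θ i) ((1 - B j * A j) * (ι j * θ j)) :=
      (h.commute_one_sub_theta j i).symm.mul_right (h.theta_commute_iota_theta hij)
    exact (c1.mul_left c2).symm.eq

theorem east_commute (i j : Fin l) :
    (1 - B j * A j) * (θ j * ι j) * (B i * θ i) = B i * θ i * ((1 - B j * A j) * (θ j * ι j)) := by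
  by_cases hij : i = j
  · subst hij
    have c : Commute (B i) (θ i * ι i) := (h.raise_theta i i).mul_right (h.raise_iota i i)
    have e1 : (1 - B i * A i) * (θ i * ι i) * (B i * θ i) = 0 := by
      rw [mul_assoc, ← mul_assoc (θ i * ι i), ← c.eq, mul_assoc (B i), ← mul_assoc,
        h.one_sub_mul_raise, zero_mul]
    have e2 : B i * θ i * ((1 - B i * A i) * (θ i * ι i)) = 0 := by
      rw [mul_assoc, ← mul_assoc (θ i), ← (h.commute_one_sub_theta i i).eq, mul_assoc,
        ← mul_assoc (θ i), h.theta_sq, zero_mul, mul_zero, mul_zero]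
    rw [e1, e2]
  · have c1 : Commute (B i) ((1 - B j * A j) * (θ j * ι j)) :=
      (h.raise_commute_one_sub hij).mul_right ((h.raise_theta i j).mul_right (h.raise_iota i j))
    have c2 : Commute (θ i) ((1 - B j * A j) * (θ j * ι j)) :=
      (h.commute_one_sub_theta j i).symm.mul_right (h.theta_commute_theta_iota hij)
    exact (c1.mul_left c2).symm.eq

/-- Collecting all θⱼ on the right shows that the product of the ιⱼθⱼ vanishes on the kernel of the
product of the θⱼ, which is the map splicing the lowering complex to the raising one. -/
theorem exists_iota_theta_prod {L : List (Fin l)} (hL : L.Nodup) :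
    ∃ Z, (L.map fun j => ι j * θ j).prod = Z * (L.map θ).prod := by
  induction L with
  | nil => exact ⟨1, by simp⟩
  | cons j L ih =>
    rw [List.nodup_cons] at hL
    obtain ⟨Z, hZ⟩ := ih hL.2
    have c : Commute (θ j) (L.map fun j => ι j * θ j).prod := by
      refine Commute.list_prod_right _ _ ?_
      simp only [List.mem_map]
      rintro _ ⟨i, hi, rfl⟩
      exact h.theta_commute_iota_theta (by rintro rfl; exact hL.1 hi)
    refine ⟨ι j * Z * (-1) ^ L.length, ?_⟩
    simp only [List.map_cons, List.prod_cons]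
    rw [mul_assoc, c.eq, hZ, mul_assoc Z, list_prod_mul_of_anti fun i => h.theta_anti i j]
    simp only [mul_assoc]

end Ring

section Module

variable {R T : Type*} [CommRing R] [AddCommGroup T] [Module R T] {l : ℕ} {δ : R}
  {A B θ ι : Fin l → Module.End R T} (h : IsKoszulSystem δ A B θ ι)

/-- The operators mapping a submodule `U` into a submodule `V`. -/
def mapsTo (U V : Submodule R T) : Submodule R (Module.End R T) where
  carrier := {S | ∀ x ∈ U, S x ∈ V}
  add_mem' ha hb x hx := V.add_mem (ha x hx) (hb x hx)
  zero_mem' _ _ := V.zero_mem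
  smul_mem' c _ ha x hx := V.smul_mem c (ha x hx)

include h

/-- On a cycle the composed homotopy reduces to D S x = δ^l x - (∏ πⱼ) x, so only the vanishing of
the last term is needed. `U` is the module of the cycle and `V` that of its preimage. -/
theorem west_exact {U V : Submodule R T} (hU : ∀ j, ∀ x ∈ U, B j (ι j x) ∈ V)
    (hV : ∀ j, ∀ x ∈ V, (1 - B j * A j : Module.End R T) (ι j (θ j x)) ∈ V) {x : T} (hx : x ∈ U)
    (hd : (∑ j, A j * θ j) x = 0)
    (hπ : ((List.finRange l).map fun j => (1 - B j * A j) * (ι j * θ j)).prod x = 0) :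
    ∃ y ∈ V, (∑ j, A j * θ j) y = δ ^ l • x := by
  obtain ⟨S, hS, e⟩ := exists_homotopy (c := algebraMap R (Module.End R T) δ)
    (Algebra.commutes δ) h.west_homotopy h.west_commute (mapsTo U V).toAddSubgroup
    (fun n j => by
      rw [← map_pow, ← Algebra.smul_def]
      exact (mapsTo U V).smul_mem _ (hU j))
    (fun j S hS x hx => hV j _ (hS x hx)) (List.finRange l)
  refine ⟨S x, hS x hx, ?_⟩
  have := LinearMap.congr_fun e x
  rw [LinearMap.add_apply, Module.End.mul_apply, Module.End.mul_apply, hd, map_zero, add_zero,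
    LinearMap.sub_apply, hπ, sub_zero, List.length_finRange, ← map_pow,
    Module.algebraMap_end_apply] at this
  exact this

theorem east_exact {U V : Submodule R T} (hU : ∀ j, ∀ x ∈ U, A j (ι j x) ∈ V)
    (hV : ∀ j, ∀ x ∈ V, (1 - B j * A j : Module.End R T) (θ j (ι j x)) ∈ V) {x : T} (hx : x ∈ U)
    (hd : (∑ j, B j * θ j) x = 0)
    (hπ : ((List.finRange l).map fun j => 1 - B j * A j).prod x = 0) :
    ∃ y ∈ V, (∑ j, B j * θ j) y = δ ^ l • x := by
  obtain ⟨S, hS, e⟩ := exists_homotopy (c := algebraMap R (Module.End R T) δ)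
    (Algebra.commutes δ) h.east_homotopy h.east_commute (mapsTo U V).toAddSubgroup
    (fun n j => by
      rw [← map_pow, ← Algebra.smul_def]
      exact (mapsTo U V).smul_mem _ (hU j))
    (fun j S hS x hx => hV j _ (hS x hx)) (List.finRange l)
  refine ⟨S x, hS x hx, ?_⟩
  have := LinearMap.congr_fun e x
  rw [LinearMap.add_apply, Module.End.mul_apply, Module.End.mul_apply, hd, map_zero, add_zero,
    LinearMap.sub_apply, list_map_mul_prod fun i j =>
      (h.commute_one_sub_theta i j).mul_right (h.commute_one_sub_iota i j),
    Module.End.mul_apply, hπ, map_zero, sub_zero, List.length_finRange, ← map_pow,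
    Module.algebraMap_end_apply] at this
  exact this

theorem west_prod_eq_zero {x : T}
    (hx : ((List.finRange l).map fun j => 1 - B j * A j).prod x = 0) :
    ((List.finRange l).map fun j => (1 - B j * A j) * (ι j * θ j)).prod x = 0 := by
  rw [list_map_mul_prod fun i j =>
      (h.commute_one_sub_iota i j).mul_right (h.commute_one_sub_theta i j),
    Module.End.mul_apply, hx, map_zero]

/-- In degree 0 the projections 1 - BⱼAⱼ are of no help; the remaining factor ends in the product of
all θⱼ, which kills the cycles of the spliced complex. -/
theorem west_prod_eq_zero_of_theta {x : T} (hx : ((List.finRange l).map θ).prod x = 0) :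
    ((List.finRange l).map fun j => (1 - B j * A j) * (ι j * θ j)).prod x = 0 := by
  have hc : ∀ i j, Commute (ι i * θ i) (1 - B j * A j) := fun i j =>
    ((h.commute_one_sub_iota j i).mul_right (h.commute_one_sub_theta j i)).symm
  have e : (fun j => (1 - B j * A j) * (ι j * θ j)) = fun j => ι j * θ j * (1 - B j * A j) :=
    funext fun j => (hc j j).eq.symm
  obtain ⟨Z, hZ⟩ := h.exists_iota_theta_prod (List.nodup_finRange l)
  rw [e, list_map_mul_prod hc, hZ, Module.End.mul_apply, Module.End.mul_apply, hx, map_zero,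
    map_zero]

/-- If every θⱼ kills x, the Clifford relation gives θⱼιⱼx = δx, and ιⱼx is still killed by θᵢ for i
≠ j. Contracting successively with all ιⱼ produces z, at the cost of one factor δ per step. -/
theorem exists_theta_prod_eq {W : ℤ → Submodule R T} (hW : ∀ j k, ∀ x ∈ W k, ι j x ∈ W (k - 1))
    {L : List (Fin l)} (hL : L.Nodup) :
    ∀ k, ∀ x ∈ W k, (∀ j ∈ L, θ j x = 0) →
      ∃ z ∈ W (k - L.length), (L.map θ).prod z = δ ^ L.length • x := by
  induction L with
  | nil => intro k x hx _; exact ⟨x, by simpa using hx, by simp⟩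
  | cons j L ih =>
    intro k x hx hθ
    rw [List.nodup_cons] at hL
    have hcl : ∀ i, θ i (ι j x) + ι j (θ i x) = if i = j then δ • x else 0 := by
      intro i
      have := LinearMap.congr_fun (h.clifford i j) x
      rw [LinearMap.add_apply, Module.End.mul_apply, Module.End.mul_apply] at this
      rw [this]
      split_ifs <;> simp [Module.algebraMap_end_apply]
    obtain ⟨z, hz, e⟩ := ih hL.2 (k - 1) (ι j x) (hW j k x hx) (by
      intro i hi
      have := hcl i
      rwa [hθ i (List.mem_cons_of_mem _ hi), map_zero, add_zero,
        if_neg (by rintro rfl; exact hL.1 hi)] at this)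
    refine ⟨z, ?_, ?_⟩
    · rw [List.length_cons]
      convert hz using 2
      push_cast
      ring
    · have h2 := hcl j
      rw [hθ j List.mem_cons_self, map_zero, add_zero, if_pos rfl] at h2
      rw [List.map_cons, List.prod_cons, Module.End.mul_apply, e, map_smul, h2, smul_smul,
        List.length_cons, pow_succ]

/-- Apply Aⱼ to ∑ Bᵢθᵢ x = 0: the term i = j becomes θⱼx because AⱼBⱼ = 1, and in all others Aⱼ
moves to the right and kills x. -/
theorem theta_eq_zero_of_east {x : T} (hA : ∀ j, A j x = 0) (hd : (∑ j, B j * θ j) x = 0)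
    (j : Fin l) : θ j x = 0 := by
  have h1 : A j * ∑ i, B i * θ i = θ j + ∑ i ∈ Finset.univ.erase j, B i * θ i * A j := by
    rw [Finset.mul_sum, ← Finset.add_sum_erase _ _ (Finset.mem_univ j), ← mul_assoc,
      h.lower_raise, one_mul]
    congr 1
    refine Finset.sum_congr rfl fun i hi => ?_
    rw [mul_assoc, ← (h.lower_theta j i).eq, ← mul_assoc, ← mul_assoc,
      (h.lower_raise_comm j i (Finset.ne_of_mem_erase hi).symm).eq]
  have h2 := LinearMap.congr_fun h1 x
  rw [Module.End.mul_apply, hd, map_zero, LinearMap.add_apply, LinearMap.sum_apply] at h2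
  simpa [Module.End.mul_apply, hA] using h2.symm

end Module

end IsKoszulSystem

end KoszulBicomplex

end

/-! ### Monomial bases of symmetric and divided powers, and flatness of the graded pieces -/

noncomputable section

namespace KoszulBicomplex

open scoped TensorProduct

/-! ### Modules with a basis of monomials -/

section Monomial

variable {R X : Type*} [CommRing R] [AddCommGroup X] [Module R X] {l : ℕ}
  (e : Module.Basis (Fin l →₀ ℕ) R X)

/-- The operator `e α ↦ e (α + single j 1)`. -/
def raise (j : Fin l) : Module.End R X := e.constr R fun α => e (α + Finsupp.single j 1)

/-- The operator `e α ↦ e (α - single j 1)`, with value `0` if `α j = 0`. -/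
def lower (j : Fin l) : Module.End R X :=
  e.constr R fun α => if α j = 0 then 0 else e (α - Finsupp.single j 1)

/-- The span of the `e α` with `α` of degree `a`. -/
def homPiece (a : ℕ) : Submodule R X := Submodule.span R (e '' {α | α.degree = a})

@[simp]
theorem raise_basis (j : Fin l) (α : Fin l →₀ ℕ) : raise e j (e α) = e (α + Finsupp.single j 1) :=
  e.constr_basis _ _ _

theorem lower_basis (j : Fin l) (α : Fin l →₀ ℕ) :
    lower e j (e α) = if α j = 0 then 0 else e (α - Finsupp.single j 1) :=
  e.constr_basis _ _ _

@[simp]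
theorem lower_basis_add (j : Fin l) (α : Fin l →₀ ℕ) :
    lower e j (e (α + Finsupp.single j 1)) = e α := by
  rw [lower_basis, if_neg (by simp), add_tsub_cancel_right]

theorem exists_eq_add_single {α : Fin l →₀ ℕ} {j : Fin l} (h : α j ≠ 0) :
    ∃ β, α = β + Finsupp.single j 1 :=
  ⟨α - Finsupp.single j 1, (tsub_add_cancel_of_le (by simpa [Nat.one_le_iff_ne_zero] using h)).symm⟩

theorem lower_mul_raise (j : Fin l) : lower e j * raise e j = 1 :=
  e.ext fun α => by simp [Module.End.mul_apply]

theorem raise_commute (i j : Fin l) : Commute (raise e i) (raise e j) :=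
  e.ext fun α => by simp [Module.End.mul_apply, add_right_comm]

theorem lower_commute_raise (i j : Fin l) (h : i ≠ j) : Commute (lower e i) (raise e j) :=
  e.ext fun α => by
    rw [Module.End.mul_apply, Module.End.mul_apply, raise_basis]
    by_cases h0 : α i = 0
    · rw [lower_basis, lower_basis, if_pos h0, if_pos (by simp [h0, h.symm]),
        map_zero]
    · obtain ⟨β, rfl⟩ := exists_eq_add_single h0
      rw [add_right_comm, lower_basis_add, lower_basis_add, raise_basis]

theorem lower_commute (i j : Fin l) : Commute (lower e i) (lower e j) :=
  e.ext fun α => by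
    rw [Module.End.mul_apply, Module.End.mul_apply]
    by_cases h : i = j
    · rw [h]
    by_cases hi : α i = 0
    · rw [lower_basis e i, if_pos hi, map_zero, lower_basis]
      split_ifs with hj
      · rw [map_zero]
      · rw [lower_basis, if_pos (by simp [hi])]
    · obtain ⟨β, rfl⟩ := exists_eq_add_single hi
      rw [lower_basis_add]
      by_cases hj : β j = 0
      · rw [lower_basis, lower_basis, if_pos hj, if_pos (by simp [hj, h]),
          map_zero]
      · obtain ⟨γ, rfl⟩ := exists_eq_add_single hj
        rw [add_right_comm, lower_basis_add, lower_basis_add, lower_basis_add]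

theorem basis_mem_homPiece {α : Fin l →₀ ℕ} {a : ℕ} (h : α.degree = a) : e α ∈ homPiece e a :=
  Submodule.subset_span ⟨α, h, rfl⟩

theorem homPiece_induction {a : ℕ} {W : Submodule R X} (h : ∀ α, α.degree = a → e α ∈ W) :
    homPiece e a ≤ W := by
  rw [homPiece, Submodule.span_le]
  rintro _ ⟨α, hα, rfl⟩
  exact h α hα

theorem raise_mem {a : ℕ} {x : X} (j : Fin l) (hx : x ∈ homPiece e a) :
    raise e j x ∈ homPiece e (a + 1) := by
  have : homPiece e a ≤ (homPiece e (a + 1)).comap (raise e j) := by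
    refine homPiece_induction e fun α hα => ?_
    rw [Submodule.mem_comap, raise_basis]
    exact basis_mem_homPiece e (by rw [map_add, hα, Finsupp.degree_single])
  exact this hx

theorem lower_mem {a : ℕ} {x : X} (j : Fin l) (hx : x ∈ homPiece e (a + 1)) :
    lower e j x ∈ homPiece e a := by
  have : homPiece e (a + 1) ≤ (homPiece e a).comap (lower e j) := by
    refine homPiece_induction e fun α hα => ?_
    rw [Submodule.mem_comap]
    by_cases h0 : α j = 0
    · rw [lower_basis, if_pos h0]; exact zero_mem _
    · obtain ⟨β, rfl⟩ := exists_eq_add_single h0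
      rw [lower_basis_add]
      refine basis_mem_homPiece e ?_
      rw [map_add, Finsupp.degree_single] at hα
      omega
  exact this hx

theorem homPiece_zero : homPiece e 0 = Submodule.span R {e 0} := by
  rw [homPiece]
  have : {α : Fin l →₀ ℕ | α.degree = 0} = {0} := by
    ext α
    exact Finsupp.degree_eq_zero_iff α
  rw [this, Set.image_singleton]

theorem lower_eq_zero {x : X} (j : Fin l) (hx : x ∈ homPiece e 0) : lower e j x = 0 := by
  rw [homPiece_zero, Submodule.mem_span_singleton] at hx
  obtain ⟨c, rfl⟩ := hx
  rw [map_smul, lower_basis, if_pos (by simp), smul_zero]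

/-- 1 - BⱼAⱼ fixes the monomials free of variable j and kills the others, so the product over all j
retains only the monomial 1. -/
theorem prod_one_sub_eq_zero {a : ℕ} {x : X} (hx : x ∈ homPiece e (a + 1)) :
    ((List.finRange l).map fun j => 1 - raise e j * lower e j).prod x = 0 := by
  have key : ∀ (L : List (Fin l)) (α : Fin l →₀ ℕ),
      (L.map fun j => 1 - raise e j * lower e j).prod (e α) =
        if ∀ j ∈ L, α j = 0 then e α else 0 := by
    intro L α
    induction L with
    | nil => simp
    | cons j L ih =>
      rw [List.map_cons, List.prod_cons, Module.End.mul_apply, ih]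
      by_cases h : ∀ j ∈ L, α j = 0
      · rw [if_pos h, LinearMap.sub_apply, Module.End.mul_apply, Module.End.one_apply]
        by_cases hj : α j = 0
        · rw [lower_basis, if_pos hj, map_zero, sub_zero, if_pos]
          simpa [hj] using h
        · obtain ⟨β, rfl⟩ := exists_eq_add_single hj
          rw [lower_basis_add, raise_basis, sub_self, if_neg]
          intro h'
          exact hj (h' j List.mem_cons_self)
      · rw [if_neg h, map_zero, if_neg]
        intro h'
        exact h fun j hj => h' j (List.mem_cons_of_mem _ hj)
  have : homPiece e (a + 1) ≤
      LinearMap.ker ((List.finRange l).map fun j => 1 - raise e j * lower e j).prod := by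
    refine homPiece_induction e fun α hα => ?_
    rw [LinearMap.mem_ker, key, if_neg]
    intro h
    have : α = 0 := Finsupp.ext fun j => h j (List.mem_finRange j)
    rw [this, map_zero] at hα
    omega
  exact this hx

end Monomial

/-! ### Retracts -/

/-- A submodule which is a direct summand. -/
def IsRetract {R X : Type*} [CommRing R] [AddCommGroup X] [Module R X] (A : Submodule R X) : Prop :=
  ∃ p : X →ₗ[R] A, ∀ a : A, p a = a

theorem IsRetract.flat {R X : Type*} [CommRing R] [AddCommGroup X] [Module R X]
    {A : Submodule R X} (h : IsRetract A) [Module.Flat R X] : Module.Flat R A := by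
  obtain ⟨p, hp⟩ := h
  exact Module.Flat.of_retract A.subtype p (LinearMap.ext hp)

theorem isRetract_of_end {R X : Type*} [CommRing R] [AddCommGroup X] [Module R X]
    {A : Submodule R X} (p : Module.End R X) (h1 : ∀ x, p x ∈ A) (h2 : ∀ x ∈ A, p x = x) :
    IsRetract A :=
  ⟨p.codRestrict A h1, fun a => Subtype.ext (h2 a a.2)⟩

theorem isRetract_bot {R X : Type*} [CommRing R] [AddCommGroup X] [Module R X] :
    IsRetract (⊥ : Submodule R X) :=
  isRetract_of_end 0 (fun _ => zero_mem _) fun _ hx => ((Submodule.mem_bot R).1 hx).symm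

theorem isRetract_homPiece {R X : Type*} [CommRing R] [AddCommGroup X] [Module R X] {l : ℕ}
    (e : Module.Basis (Fin l →₀ ℕ) R X) (a : ℕ) : IsRetract (homPiece e a) := by
  classical
  refine isRetract_of_end (e.constr R fun α => if α.degree = a then e α else 0) ?_ ?_
  · intro x
    have : (⊤ : Submodule R X) ≤ (homPiece e a).comap
        (e.constr R fun α => if α.degree = a then e α else 0) := by
      rw [← e.span_eq, Submodule.span_le]
      rintro _ ⟨α, rfl⟩
      rw [SetLike.mem_coe, Submodule.mem_comap, e.constr_basis]
      split_ifs with h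
      · exact basis_mem_homPiece e h
      · exact zero_mem _
    exact this trivial
  · intro x hx
    have : homPiece e a ≤ LinearMap.eqLocus
        (e.constr R fun α => if α.degree = a then e α else 0) LinearMap.id := by
      refine homPiece_induction e fun α hα => ?_
      rw [LinearMap.mem_eqLocus, e.constr_basis, if_pos hα, LinearMap.id_apply]
    exact this hx

theorem isRetract_exteriorPower (R M : Type*) [CommRing R] [AddCommGroup M] [Module R M] (k : ℕ) :
    IsRetract (⋀[R]^k M) :=
  ⟨DirectSum.component R ℕ _ k ∘ₗ
      (DirectSum.decomposeLinearEquiv fun i : ℕ => ⋀[R]^i M).toLinearMap,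
    fun a => by
      simp only [LinearMap.comp_apply, LinearEquiv.coe_coe, DirectSum.decomposeLinearEquiv_apply,
        DirectSum.decompose_coe]
      exact DirectSum.component.lof_self R (M := fun i : ℕ => ⋀[R]^i M) k a⟩

section TensorPiece

variable {R : Type*} [CommRing R] {X Y Z X' Y' Z' : Type*} [AddCommGroup X] [Module R X]
    [AddCommGroup Y] [Module R Y] [AddCommGroup Z] [Module R Z] [AddCommGroup X'] [Module R X']
    [AddCommGroup Y'] [Module R Y'] [AddCommGroup Z'] [Module R Z']

/-- The tensor product of three linear maps. -/
def map₃ (f : X →ₗ[R] X') (g : Y →ₗ[R] Y') (h : Z →ₗ[R] Z') :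
    X ⊗[R] (Y ⊗[R] Z) →ₗ[R] X' ⊗[R] (Y' ⊗[R] Z') :=
  TensorProduct.map f (TensorProduct.map g h)

theorem map₃_mul (f f' : Module.End R X) (g g' : Module.End R Y) (h h' : Module.End R Z) :
    (map₃ f g h * map₃ f' g' h' : Module.End R (X ⊗[R] (Y ⊗[R] Z))) =
      map₃ (f * f') (g * g') (h * h') := by
  rw [map₃, map₃, map₃, TensorProduct.map_mul, TensorProduct.map_mul]

theorem tmul_mem_tensorPiece {A : Submodule R X} {B : Submodule R Y} {C : Submodule R Z}
    {x : X} {y : Y} {z : Z} (hx : x ∈ A) (hy : y ∈ B) (hz : z ∈ C) :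
    x ⊗ₜ[R] (y ⊗ₜ[R] z) ∈ tensorPiece A B C :=
  ⟨⟨x, hx⟩ ⊗ₜ (⟨y, hy⟩ ⊗ₜ ⟨z, hz⟩), rfl⟩

theorem tensorPiece_le {A : Submodule R X} {B : Submodule R Y} {C : Submodule R Z}
    {W : Submodule R (X ⊗[R] (Y ⊗[R] Z))}
    (h : ∀ x ∈ A, ∀ y ∈ B, ∀ z ∈ C, x ⊗ₜ[R] (y ⊗ₜ[R] z) ∈ W) : tensorPiece A B C ≤ W := by
  rintro _ ⟨u, rfl⟩
  induction u with
  | zero => rw [map_zero]; exact zero_mem _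
  | add u v hu hv => rw [map_add]; exact add_mem hu hv
  | tmul x u =>
    induction u with
    | zero => rw [TensorProduct.tmul_zero, map_zero]; exact zero_mem _
    | add u v hu hv => rw [TensorProduct.tmul_add, map_add]; exact add_mem hu hv
    | tmul y z => exact h x x.2 y y.2 z z.2

theorem map₃_mem {A : Submodule R X} {B : Submodule R Y} {C : Submodule R Z} {A' : Submodule R X'}
    {B' : Submodule R Y'} {C' : Submodule R Z'} {f : X →ₗ[R] X'} {g : Y →ₗ[R] Y'} {h : Z →ₗ[R] Z'}
    (hf : ∀ x ∈ A, f x ∈ A') (hg : ∀ y ∈ B, g y ∈ B') (hh : ∀ z ∈ C, h z ∈ C') :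
    ∀ x ∈ tensorPiece A B C, map₃ f g h x ∈ tensorPiece A' B' C' := by
  have : tensorPiece A B C ≤ (tensorPiece A' B' C').comap (map₃ f g h) :=
    tensorPiece_le fun x hx y hy z hz => tmul_mem_tensorPiece (hf x hx) (hg y hy) (hh z hz)
  exact this

theorem map₃_congr {A : Submodule R X} {B : Submodule R Y} {C : Submodule R Z}
    {f f' : X →ₗ[R] X'} {g g' : Y →ₗ[R] Y'} {h h' : Z →ₗ[R] Z'}
    (hf : ∀ x ∈ A, f x = f' x) (hg : ∀ y ∈ B, g y = g' y) (hh : ∀ z ∈ C, h z = h' z) :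
    ∀ x ∈ tensorPiece A B C, map₃ f g h x = map₃ f' g' h' x := by
  have : tensorPiece A B C ≤ LinearMap.eqLocus (map₃ f g h) (map₃ f' g' h') :=
    tensorPiece_le fun x hx y hy z hz => by
      simp [map₃, hf x hx, hg y hy, hh z hz]
  exact this

theorem map₃_eq_zero {A : Submodule R X} {B : Submodule R Y} {C : Submodule R Z}
    {f : X →ₗ[R] X'} {g : Y →ₗ[R] Y'} {h : Z →ₗ[R] Z'}
    (H : (∀ x ∈ A, f x = 0) ∨ (∀ y ∈ B, g y = 0) ∨ (∀ z ∈ C, h z = 0)) :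
    ∀ x ∈ tensorPiece A B C, map₃ f g h x = 0 := by
  have : tensorPiece A B C ≤ LinearMap.ker (map₃ f g h) :=
    tensorPiece_le fun x hx y hy z hz => by
      rcases H with H | H | H
      · simp [map₃, H x hx]
      · simp [map₃, H y hy]
      · simp [map₃, H z hz]
  exact this

theorem tensorPiece_eq_bot {A : Submodule R X} {C : Submodule R Z} :
    tensorPiece A (⊥ : Submodule R Y) C = ⊥ := by
  rw [eq_bot_iff]
  refine tensorPiece_le fun x _ y hy z _ => ?_
  rw [(Submodule.mem_bot R).1 hy]
  simp

/-- Tensoring the retractions shows that A ⊗ B ⊗ C embeds into X ⊗ Y ⊗ Z; the piece is therefore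
isomorphic to a tensor product of flat modules. -/
theorem tensorPiece_flat {A : Submodule R X} {B : Submodule R Y} {C : Submodule R Z}
    (hA : IsRetract A) (hB : IsRetract B) (hC : IsRetract C) [Module.Flat R X] [Module.Flat R Y]
    [Module.Flat R Z] : Module.Flat R (tensorPiece A B C) := by
  have := hA.flat
  have := hB.flat
  have := hC.flat
  obtain ⟨pA, hpA⟩ := hA
  obtain ⟨pB, hpB⟩ := hB
  obtain ⟨pC, hpC⟩ := hC
  have hinj : Function.Injective
      (TensorProduct.map A.subtype (TensorProduct.map B.subtype C.subtype)) := by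
    refine Function.LeftInverse.injective (g := map₃ pA pB pC) fun u => ?_
    have : map₃ pA pB pC ∘ₗ TensorProduct.map A.subtype (TensorProduct.map B.subtype C.subtype)
        = LinearMap.id := by
      rw [map₃, ← TensorProduct.map_comp, ← TensorProduct.map_comp,
        show pA ∘ₗ A.subtype = LinearMap.id from LinearMap.ext hpA,
        show pB ∘ₗ B.subtype = LinearMap.id from LinearMap.ext hpB,
        show pC ∘ₗ C.subtype = LinearMap.id from LinearMap.ext hpC, TensorProduct.map_id,
        TensorProduct.map_id]
    exact LinearMap.congr_fun this u
  exact Module.Flat.of_linearEquiv (LinearEquiv.ofInjective _ hinj).symm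

end TensorPiece

/-! ### Symmetric powers of free modules -/

section Sym

variable {R F : Type*} [CommRing R] [AddCommGroup F] [Module R F] {m : ℕ}
  (b : Module.Basis (Fin m) R F)

theorem symmetricAlgebra_zero : b.symmetricAlgebra 0 = 1 := by
  simp [Module.Basis.symmetricAlgebra]

theorem mulLeft_ι_eq_raise (j : Fin m) :
    LinearMap.mulLeft R (SymmetricAlgebra.ι R F (b j)) = raise b.symmetricAlgebra j :=
  b.symmetricAlgebra.ext fun α => by
    rw [raise_basis, LinearMap.mulLeft_apply]
    apply (SymmetricAlgebra.equivMvPolynomial b).injective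
    rw [map_mul, SymmetricAlgebra.equivMvPolynomial_ι_apply]
    simp [Module.Basis.symmetricAlgebra, MvPolynomial.X, MvPolynomial.monomial_mul, add_comm]

theorem symPow_succ {M : Type*} [AddCommGroup M] [Module R M] (k : ℕ) :
    symPow R M (k + 1) = LinearMap.range (SymmetricAlgebra.ι R M) * symPow R M k :=
  pow_succ' _ _

theorem ι_mul_mem_symPow {M : Type*} [AddCommGroup M] [Module R M] {k : ℕ} (x : M)
    {s : SymmetricAlgebra R M} (hs : s ∈ symPow R M k) :
    SymmetricAlgebra.ι R M x * s ∈ symPow R M (k + 1) := by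
  rw [symPow_succ]
  exact Submodule.mul_mem_mul ⟨x, rfl⟩ hs

theorem symPow_eq_homPiece (k : ℕ) : symPow R F k = homPiece b.symmetricAlgebra k := by
  induction k with
  | zero =>
    rw [homPiece_zero, symmetricAlgebra_zero, symPow, pow_zero, Submodule.one_eq_span]
  | succ k ih =>
    apply le_antisymm
    · rw [symPow_succ, ih, Submodule.mul_le]
      rintro _ ⟨x, rfl⟩ s hs
      rw [← b.sum_repr x, map_sum, Finset.sum_mul]
      refine sum_mem fun j _ => ?_
      rw [map_smul, smul_mul_assoc]
      refine Submodule.smul_mem _ _ ?_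
      have := raise_mem b.symmetricAlgebra j hs
      rwa [← mulLeft_ι_eq_raise] at this
    · refine homPiece_induction _ fun α hα => ?_
      have : ∃ j, α j ≠ 0 := by
        by_contra! h
        rw [show α = 0 from Finsupp.ext h, map_zero] at hα
        omega
      obtain ⟨j, hj⟩ := this
      obtain ⟨β, rfl⟩ := exists_eq_add_single hj
      rw [← raise_basis, ← mulLeft_ι_eq_raise, LinearMap.mulLeft_apply]
      refine ι_mul_mem_symPow _ ?_
      rw [ih]
      refine basis_mem_homPiece _ ?_
      rw [map_add, Finsupp.degree_single] at hα
      omega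

end Sym

/-! ### Divided powers of free modules -/

section DivPow

open DividedPowerAlgebra

variable {R H : Type*} [CommRing R] [AddCommGroup H] [Module R H]

theorem dpDerivHom_fst (a : Module.Dual R H) (x : DividedPowerAlgebra R H) :
    (dpDerivHom a x).fst = x := by
  have : (TrivSqZeroExt.fstHom R (DividedPowerAlgebra R H) (DividedPowerAlgebra R H)).comp
      (dpDerivHom a) = AlgHom.id R _ := by
    apply DividedPowerAlgebra.algHom_ext
    intro n y
    simp [dpDerivHom]
  exact DFunLike.congr_fun this x

/-- The Leibniz rule is multiplicativity of the homomorphism into the dual numbers, read off in the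
ε-component. -/
theorem dpContract_mul (a : Module.Dual R H) (x y : DividedPowerAlgebra R H) :
    dpContract a (x * y) = x * dpContract a y + dpContract a x * y := by
  simp [dpContract, dpDerivHom_fst, mul_comm]

theorem dpContract_one (a : Module.Dual R H) : dpContract a (1 : DividedPowerAlgebra R H) = 0 := by
  simp [dpContract]

theorem dpContract_dp_succ (a : Module.Dual R H) (k : ℕ) (x : H) :
    dpContract a (dp R (k + 1) x) = a x • dp R k x := by
  simp [dpContract, dpDerivHom]

theorem dpAug_dp (k : ℕ) (x : H) : dpAug R H (dp R k x) = if k = 0 then 1 else 0 := by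
  simp [dpAug]

theorem dpContract_dp_eq_zero {a : Module.Dual R H} {x : H} (h : a x = 0) (k : ℕ) :
    dpContract a (dp R k x) = 0 := by
  cases k with
  | zero => rw [dp_zero, dpContract_one]
  | succ k => rw [dpContract_dp_succ, h, zero_smul]

theorem dpContract_prod_eq_zero {α : Type*} {a : Module.Dual R H} {s : Finset α}
    {f : α → DividedPowerAlgebra R H} (h : ∀ i ∈ s, dpContract a (f i) = 0) :
    dpContract a (∏ i ∈ s, f i) = 0 := by
  classical
  induction s using Finset.induction_on with
  | empty => simp [dpContract_one]
  | insert i s hi ih =>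
    rw [Finset.prod_insert hi, dpContract_mul, h i (Finset.mem_insert_self _ _),
      ih fun j hj => h j (Finset.mem_insert_of_mem hj), mul_zero, zero_mul, add_zero]

variable {l : ℕ} (b : Module.Basis (Fin l) R H)

/-- The monomials `∏ⱼ bⱼ^(αⱼ)` in the divided power algebra. -/
def dpMonomial (α : Fin l →₀ ℕ) : DividedPowerAlgebra R H := ∏ j, dp R (α j) (b j)

theorem dpMonomial_zero : dpMonomial b 0 = 1 := by simp [dpMonomial, dp_zero]

theorem dpContract_dpMonomial (j : Fin l) (α : Fin l →₀ ℕ) :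
    dpContract (b.coord j) (dpMonomial b α) =
      if α j = 0 then 0 else dpMonomial b (α - Finsupp.single j 1) := by
  have h0 : dpContract (b.coord j) (∏ i ∈ Finset.univ.erase j, dp R (α i) (b i)) = 0 :=
    dpContract_prod_eq_zero fun i hi =>
      dpContract_dp_eq_zero (by simp [Finset.ne_of_mem_erase hi]) _
  rw [dpMonomial, ← Finset.mul_prod_erase _ _ (Finset.mem_univ j), dpContract_mul, h0, mul_zero,
    zero_add]
  cases hj : α j with
  | zero => rw [dp_zero, dpContract_one, zero_mul, if_pos rfl]
  | succ k =>
    rw [dpContract_dp_succ, if_neg (Nat.succ_ne_zero k), Module.Basis.coord_apply,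
      Module.Basis.repr_self, Finsupp.single_eq_same, one_smul, dpMonomial,
      ← Finset.mul_prod_erase _ _ (Finset.mem_univ j)]
    congr 1
    · simp [hj]
    · refine Finset.prod_congr rfl fun i hi => ?_
      simp [(Finset.ne_of_mem_erase hi).symm]

theorem dpAug_dpMonomial (α : Fin l →₀ ℕ) :
    dpAug R H (dpMonomial b α) = if α = 0 then 1 else 0 := by
  rw [dpMonomial, map_prod]
  simp_rw [dpAug_dp]
  split_ifs with h
  · subst h; simp
  · have : ∃ j, α j ≠ 0 := by
      by_contra! h'
      exact h (Finsupp.ext h')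
    obtain ⟨j, hj⟩ := this
    exact Finset.prod_eq_zero (Finset.mem_univ j) (if_neg hj)

/-- Contracting along the variables occurring in β takes the monomial of β to 1, which the
augmentation detects; every other monomial either dies or keeps a positive degree. These functionals
prove linear independence. -/
theorem exists_dual_dpMonomial (β : Fin l →₀ ℕ) : ∃ f : DividedPowerAlgebra R H →ₗ[R] R,
    ∀ α, f (dpMonomial b α) = if α = β then 1 else 0 := by
  generalize hd : β.degree = d
  induction d generalizing β with
  | zero =>
    rw [Finsupp.degree_eq_zero_iff] at hd
    subst hd
    exact ⟨(dpAug R H).toLinearMap, dpAug_dpMonomial b⟩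
  | succ d ih =>
    have : ∃ j, β j ≠ 0 := by
      by_contra! h
      rw [show β = 0 from Finsupp.ext h, map_zero] at hd
      omega
    obtain ⟨j, hj⟩ := this
    obtain ⟨γ, rfl⟩ := exists_eq_add_single hj
    obtain ⟨f, hf⟩ := ih γ (by rw [map_add, Finsupp.degree_single] at hd; omega)
    refine ⟨f ∘ₗ dpContract (b.coord j), fun α => ?_⟩
    rw [LinearMap.comp_apply, dpContract_dpMonomial]
    by_cases h0 : α j = 0
    · rw [if_pos h0, map_zero, if_neg]
      rintro rfl
      exact hj h0
    · obtain ⟨α, rfl⟩ := exists_eq_add_single h0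
      rw [if_neg h0, add_tsub_cancel_right, hf]
      simp

theorem linearIndependent_dpMonomial : LinearIndependent R (dpMonomial b) := by
  rw [linearIndependent_iff]
  intro c hc
  ext β
  obtain ⟨f, hf⟩ := exists_dual_dpMonomial b β
  have h : (f ∘ₗ Finsupp.linearCombination R (dpMonomial b)) = Finsupp.lapply β := by
    ext α
    simp [hf, Finsupp.single_apply]
  have h' := LinearMap.congr_fun h c
  rw [LinearMap.comp_apply, hc, map_zero] at h'
  exact h'.symm

theorem span_dpMonomial : ⊤ ≤ Submodule.span R (Set.range (dpMonomial b)) := by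
  have h : (dpMonomial b : _ → DividedPowerAlgebra R H) =
      fun n : Fin l →₀ ℕ => n.prod fun i k => dp R k (b i) := by
    funext α
    exact (Finsupp.prod_fintype α (fun i k => dp R k (b i)) fun _ => dp_zero).symm
  rw [h]
  exact (submodule_span_prod_dp_eq_top b.span_eq).ge

/-- The basis of the divided power algebra of a free module, formed by the monomials. -/
def dpBasis : Module.Basis (Fin l →₀ ℕ) R (DividedPowerAlgebra R H) :=
  Module.Basis.mk (linearIndependent_dpMonomial b) (span_dpMonomial b)

theorem dpBasis_apply (α : Fin l →₀ ℕ) : dpBasis b α = dpMonomial b α :=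
  Module.Basis.mk_apply _ _ _

/-- Contraction of divided power monomials involves no coefficients. This makes it inverse, on one
side, to raising the exponent in every characteristic. -/
theorem dpContract_eq_lower (j : Fin l) : dpContract (b.coord j) = lower (dpBasis b) j :=
  (dpBasis b).ext fun α => by
    rw [lower_basis, dpBasis_apply, dpBasis_apply, dpContract_dpMonomial]

theorem dpMonomial_mul (α β : Fin l →₀ ℕ) : ∃ c : ℕ,
    dpMonomial b α * dpMonomial b β = c • dpMonomial b (α + β) := by
  refine ⟨∏ j, (α j + β j).choose (α j), ?_⟩
  rw [dpMonomial, dpMonomial, ← Finset.prod_mul_distrib]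
  simp_rw [dp_mul, nsmul_eq_mul]
  rw [Finset.prod_mul_distrib, dpMonomial, Nat.cast_prod]
  rfl

theorem mul_mem_homPiece_dpBasis {a a' : ℕ} {x y : DividedPowerAlgebra R H}
    (hx : x ∈ homPiece (dpBasis b) a) (hy : y ∈ homPiece (dpBasis b) a') :
    x * y ∈ homPiece (dpBasis b) (a + a') := by
  have h := Submodule.mul_mem_mul hx hy
  rw [homPiece, homPiece, Submodule.span_mul_span] at h
  refine Submodule.span_le.2 ?_ h
  rintro _ ⟨_, ⟨α, hα, rfl⟩, _, ⟨β, hβ, rfl⟩, rfl⟩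
  obtain ⟨c, hc⟩ := dpMonomial_mul b α β
  simp only [dpBasis_apply, hc]
  rw [← dpBasis_apply]
  refine Submodule.smul_of_tower_mem _ _ (basis_mem_homPiece _ ?_)
  rw [map_add, hα, hβ]

theorem dp_mem_homPiece (k : ℕ) (x : H) : dp R k x ∈ homPiece (dpBasis b) k := by
  classical
  rw [← b.sum_repr x, dp_sum_smul]
  refine sum_mem fun s hs => Submodule.smul_mem _ _ ?_
  have : ∏ i, dp R (Multiset.count i (s : Multiset (Fin l))) (b i) =
      dpBasis b (Multiset.toFinsupp (s : Multiset (Fin l))) := by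
    rw [dpBasis_apply, dpMonomial]
    simp
  rw [this]
  refine basis_mem_homPiece _ ?_
  rw [Finsupp.degree_eq_sum]
  simp

theorem divPow_eq_homPiece (k : ℕ) : divPow R H k = homPiece (dpBasis b) k := by
  apply le_antisymm
  · rw [divPow, Submodule.span_le]
    rintro _ ⟨s, hs, rfl⟩
    subst hs
    induction s using Multiset.induction_on with
    | empty =>
      simp only [Multiset.map_zero, Multiset.prod_zero, Multiset.sum_zero]
      rw [← dpMonomial_zero b, ← dpBasis_apply]
      exact basis_mem_homPiece _ (by simp)
    | cons u s ih =>
      simp only [Multiset.map_cons, Multiset.prod_cons, Multiset.sum_cons]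
      exact mul_mem_homPiece_dpBasis b (dp_mem_homPiece b _ _) ih
  · refine homPiece_induction _ fun α hα => Submodule.subset_span ?_
    refine ⟨Finset.univ.val.map fun j => (α j, b j), ?_, ?_⟩
    · rw [Multiset.map_map, ← hα, Finsupp.degree_eq_sum]
      rfl
    · rw [Multiset.map_map, dpBasis_apply]
      rfl

end DivPow

end KoszulBicomplex

end

/-! ### Koszul systems from exterior multiplication and contraction -/

noncomputable section

namespace KoszulBicomplex

open scoped TensorProduct

/-! ### Exterior powers with integral exponents -/

section Ext

variable (R G : Type*) [CommRing R] [AddCommGroup G] [Module R G]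

/-- The exterior power with an integral exponent, `0` if the exponent is negative. -/
def extZ (k : ℤ) : Submodule R (ExteriorAlgebra R G) := if 0 ≤ k then ⋀[R]^k.toNat G else ⊥

theorem extZ_natCast (k : ℕ) : extZ R G k = ⋀[R]^k G := by simp [extZ]

theorem extZ_of_neg {k : ℤ} (h : k < 0) : extZ R G k = ⊥ := if_neg (by omega)

variable {R G}

theorem isRetract_extZ (k : ℤ) : IsRetract (extZ R G k) := by
  unfold extZ
  split_ifs
  · exact isRetract_exteriorPower R G _
  · exact isRetract_bot

theorem exteriorPower_succ (k : ℕ) :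
    ⋀[R]^(k + 1) G = LinearMap.range (ExteriorAlgebra.ι R (M := G)) * ⋀[R]^k G :=
  pow_succ' _ _

theorem ι_mul_mem_extZ (v : G) {k : ℤ} {x : ExteriorAlgebra R G} (hx : x ∈ extZ R G k) :
    ExteriorAlgebra.ι R v * x ∈ extZ R G (k + 1) := by
  rcases lt_or_ge k 0 with h | h
  · rw [extZ_of_neg R G h, Submodule.mem_bot] at hx
    rw [hx, mul_zero]
    exact zero_mem _
  · obtain ⟨k, rfl⟩ := Int.eq_ofNat_of_zero_le h
    rw [extZ_natCast] at hx
    rw [show (k : ℤ) + 1 = (k + 1 : ℕ) by norm_num, extZ_natCast, exteriorPower_succ]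
    exact Submodule.mul_mem_mul ⟨v, rfl⟩ hx

theorem contractLeft_mem_extZ (a : Module.Dual R G) {k : ℤ} {x : ExteriorAlgebra R G}
    (hx : x ∈ extZ R G k) : CliffordAlgebra.contractLeft a x ∈ extZ R G (k - 1) := by
  rcases lt_or_ge k 0 with h | h
  · rw [extZ_of_neg R G h, Submodule.mem_bot] at hx
    rw [hx, map_zero]
    exact zero_mem _
  · obtain ⟨k, rfl⟩ := Int.eq_ofNat_of_zero_le h
    rw [extZ_natCast] at hx
    induction k generalizing x with
    | zero =>
      rw [ExteriorAlgebra.exteriorPower, pow_zero, Submodule.one_eq_range] at hx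
      obtain ⟨c, rfl⟩ := hx
      rw [Algebra.linearMap_apply, CliffordAlgebra.contractLeft_algebraMap]
      exact zero_mem _
    | succ k ih =>
      rw [exteriorPower_succ] at hx
      rw [show ((k + 1 : ℕ) : ℤ) - 1 = k by push_cast; ring]
      induction hx using Submodule.mul_induction_on' with
      | mem_mul_mem v hv y hy =>
        obtain ⟨v, rfl⟩ := hv
        rw [ExteriorAlgebra.ι, CliffordAlgebra.contractLeft_ι_mul]
        refine sub_mem (Submodule.smul_mem _ _ (by rwa [extZ_natCast])) ?_
        have := ι_mul_mem_extZ v (ih hy (by positivity))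
        rwa [sub_add_cancel] at this
      | add y _ z _ hy hz => rw [map_add]; exact add_mem hy hz

theorem extZ_eq_bot_of_lt {n : ℕ} (b : Module.Basis (Fin n) R G) {k : ℤ} (h : (n : ℤ) < k) :
    extZ R G k = ⊥ := by
  obtain ⟨k, rfl⟩ := Int.eq_ofNat_of_zero_le (show 0 ≤ k by omega)
  rw [extZ_natCast]
  have hk : n < k := by exact_mod_cast h
  have : IsEmpty (Set.powersetCard (Fin n) k) := ⟨fun s => by
    have h1 := Finset.card_le_univ s.1
    rw [s.2, Fintype.card_fin] at h1
    omega⟩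
  have : Subsingleton (⋀[R]^k G) := (b.exteriorPower (n := k)).repr.toEquiv.subsingleton
  exact Submodule.subsingleton_iff_eq_bot.1 this

end Ext

/-! ### Koszul systems on triple tensor products -/

section Systems

variable {R : Type*} [CommRing R]

/-- Monomial operators on one tensor factor and Clifford operators on another commute, so a Koszul
system needs only relations inside each factor. -/
theorem isKoszulSystem_of_commute {X E₂ E : Type*} [AddCommGroup X] [Module R X] [Ring E₂]
    [Algebra R E₂] [Ring E] [Algebra R E] {l : ℕ} (e : Module.Basis (Fin l →₀ ℕ) R X)
    {δ : R} {θ ι : Fin l → E₂} (h1 : ∀ j, θ j * θ j = 0) (h2 : ∀ i j, θ i * θ j = -(θ j * θ i))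
    (h3 : ∀ i j, θ i * ι j + ι j * θ i = if i = j then algebraMap R E₂ δ else 0)
    (f : Module.End R X →ₐ[R] E) (g : E₂ →ₐ[R] E) (hfg : ∀ a b, Commute (f a) (g b)) :
    IsKoszulSystem δ (fun j => f (lower e j)) (fun j => f (raise e j)) (fun j => g (θ j))
      (fun j => g (ι j)) where
  lower_raise j := by rw [← map_mul, lower_mul_raise, map_one]
  lower_comm i j := (lower_commute e i j).map f
  raise_comm i j := (raise_commute e i j).map f
  lower_raise_comm i j h := (lower_commute_raise e i j h).map f
  theta_sq j := by rw [← map_mul, h1, map_zero]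
  theta_anti i j := by rw [← map_mul, h2, map_neg, map_mul]
  clifford i j := by
    rw [← map_mul, ← map_mul, ← map_add, h3]
    split_ifs
    · exact g.commutes δ
    · exact map_zero g
  lower_theta _ _ := hfg _ _
  lower_iota _ _ := hfg _ _
  raise_theta _ _ := hfg _ _
  raise_iota _ _ := hfg _ _

variable (R) (X Y Z : Type*) [AddCommGroup X] [Module R X] [AddCommGroup Y] [Module R Y]
  [AddCommGroup Z] [Module R Z]

/-- The action of endomorphisms of the first factor of a triple tensor product. -/
def slot₁ : Module.End R X →ₐ[R] Module.End R (X ⊗[R] (Y ⊗[R] Z)) :=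
  Module.End.rTensorAlgHom R X (Y ⊗[R] Z)

/-- The action of endomorphisms of the second factor of a triple tensor product. -/
def slot₂ : Module.End R Y →ₐ[R] Module.End R (X ⊗[R] (Y ⊗[R] Z)) :=
  (Module.End.lTensorAlgHom R (Y ⊗[R] Z) X).comp (Module.End.rTensorAlgHom R Y Z)

/-- The action of endomorphisms of the third factor of a triple tensor product. -/
def slot₃ : Module.End R Z →ₐ[R] Module.End R (X ⊗[R] (Y ⊗[R] Z)) :=
  (Module.End.lTensorAlgHom R (Y ⊗[R] Z) X).comp (Module.End.lTensorAlgHom R Z Y)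

variable {R X Y Z}

theorem slot₁_apply (f : Module.End R X) : slot₁ R X Y Z f = map₃ f 1 1 := by
  rw [map₃, TensorProduct.map_one]; rfl

theorem slot₂_apply (f : Module.End R Y) : slot₂ R X Y Z f = map₃ 1 f 1 := rfl

theorem slot₃_apply (f : Module.End R Z) : slot₃ R X Y Z f = map₃ 1 1 f := rfl

theorem slot₁_commute_slot₂ (f : Module.End R X) (g : Module.End R Y) :
    Commute (slot₁ R X Y Z f) (slot₂ R X Y Z g) := by
  simp [Commute, SemiconjBy, slot₁_apply, slot₂_apply, map₃_mul]

theorem slot₃_commute_slot₂ (f : Module.End R Z) (g : Module.End R Y) :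
    Commute (slot₃ R X Y Z f) (slot₂ R X Y Z g) := by
  simp [Commute, SemiconjBy, slot₃_apply, slot₂_apply, map₃_mul]

end Systems

section Clifford

variable {R G : Type*} [CommRing R] [AddCommGroup G] [Module R G]

/-- Left exterior multiplication by a vector. -/
abbrev wedge (v : G) : Module.End R (ExteriorAlgebra R G) :=
  LinearMap.mulLeft R (ExteriorAlgebra.ι R v)

/-- Contraction by a linear form. -/
abbrev contract (a : Module.Dual R G) : Module.End R (ExteriorAlgebra R G) :=
  CliffordAlgebra.contractLeft a

theorem wedge_mul_self (v : G) : wedge (R := R) v * wedge v = 0 :=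
  LinearMap.ext fun x => by
    simp [Module.End.mul_apply, wedge, ← mul_assoc]

theorem wedge_anti (v w : G) : wedge (R := R) v * wedge w = -(wedge w * wedge v) := by
  refine LinearMap.ext fun x => ?_
  have h : ExteriorAlgebra.ι R v * ExteriorAlgebra.ι R w =
      -(ExteriorAlgebra.ι R w * ExteriorAlgebra.ι R v) :=
    eq_neg_of_add_eq_zero_left (ExteriorAlgebra.ι_add_mul_swap v w)
  simp only [Module.End.mul_apply, LinearMap.neg_apply, LinearMap.mulLeft_apply]
  rw [← mul_assoc, h, neg_mul, mul_assoc]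

theorem contract_mul_self (a : Module.Dual R G) : contract a * contract a = 0 :=
  LinearMap.ext fun x => CliffordAlgebra.contractLeft_contractLeft a x

theorem contract_anti (a b : Module.Dual R G) :
    contract a * contract b = -(contract b * contract a) :=
  LinearMap.ext fun x => CliffordAlgebra.contractLeft_comm (d := a) (d' := b) x

theorem wedge_contract (v : G) (a : Module.Dual R G) :
    wedge v * contract a + contract a * wedge v = algebraMap R _ (a v) :=
  LinearMap.ext fun x => by
    rw [LinearMap.add_apply, Module.End.mul_apply, Module.End.mul_apply, LinearMap.mulLeft_apply,
      LinearMap.mulLeft_apply, ExteriorAlgebra.ι, CliffordAlgebra.contractLeft_ι_mul,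
      Module.algebraMap_end_apply]
    abel

theorem contract_wedge (v : G) (a : Module.Dual R G) :
    contract a * wedge v + wedge v * contract a = algebraMap R _ (a v) := by
  rw [add_comm, wedge_contract]

end Clifford

end KoszulBicomplex

end

/-! ### Row and column maps as operators, and the relations of the bicomplex -/

noncomputable section

namespace KoszulBicomplex

open scoped TensorProduct

section Maps

variable {R H G F : Type*} [CommRing R] [AddCommGroup H] [Module R H] [AddCommGroup G] [Module R G]
  [AddCommGroup F] [Module R F] {l m : ℕ}

theorem mulLeft_coord_eq_raise (bH : Module.Basis (Fin l) R H) (j : Fin l) :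
    LinearMap.mulLeft R (SymmetricAlgebra.ι R (Module.Dual R H) (bH.coord j)) =
      raise bH.dualBasis.symmetricAlgebra j := by
  rw [← mulLeft_ι_eq_raise, Module.Basis.coe_dualBasis]

theorem slot₁_mul_slot₂ {X Y Z : Type*} [AddCommGroup X] [Module R X] [AddCommGroup Y] [Module R Y]
    [AddCommGroup Z] [Module R Z] (f : Module.End R X) (g : Module.End R Y) :
    slot₁ R X Y Z f * slot₂ R X Y Z g = map₃ f g 1 := by
  rw [slot₁_apply, slot₂_apply, map₃_mul, mul_one, one_mul, mul_one]

theorem slot₃_mul_slot₂ {X Y Z : Type*} [AddCommGroup X] [Module R X] [AddCommGroup Y] [Module R Y]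
    [AddCommGroup Z] [Module R Z] (f : Module.End R Z) (g : Module.End R Y) :
    slot₃ R X Y Z f * slot₂ R X Y Z g = map₃ 1 g f := by
  rw [slot₃_apply, slot₂_apply, map₃_mul, mul_one, one_mul, mul_one]

/-- The operator `∑ⱼ Aⱼ ⊗ (vⱼ ∧ -)` on `P ⊗ ⋀G ⊗ S(F)`, for the lowering operators `Aⱼ` of `P`. -/
def lowEnd (F : Type*) [AddCommGroup F] [Module R F] {P : Type*} [AddCommGroup P] [Module R P]
    (e : Module.Basis (Fin l →₀ ℕ) R P) (v : Fin l → G) :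
    Module.End R (P ⊗[R] (ExteriorAlgebra R G ⊗[R] SymmetricAlgebra R F)) :=
  ∑ j, slot₁ R _ _ _ (lower e j) * slot₂ R _ _ _ (wedge (v j))

/-- The operator `∑ⱼ Bⱼ ⊗ (vⱼ ∧ -)` on `P ⊗ ⋀G ⊗ S(F)`, for the raising operators `Bⱼ` of `P`. -/
def raiseEnd (F : Type*) [AddCommGroup F] [Module R F] {P : Type*} [AddCommGroup P] [Module R P]
    (e : Module.Basis (Fin l →₀ ℕ) R P) (v : Fin l → G) :
    Module.End R (P ⊗[R] (ExteriorAlgebra R G ⊗[R] SymmetricAlgebra R F)) :=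
  ∑ j, slot₁ R _ _ _ (raise e j) * slot₂ R _ _ _ (wedge (v j))

theorem dPhiWest_eq (bH : Module.Basis (Fin l) R H) (φ : H →ₗ[R] G) :
    dPhiWest F bH φ = lowEnd F (dpBasis bH) (fun j => φ (bH j)) :=
  Finset.sum_congr rfl fun j _ => by
    rw [slot₁_mul_slot₂, dpContract_eq_lower]; rfl

theorem dPhiEast_eq (bH : Module.Basis (Fin l) R H) (φ : H →ₗ[R] G) :
    dPhiEast F bH φ = raiseEnd F bH.dualBasis.symmetricAlgebra (fun j => φ (bH j)) :=
  Finset.sum_congr rfl fun j _ => by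
    rw [slot₁_mul_slot₂, mulLeft_coord_eq_raise]; rfl

/-- The columns, on a tensor product `P ⊗ ⋀G ⊗ S(F)`. -/
def colEnd (P : Type*) [AddCommGroup P] [Module R P] (bF : Module.Basis (Fin m) R F)
    (ψ : G →ₗ[R] F) :
    Module.End R (P ⊗[R] (ExteriorAlgebra R G ⊗[R] SymmetricAlgebra R F)) :=
  ∑ j, slot₃ R _ _ _ (raise bF.symmetricAlgebra j) * slot₂ R _ _ _ (contract (bF.coord j ∘ₗ ψ))

theorem map_id_dPsi (P : Type*) [AddCommGroup P] [Module R P] (bF : Module.Basis (Fin m) R F)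
    (ψ : G →ₗ[R] F) :
    TensorProduct.map LinearMap.id (dPsi bF ψ) = colEnd P bF ψ := by
  rw [colEnd, dPsi, ← TensorProduct.mapBilinear_apply, map_sum]
  refine Finset.sum_congr rfl fun j _ => ?_
  rw [slot₃_mul_slot₂, mulLeft_ι_eq_raise]
  rfl

theorem list_wedge_prod (v : Fin l → G) :
    ((List.finRange l).map fun j => wedge (R := R) (v j)).prod =
      LinearMap.mulLeft R (ExteriorAlgebra.ιMulti R l v) := by
  rw [ExteriorAlgebra.ιMulti_apply, List.ofFn_eq_map]
  generalize List.finRange l = L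
  induction L with
  | nil => ext; simp
  | cons j L ih =>
    simp only [List.map_cons, List.prod_cons]
    rw [ih, LinearMap.mulLeft_mul]
    rfl

/-- The exterior multiplication by the product of a list of vectors on `P ⊗ ⋀G ⊗ S(F)`. -/
def volEnd (P F : Type*) [AddCommGroup P] [Module R P] [AddCommGroup F] [Module R F]
    (v : Fin l → G) : Module.End R (P ⊗[R] (ExteriorAlgebra R G ⊗[R] SymmetricAlgebra R F)) :=
  ((List.finRange l).map fun j => slot₂ R _ _ _ (wedge (R := R) (v j))).prod

theorem volEnd_eq (P F : Type*) [AddCommGroup P] [Module R P] [AddCommGroup F] [Module R F]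
    (v : Fin l → G) :
    volEnd P F v = map₃ 1 (LinearMap.mulLeft R (ExteriorAlgebra.ιMulti R l v)) 1 := by
  rw [← list_wedge_prod, ← slot₂_apply, map_list_prod, List.map_map]
  rfl

/-- The identification of the parts of degree `0` of `D(H)` and `S(H*)`. -/
def westToEast (R H G F : Type*) [CommRing R] [AddCommGroup H] [Module R H] [AddCommGroup G]
    [Module R G] [AddCommGroup F] [Module R F] : WestTotal R H G F →ₗ[R] EastTotal R H G F :=
  map₃ (Algebra.linearMap R _ ∘ₗ (dpAug R H).toLinearMap) 1 1

/-- The identification of the parts of degree `0` of `S(H*)` and `D(H)`. -/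
def eastToWest (R H G F : Type*) [CommRing R] [AddCommGroup H] [Module R H] [AddCommGroup G]
    [Module R G] [AddCommGroup F] [Module R F] : EastTotal R H G F →ₗ[R] WestTotal R H G F :=
  map₃ (Algebra.linearMap R _ ∘ₗ (SymmetricAlgebra.algebraMapInv).toLinearMap) 1 1

theorem nuPhi_eq (bH : Module.Basis (Fin l) R H) (φ : H →ₗ[R] G) :
    nuPhi F bH φ = volEnd _ F (fun j => φ (bH j)) ∘ₗ westToEast R H G F := by
  rw [volEnd_eq, westToEast, map₃, map₃, ← TensorProduct.map_comp, ← TensorProduct.map_comp]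
  rfl

/-- Exterior multiplication and the identification of degree 0 parts concern different tensor
factors, so their order is immaterial. This order suits ν after `dPhiWest`, the other one `dPhiEast`
after ν. -/
theorem nuPhi_eq' (bH : Module.Basis (Fin l) R H) (φ : H →ₗ[R] G) :
    nuPhi F bH φ = westToEast R H G F ∘ₗ volEnd _ F (fun j => φ (bH j)) := by
  rw [volEnd_eq, westToEast, map₃, map₃, ← TensorProduct.map_comp, ← TensorProduct.map_comp]
  rfl

theorem westToEast_colEnd (bF : Module.Basis (Fin m) R F) (ψ : G →ₗ[R] F) :
    westToEast R H G F ∘ₗ colEnd _ bF ψ = colEnd _ bF ψ ∘ₗ westToEast R H G F := by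
  rw [← map_id_dPsi, ← map_id_dPsi, westToEast, map₃, TensorProduct.map_one,
    ← TensorProduct.map_comp, ← TensorProduct.map_comp]
  rfl

/-! ### The relations of the bicomplex -/

theorem rowMap_inWest (bH : Module.Basis (Fin l) R H) (φ : H →ₗ[R] G) (q : ℕ)
    (u : WestTotal R H G F) : rowMap bH φ q (inWest R H G F u) =
      inWest R H G F (dPhiWest F bH φ u) +
        (-1 : R) ^ ((l + 1) * q) • inEast R H G F (nuPhi F bH φ u) := by
  have h1 : outWest R H G F (inWest R H G F u) = u := rfl
  have h2 : outEast R H G F (inWest R H G F u) = 0 := rfl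
  simp [rowMap, h1, h2]

theorem rowMap_inEast (bH : Module.Basis (Fin l) R H) (φ : H →ₗ[R] G) (q : ℕ)
    (u : EastTotal R H G F) : rowMap bH φ q (inEast R H G F u) =
      inEast R H G F (dPhiEast F bH φ u) := by
  have h1 : outWest R H G F (inEast R H G F u) = 0 := rfl
  have h2 : outEast R H G F (inEast R H G F u) = u := rfl
  simp [rowMap, h1, h2]

theorem colMap_inWest (bF : Module.Basis (Fin m) R F) (ψ : G →ₗ[R] F)
    (u : WestTotal R H G F) :
    colMap H bF ψ (inWest R H G F u) = inWest R H G F (colEnd _ bF ψ u) := by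
  have h1 : outWest R H G F (inWest R H G F u) = u := rfl
  have h2 : outEast R H G F (inWest R H G F u) = 0 := rfl
  simp [colMap, h1, h2, map_id_dPsi]

theorem colMap_inEast (bF : Module.Basis (Fin m) R F) (ψ : G →ₗ[R] F)
    (u : EastTotal R H G F) :
    colMap H bF ψ (inEast R H G F u) = inEast R H G F (colEnd _ bF ψ u) := by
  have h1 : outWest R H G F (inEast R H G F u) = 0 := rfl
  have h2 : outEast R H G F (inEast R H G F u) = u := rfl
  simp [colMap, h1, h2, map_id_dPsi]

theorem inWest_injective : Function.Injective (inWest R H G F) := fun _ _ h =>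
  congrArg Prod.fst h

theorem inEast_injective : Function.Injective (inEast R H G F) := fun _ _ h =>
  congrArg Prod.snd h

theorem inWest_add_inEast_eq_zero {u : WestTotal R H G F} {v : EastTotal R H G F}
    (h : inWest R H G F u + inEast R H G F v = 0) : u = 0 ∧ v = 0 := by
  have h1 : u + 0 = 0 := congrArg Prod.fst h
  have h2 : 0 + v = 0 := congrArg Prod.snd h
  exact ⟨by simpa using h1, by simpa using h2⟩

theorem total_induction {P : Total R H G F → Prop} (h1 : ∀ u, P (inWest R H G F u))
    (h2 : ∀ u, P (inEast R H G F u)) (h3 : ∀ x y, P x → P y → P (x + y)) (x : Total R H G F) :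
    P x := by
  have e : x = inWest R H G F (outWest R H G F x) + inEast R H G F (outEast R H G F x) := by
    change (x.1, x.2) = (x.1 + 0, 0 + x.2)
    rw [add_zero, zero_add]
  rw [e]
  exact h3 _ _ (h1 _) (h2 _)

section Generic

variable {P : Type*} [AddCommGroup P] [Module R P] (e : Module.Basis (Fin l →₀ ℕ) R P)
  (v : Fin l → G)

theorem lowEnd_mul_self : lowEnd F e v * lowEnd F e v = 0 := by
  rw [lowEnd, sum_mul_self_eq_zero]
  · exact fun i j => (lower_commute _ i j).map _
  · exact fun i j => slot₁_commute_slot₂ _ _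
  · exact fun i => by rw [← map_mul, wedge_mul_self, map_zero]
  · exact fun i j => by rw [← map_mul, wedge_anti, map_neg, map_mul]

theorem raiseEnd_mul_self : raiseEnd F e v * raiseEnd F e v = 0 := by
  rw [raiseEnd, sum_mul_self_eq_zero]
  · exact fun i j => (raise_commute _ i j).map _
  · exact fun i j => slot₁_commute_slot₂ _ _
  · exact fun i => by rw [← map_mul, wedge_mul_self, map_zero]
  · exact fun i j => by rw [← map_mul, wedge_anti, map_neg, map_mul]

end Generic

theorem dPhiWest_dPhiWest (bH : Module.Basis (Fin l) R H) (φ : H →ₗ[R] G)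
    (u : WestTotal R H G F) : dPhiWest F bH φ (dPhiWest F bH φ u) = 0 := by
  rw [dPhiWest_eq]
  exact LinearMap.congr_fun (lowEnd_mul_self (dpBasis bH) fun j => φ (bH j)) u

theorem dPhiEast_dPhiEast (bH : Module.Basis (Fin l) R H) (φ : H →ₗ[R] G)
    (u : EastTotal R H G F) : dPhiEast F bH φ (dPhiEast F bH φ u) = 0 := by
  rw [dPhiEast_eq]
  exact LinearMap.congr_fun
    (raiseEnd_mul_self bH.dualBasis.symmetricAlgebra fun j => φ (bH j)) u

theorem colEnd_mul_self (P : Type*) [AddCommGroup P] [Module R P] (bF : Module.Basis (Fin m) R F)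
    (ψ : G →ₗ[R] F) : colEnd P bF ψ * colEnd P bF ψ = 0 := by
  rw [colEnd, sum_mul_self_eq_zero]
  · exact fun i j => (raise_commute _ i j).map _
  · exact fun i j => slot₃_commute_slot₂ _ _
  · exact fun i => by rw [← map_mul, contract_mul_self, map_zero]
  · exact fun i j => by rw [← map_mul, contract_anti, map_neg, map_mul]

theorem volEnd_mul_slot₂ (P : Type*) [AddCommGroup P] [Module R P] (v : Fin l → G) (j : Fin l) :
    volEnd P F v * slot₂ R _ _ _ (wedge (v j)) = 0 :=
  list_prod_mul_eq_zero (θ := fun j => slot₂ R P _ (SymmetricAlgebra R F) (wedge (v j)))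
    (fun i => by rw [← map_mul, wedge_mul_self, map_zero])
    (fun i j => by rw [← map_mul, wedge_anti, map_neg, map_mul]) (List.mem_finRange j)

theorem slot₂_mul_volEnd (P : Type*) [AddCommGroup P] [Module R P] (v : Fin l → G) (j : Fin l) :
    slot₂ R _ _ _ (wedge (v j)) * volEnd P F v = 0 :=
  mul_list_prod_eq_zero (θ := fun j => slot₂ R P _ (SymmetricAlgebra R F) (wedge (v j)))
    (fun i => by rw [← map_mul, wedge_mul_self, map_zero])
    (fun i j => by rw [← map_mul, wedge_anti, map_neg, map_mul]) (List.mem_finRange j)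

theorem nuPhi_dPhiWest (bH : Module.Basis (Fin l) R H) (φ : H →ₗ[R] G)
    (u : WestTotal R H G F) : nuPhi F bH φ (dPhiWest F bH φ u) = 0 := by
  rw [nuPhi_eq', LinearMap.comp_apply, ← Module.End.mul_apply, dPhiWest_eq, lowEnd, Finset.mul_sum]
  rw [Finset.sum_eq_zero, LinearMap.zero_apply, map_zero]
  intro j _
  rw [(slot₁_commute_slot₂ _ _).eq, ← mul_assoc, volEnd_mul_slot₂ _ (fun j => φ (bH j)), zero_mul]

theorem dPhiEast_nuPhi (bH : Module.Basis (Fin l) R H) (φ : H →ₗ[R] G)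
    (u : WestTotal R H G F) : dPhiEast F bH φ (nuPhi F bH φ u) = 0 := by
  rw [nuPhi_eq, LinearMap.comp_apply, ← Module.End.mul_apply, dPhiEast_eq, raiseEnd, Finset.sum_mul]
  rw [Finset.sum_eq_zero, LinearMap.zero_apply]
  intro j _
  rw [mul_assoc, slot₂_mul_volEnd _ (fun j => φ (bH j)), mul_zero]

theorem rowMap_rowMap (bH : Module.Basis (Fin l) R H) (φ : H →ₗ[R] G) (q : ℕ)
    (x : Total R H G F) : rowMap bH φ q (rowMap bH φ q x) = 0 := by
  induction x using total_induction with
  | h1 u =>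
    rw [rowMap_inWest, map_add, map_smul, rowMap_inWest, rowMap_inEast, dPhiWest_dPhiWest,
      nuPhi_dPhiWest, dPhiEast_nuPhi]
    simp
  | h2 u => rw [rowMap_inEast, rowMap_inEast, dPhiEast_dPhiEast, map_zero]
  | h3 x y hx hy => rw [map_add, map_add, hx, hy, add_zero]

theorem colMap_colMap (bF : Module.Basis (Fin m) R F) (ψ : G →ₗ[R] F) (x : Total R H G F) :
    colMap H bF ψ (colMap H bF ψ x) = 0 := by
  induction x using total_induction with
  | h1 u =>
    rw [colMap_inWest, colMap_inWest, ← Module.End.mul_apply, colEnd_mul_self,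
      LinearMap.zero_apply, map_zero]
  | h2 u =>
    rw [colMap_inEast, colMap_inEast, ← Module.End.mul_apply, colEnd_mul_self,
      LinearMap.zero_apply, map_zero]
  | h3 x y hx hy => rw [map_add, map_add, hx, hy, add_zero]

theorem slot₁_commute_slot₃ {X Y Z : Type*} [AddCommGroup X] [Module R X] [AddCommGroup Y]
    [Module R Y] [AddCommGroup Z] [Module R Z] (f : Module.End R X) (g : Module.End R Z) :
    Commute (slot₁ R X Y Z f) (slot₃ R X Y Z g) := by
  simp [Commute, SemiconjBy, slot₁_apply, slot₃_apply, map₃_mul]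

theorem wedge_mul_contract {v : G} {a : Module.Dual R G} (h : a v = 0) :
    wedge v * contract a = -(contract a * wedge v) := by
  rw [eq_neg_iff_add_eq_zero, wedge_contract, h, map_zero]

variable {bF : Module.Basis (Fin m) R F} {φ : H →ₗ[R] G} {ψ : G →ₗ[R] F}

section Generic

variable {P : Type*} [AddCommGroup P] [Module R P] (e : Module.Basis (Fin l →₀ ℕ) R P)
  {v : Fin l → G}

theorem lowEnd_mul_colEnd (h : ∀ i, ψ (v i) = 0) :
    lowEnd F e v * colEnd P bF ψ + colEnd P bF ψ * lowEnd F e v = 0 := by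
  rw [lowEnd, colEnd, sum_mul_sum_anti, neg_add_cancel]
  · exact fun i j => slot₁_commute_slot₃ _ _
  · exact fun i j => slot₁_commute_slot₂ _ _
  · exact fun i j => (slot₃_commute_slot₂ _ _).symm
  · exact fun i j => by rw [← map_mul, wedge_mul_contract (by simp [h]), map_neg, map_mul]

theorem raiseEnd_mul_colEnd (h : ∀ i, ψ (v i) = 0) :
    raiseEnd F e v * colEnd P bF ψ + colEnd P bF ψ * raiseEnd F e v = 0 := by
  rw [raiseEnd, colEnd, sum_mul_sum_anti, neg_add_cancel]
  · exact fun i j => slot₁_commute_slot₃ _ _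
  · exact fun i j => slot₁_commute_slot₂ _ _
  · exact fun i j => (slot₃_commute_slot₂ _ _).symm
  · exact fun i j => by rw [← map_mul, wedge_mul_contract (by simp [h]), map_neg, map_mul]

end Generic

theorem dPhiWest_colEnd (bH : Module.Basis (Fin l) R H) (h : ψ ∘ₗ φ = 0)
    (u : WestTotal R H G F) :
    dPhiWest F bH φ (colEnd _ bF ψ u) + colEnd _ bF ψ (dPhiWest F bH φ u) = 0 := by
  rw [dPhiWest_eq]
  exact LinearMap.congr_fun (lowEnd_mul_colEnd (bF := bF) (ψ := ψ) (dpBasis bH)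
    fun i => LinearMap.congr_fun h (bH i)) u

theorem dPhiEast_colEnd (bH : Module.Basis (Fin l) R H) (h : ψ ∘ₗ φ = 0)
    (u : EastTotal R H G F) :
    dPhiEast F bH φ (colEnd _ bF ψ u) + colEnd _ bF ψ (dPhiEast F bH φ u) = 0 := by
  rw [dPhiEast_eq]
  exact LinearMap.congr_fun (raiseEnd_mul_colEnd (bF := bF) (ψ := ψ)
    bH.dualBasis.symmetricAlgebra fun i => LinearMap.congr_fun h (bH i)) u

theorem volEnd_mul_colEnd (P : Type*) [AddCommGroup P] [Module R P] (v : Fin l → G)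
    (h : ∀ i, ψ (v i) = 0) :
    volEnd P F v * colEnd P bF ψ = (-1) ^ l * (colEnd P bF ψ * volEnd P F v) := by
  have := list_prod_mul_of_anti (θ := fun j => slot₂ R P _ (SymmetricAlgebra R F) (wedge (v j)))
    (y := colEnd P bF ψ) (fun i => mul_sum_anti
      (C := fun j => slot₃ R _ _ _ (raise bF.symmetricAlgebra j))
      (θ := fun j => slot₂ R _ _ _ (contract (bF.coord j ∘ₗ ψ)))
      (fun j => (slot₃_commute_slot₂ _ _).symm) (fun j => by
        rw [← map_mul, wedge_mul_contract (by simp [h]), map_neg, map_mul])) (List.finRange l)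
  rwa [List.length_finRange] at this

/-- Since ψφ = 0, each φ(hⱼ) ∧ - anticommutes with the column map; moving it past l of them gives
the sign (-1)^l. -/
theorem nuPhi_colEnd (bH : Module.Basis (Fin l) R H) (h : ψ ∘ₗ φ = 0)
    (u : WestTotal R H G F) :
    nuPhi F bH φ (colEnd _ bF ψ u) = (-1 : R) ^ l • colEnd _ bF ψ (nuPhi F bH φ u) := by
  have h1 := LinearMap.congr_fun (westToEast_colEnd (H := H) bF ψ) u
  have h2 := LinearMap.congr_fun (volEnd_mul_colEnd (F := F) (bF := bF)
    (SymmetricAlgebra R (Module.Dual R H)) (fun j => φ (bH j))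
    fun i => LinearMap.congr_fun h (bH i)) (westToEast R H G F u)
  rw [LinearMap.comp_apply, LinearMap.comp_apply] at h1
  rw [nuPhi_eq, LinearMap.comp_apply, h1, ← Module.End.mul_apply, h2]
  rcases neg_one_pow_eq_or R l with e | e <;> rcases neg_one_pow_eq_or ℤ l with e' | e'
  all_goals
    have : ((-1 : Module.End R (EastTotal R H G F)) ^ l) =
      algebraMap R _ ((-1 : R) ^ l) := by simp
    rw [this, Module.End.mul_apply, Module.algebraMap_end_apply]
    rfl

theorem rowMap_colMap (bH : Module.Basis (Fin l) R H) (h : ψ ∘ₗ φ = 0) (q : ℕ)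
    (x : Total R H G F) :
    rowMap bH φ (q + 1) (colMap H bF ψ x) = -colMap H bF ψ (rowMap bH φ q x) := by
  induction x using total_induction with
  | h1 u =>
    -- From row q to row q + 1 the sign of the row map at p = t changes by (-1)^(l+1), and passing
    -- the column map costs (-1)^l; together this is -1.
    have e : (-1 : R) ^ ((l + 1) * (q + 1)) * (-1) ^ l + (-1) ^ ((l + 1) * q) = 0 := by
      rw [← pow_add, show (l + 1) * (q + 1) + l = (l + 1) * q + 1 + 2 * l by ring,
        pow_add _ _ (2 * l), pow_mul, pow_succ]
      simp
    rw [eq_neg_iff_add_eq_zero, colMap_inWest, rowMap_inWest, rowMap_inWest, map_add, map_smul,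
      colMap_inWest, colMap_inEast, nuPhi_colEnd bH h, map_smul, smul_smul, add_add_add_comm,
      ← map_add, dPhiWest_colEnd bH h, ← add_smul, e, zero_smul, map_zero, add_zero]
  | h2 u =>
    rw [eq_neg_iff_add_eq_zero, colMap_inEast, rowMap_inEast, rowMap_inEast, colMap_inEast,
      ← map_add, dPhiEast_colEnd bH h, map_zero]
  | h3 x y hx hy => rw [map_add, map_add, map_add, map_add, hx, hy, neg_add]

end Maps

end KoszulBicomplex

end

/-! ### Graded Koszul systems and their instances in the rows and columns -/

noncomputable section

namespace KoszulBicomplex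

open scoped TensorProduct

/-- A Koszul system of operators on a module with a family of submodules `W a k`, such that the
lowering and raising operators change `a` and the other operators change `k` by one. -/
structure IsGradedKoszulSystem {R T : Type*} [CommRing R] [AddCommGroup T] [Module R T] {l : ℕ}
    (δ : R) (A B θ ι : Fin l → Module.End R T) (W : ℕ → ℤ → Submodule R T) : Prop
    extends IsKoszulSystem δ A B θ ι where
  lower_mem : ∀ j a k, ∀ x ∈ W (a + 1) k, A j x ∈ W a k
  lower_zero : ∀ j k, ∀ x ∈ W 0 k, A j x = 0
  raise_mem : ∀ j a k, ∀ x ∈ W a k, B j x ∈ W (a + 1) k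
  theta_mem : ∀ j a k, ∀ x ∈ W a k, θ j x ∈ W a (k + 1)
  iota_mem : ∀ j a k, ∀ x ∈ W a k, ι j x ∈ W a (k - 1)
  prod_one_sub : ∀ a k, ∀ x ∈ W (a + 1) k, ((List.finRange l).map fun j => 1 - B j * A j).prod x = 0

namespace IsGradedKoszulSystem

variable {R T : Type*} [CommRing R] [AddCommGroup T] [Module R T] {l : ℕ} {δ : R}
  {A B θ ι : Fin l → Module.End R T} {W : ℕ → ℤ → Submodule R T}
  (h : IsGradedKoszulSystem δ A B θ ι W)

include h

theorem one_sub_mem (j : Fin l) (a : ℕ) (k : ℤ) {x : T} (hx : x ∈ W a k) :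
    (1 - B j * A j : Module.End R T) x ∈ W a k := by
  rw [LinearMap.sub_apply, Module.End.mul_apply, Module.End.one_apply]
  refine sub_mem hx ?_
  cases a with
  | zero => rw [h.lower_zero j k x hx, map_zero]; exact zero_mem _
  | succ a => exact h.raise_mem j a k _ (h.lower_mem j a k x hx)

theorem iota_theta_mem (j : Fin l) (a : ℕ) (k : ℤ) {x : T} (hx : x ∈ W a k) :
    ι j (θ j x) ∈ W a k := by
  simpa using h.iota_mem j a _ _ (h.theta_mem j a k x hx)

theorem theta_iota_mem (j : Fin l) (a : ℕ) (k : ℤ) {x : T} (hx : x ∈ W a k) :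
    θ j (ι j x) ∈ W a k := by
  simpa using h.theta_mem j a _ _ (h.iota_mem j a k x hx)

theorem west_exact_succ {a : ℕ} {k : ℤ} {x : T} (hx : x ∈ W (a + 1) k)
    (hd : (∑ j, A j * θ j) x = 0) :
    ∃ y ∈ W (a + 2) (k - 1), (∑ j, A j * θ j) y = δ ^ l • x :=
  h.west_exact (U := W (a + 1) k) (fun j _ hx => h.raise_mem j _ _ _ (h.iota_mem j _ _ _ hx))
    (fun j _ hx => h.one_sub_mem j _ _ (h.iota_theta_mem j _ _ hx)) hx hd
    (h.west_prod_eq_zero (h.prod_one_sub a k x hx))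

theorem sum_lower_theta_eq_zero {k : ℤ} {x : T} (hx : x ∈ W 0 k) : (∑ j, A j * θ j) x = 0 := by
  rw [LinearMap.sum_apply]
  exact Finset.sum_eq_zero fun j _ => h.lower_zero j _ _ (h.theta_mem j _ _ x hx)

theorem west_exact_zero {k : ℤ} {x : T} (hx : x ∈ W 0 k)
    (hθ : ((List.finRange l).map θ).prod x = 0) :
    ∃ y ∈ W 1 (k - 1), (∑ j, A j * θ j) y = δ ^ l • x :=
  h.west_exact (U := W 0 k) (fun j _ hx => h.raise_mem j _ _ _ (h.iota_mem j _ _ _ hx))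
    (fun j _ hx => h.one_sub_mem j _ _ (h.iota_theta_mem j _ _ hx)) hx
    (h.sum_lower_theta_eq_zero hx) (h.west_prod_eq_zero_of_theta hθ)

theorem east_exact_succ {a : ℕ} {k : ℤ} {x : T} (hx : x ∈ W (a + 1) k)
    (hd : (∑ j, B j * θ j) x = 0) :
    ∃ y ∈ W a (k - 1), (∑ j, B j * θ j) y = δ ^ l • x :=
  h.east_exact (U := W (a + 1) k) (fun j _ hx => h.lower_mem j _ _ _ (h.iota_mem j _ _ _ hx))
    (fun j _ hx => h.one_sub_mem j _ _ (h.theta_iota_mem j _ _ hx)) hx hd (h.prod_one_sub a k x hx)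

/-- A degree 0 cycle of the raising complex is killed by every θⱼ, hence up to δ^l it comes from the
splicing map, not from a raising differential. -/
theorem east_exact_zero {k : ℤ} {x : T} (hx : x ∈ W 0 k) (hd : (∑ j, B j * θ j) x = 0) :
    ∃ z ∈ W 0 (k - l), ((List.finRange l).map θ).prod z = δ ^ l • x := by
  obtain ⟨z, hz, e⟩ := h.exists_theta_prod_eq (W := W 0) (fun j k x hx => h.iota_mem j 0 k x hx)
    (List.nodup_finRange l) k x hx
    (fun j _ => h.theta_eq_zero_of_east (fun j => h.lower_zero j k x hx) hd j)
  rw [List.length_finRange] at hz e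
  exact ⟨z, hz, e⟩

end IsGradedKoszulSystem

section Rows

variable {R G P F : Type*} [CommRing R] [AddCommGroup G] [Module R G] [AddCommGroup F] [Module R F]
  [AddCommGroup P] [Module R P] {l : ℕ}

theorem prod_one_sub_slot {X E : Type*} [AddCommGroup X] [Module R X] [Ring E] [Algebra R E]
    (e : Module.Basis (Fin l →₀ ℕ) R X) (f : Module.End R X →ₐ[R] E) :
    ((List.finRange l).map fun j => 1 - f (raise e j) * f (lower e j)).prod =
      f ((List.finRange l).map fun j => 1 - raise e j * lower e j).prod := by
  rw [map_list_prod, List.map_map]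
  congr 2
  funext j
  simp

/-- The basis `e` can be that of D(H) or that of S(H*), so one statement serves both halves of a
row. -/
theorem isGradedKoszulSystem_row (e : Module.Basis (Fin l →₀ ℕ) R P) {v : Fin l → G}
    {a : Fin l → Module.Dual R G} {δ : R} (h : ∀ i j, a j (v i) = if i = j then δ else 0)
    (C : Submodule R (SymmetricAlgebra R F)) :
    IsGradedKoszulSystem δ (fun j => slot₁ R P (ExteriorAlgebra R G) _ (lower e j))
      (fun j => slot₁ R _ _ _ (raise e j)) (fun j => slot₂ R _ _ _ (wedge (v j)))
      (fun j => slot₂ R _ _ _ (contract (a j)))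
      (fun d k => tensorPiece (homPiece e d) (extZ R G k) C) where
  toIsKoszulSystem := isKoszulSystem_of_commute e (fun j => wedge_mul_self _)
    (fun i j => wedge_anti _ _)
    (fun i j => by rw [wedge_contract, h]; split_ifs <;> simp) _ _ slot₁_commute_slot₂
  lower_mem j d k := by
    rw [slot₁_apply]
    exact map₃_mem (fun x hx => lower_mem e j hx) (fun _ h => h) (fun _ h => h)
  lower_zero j k := by
    rw [slot₁_apply]
    exact map₃_eq_zero (Or.inl fun x hx => lower_eq_zero e j hx)
  raise_mem j d k := by
    rw [slot₁_apply]
    exact map₃_mem (fun x hx => raise_mem e j hx) (fun _ h => h) (fun _ h => h)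
  theta_mem j d k := map₃_mem (fun _ h => h) (fun x hx => ι_mul_mem_extZ (v j) hx) (fun _ h => h)
  iota_mem j d k := map₃_mem (fun _ h => h) (fun x hx => contractLeft_mem_extZ (a j) hx)
    (fun _ h => h)
  prod_one_sub d k := by
    rw [prod_one_sub_slot e (slot₁ R P (ExteriorAlgebra R G) (SymmetricAlgebra R F)),
      slot₁_apply]
    exact map₃_eq_zero (Or.inl fun x hx => prod_one_sub_eq_zero e hx)

end Rows

section Columns

variable {R G P F : Type*} [CommRing R] [AddCommGroup G] [Module R G] [AddCommGroup F] [Module R F]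
  [AddCommGroup P] [Module R P] {m : ℕ}

/-- Here θ contracts and ι multiplies, so the second degree is the negative of the exterior
exponent. With its monomial basis S(F) carries lowering operators as well and can stand in for
divided powers, which is used to prolong columns to the left. -/
theorem isGradedKoszulSystem_col (bF : Module.Basis (Fin m) R F) {v : Fin m → G}
    {a : Fin m → Module.Dual R G} {δ : R} (h : ∀ i j, a i (v j) = if i = j then δ else 0)
    (D : Submodule R P) :
    IsGradedKoszulSystem δ (fun j => slot₃ R P (ExteriorAlgebra R G) _ (lower bF.symmetricAlgebra j))
      (fun j => slot₃ R _ _ _ (raise bF.symmetricAlgebra j))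
      (fun j => slot₂ R _ _ _ (contract (a j))) (fun j => slot₂ R _ _ _ (wedge (v j)))
      (fun d k => tensorPiece D (extZ R G (-k)) (symPow R F d)) where
  toIsKoszulSystem := isKoszulSystem_of_commute bF.symmetricAlgebra (fun j => contract_mul_self _)
    (fun i j => contract_anti _ _)
    (fun i j => by rw [contract_wedge, h]; split_ifs <;> simp) _ _ slot₃_commute_slot₂
  lower_mem j d k := by
    rw [symPow_eq_homPiece bF, symPow_eq_homPiece bF]
    exact map₃_mem (fun _ h => h) (fun _ h => h) (fun x hx => lower_mem _ j hx)
  lower_zero j k := by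
    rw [symPow_eq_homPiece bF]
    exact map₃_eq_zero (Or.inr <| Or.inr fun x hx => lower_eq_zero _ j hx)
  raise_mem j d k := by
    rw [symPow_eq_homPiece bF, symPow_eq_homPiece bF]
    exact map₃_mem (fun _ h => h) (fun _ h => h) (fun x hx => raise_mem _ j hx)
  theta_mem j d k := map₃_mem (fun _ h => h)
    (fun x hx => by
      rw [neg_add']
      exact contractLeft_mem_extZ (a j) hx) (fun _ h => h)
  iota_mem j d k := map₃_mem (fun _ h => h)
    (fun x hx => by
      rw [neg_sub', sub_neg_eq_add]
      exact ι_mul_mem_extZ (v j) hx) (fun _ h => h)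
  prod_one_sub d k := by
    rw [prod_one_sub_slot bF.symmetricAlgebra
      (slot₃ R P (ExteriorAlgebra R G) (SymmetricAlgebra R F)), slot₃_apply, symPow_eq_homPiece bF]
    exact map₃_eq_zero (Or.inr <| Or.inr fun x hx => prod_one_sub_eq_zero _ hx)

end Columns

end KoszulBicomplex

end

/-! ### Dual families from minors, the cells of the bicomplex, and exactness of the rows -/

noncomputable section

namespace KoszulBicomplex

open scoped TensorProduct

/-! ### Linear forms and vectors dual to a family, up to a minor -/

section Minors

variable {R G F : Type*} [CommRing R] [AddCommGroup G] [Module R G] [AddCommGroup F] [Module R F]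

theorem exists_dual_families_of_minor {a b k : ℕ} (A : Matrix (Fin a) (Fin b) R)
    (e : Fin k → Fin a) (f : Fin k → Fin b) : ∃ B : Matrix (Fin k) (Fin k) R,
      B * A.submatrix e f = (A.submatrix e f).det • 1 ∧
      A.submatrix e f * B = (A.submatrix e f).det • 1 :=
  ⟨_, Matrix.adjugate_mul _, Matrix.mul_adjugate _⟩

/-- The rows of the adjugate are the coefficients of the forms; a permutation of the columns is
undone by its inverse. -/
theorem exists_forms_of_minor {n l : ℕ} (bG : Module.Basis (Fin n) R G)
    {H : Type*} [AddCommGroup H] [Module R H] (bH : Module.Basis (Fin l) R H) (φ : H →ₗ[R] G)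
    (e : Fin l → Fin n) (f : Fin l → Fin l) : ∃ a : Fin l → Module.Dual R G, ∀ i j,
      a j (φ (bH i)) = if i = j then ((LinearMap.toMatrix bH bG φ).submatrix e f).det else 0 := by
  by_cases hf : Function.Injective f
  · obtain ⟨σ, rfl⟩ : ∃ σ : Equiv.Perm (Fin l), f = σ :=
      ⟨Equiv.ofBijective f (Finite.injective_iff_bijective.1 hf), rfl⟩
    obtain ⟨B, hB, -⟩ := exists_dual_families_of_minor (LinearMap.toMatrix bH bG φ) e σ
    refine ⟨fun j => ∑ i, B (σ.symm j) i • bG.coord (e i), fun i j => ?_⟩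
    have h := congrFun (congrFun hB (σ.symm j)) (σ.symm i)
    simp only [Matrix.mul_apply, Matrix.submatrix_apply, Matrix.smul_apply, Matrix.one_apply,
      LinearMap.toMatrix_apply, Equiv.apply_symm_apply, smul_eq_mul, mul_ite, mul_one,
      mul_zero, EmbeddingLike.apply_eq_iff_eq] at h
    simp only [LinearMap.sum_apply, LinearMap.smul_apply, Module.Basis.coord_apply, smul_eq_mul]
    rw [h]
    simp only [eq_comm]
  -- A repeated column makes the minor zero, and then zero forms suffice.
  · refine ⟨0, fun i j => ?_⟩
    obtain ⟨i', j', h, hne⟩ := Function.not_injective_iff.1 hf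
    rw [Matrix.det_zero_of_column_eq hne (fun k => by simp [h])]
    simp

theorem exists_vectors_of_minor {n m : ℕ} (bG : Module.Basis (Fin n) R G)
    (bF : Module.Basis (Fin m) R F) (ψ : G →ₗ[R] F) (e : Fin m → Fin m) (f : Fin m → Fin n) :
    ∃ v : Fin m → G, ∀ i j, (bF.coord i ∘ₗ ψ) (v j) =
      if i = j then ((LinearMap.toMatrix bG bF ψ).submatrix e f).det else 0 := by
  by_cases he : Function.Injective e
  · obtain ⟨σ, rfl⟩ : ∃ σ : Equiv.Perm (Fin m), e = σ :=
      ⟨Equiv.ofBijective e (Finite.injective_iff_bijective.1 he), rfl⟩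
    obtain ⟨B, -, hB⟩ := exists_dual_families_of_minor (LinearMap.toMatrix bG bF ψ) σ f
    refine ⟨fun j => ∑ i, B i (σ.symm j) • bG (f i), fun i j => ?_⟩
    have h := congrFun (congrFun hB (σ.symm i)) (σ.symm j)
    simp only [Matrix.mul_apply, Matrix.submatrix_apply, Matrix.smul_apply, Matrix.one_apply,
      LinearMap.toMatrix_apply, Equiv.apply_symm_apply, smul_eq_mul, mul_ite, mul_one,
      mul_zero, EmbeddingLike.apply_eq_iff_eq] at h
    rw [LinearMap.comp_apply, map_sum, map_sum, ← h]
    exact Finset.sum_congr rfl fun k _ => by simp [mul_comm]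
  · refine ⟨0, fun i j => ?_⟩
    obtain ⟨i', j', h, hne⟩ := Function.not_injective_iff.1 he
    rw [Matrix.det_zero_of_row_eq hne (by ext k; simp [h])]
    simp

end Minors

/-! ### The operators and the graded pieces -/

section Pieces

variable {R G F P : Type*} [CommRing R] [AddCommGroup G] [Module R G] [AddCommGroup F] [Module R F]
  [AddCommGroup P] [Module R P] {l m : ℕ}

theorem lowEnd_mem (e : Module.Basis (Fin l →₀ ℕ) R P) (v : Fin l → G) {a : ℕ} {k : ℤ}
    {C : Submodule R (SymmetricAlgebra R F)}
    {x : P ⊗[R] (ExteriorAlgebra R G ⊗[R] SymmetricAlgebra R F)}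
    (hx : x ∈ tensorPiece (homPiece e (a + 1)) (extZ R G k) C) :
    lowEnd F e v x ∈ tensorPiece (homPiece e a) (extZ R G (k + 1)) C := by
  rw [lowEnd, LinearMap.sum_apply]
  refine sum_mem fun j _ => ?_
  rw [slot₁_mul_slot₂]
  exact map₃_mem (fun x hx => lower_mem e j hx) (fun y hy => ι_mul_mem_extZ (v j) hy)
    (fun _ h => h) x hx

theorem lowEnd_eq_zero (e : Module.Basis (Fin l →₀ ℕ) R P) (v : Fin l → G)
    {B : Submodule R (ExteriorAlgebra R G)} {C : Submodule R (SymmetricAlgebra R F)}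
    {x : P ⊗[R] (ExteriorAlgebra R G ⊗[R] SymmetricAlgebra R F)}
    (hx : x ∈ tensorPiece (homPiece e 0) B C) : lowEnd F e v x = 0 := by
  rw [lowEnd, LinearMap.sum_apply]
  refine Finset.sum_eq_zero fun j _ => ?_
  rw [slot₁_mul_slot₂]
  exact map₃_eq_zero (Or.inl fun x hx => lower_eq_zero e j hx) x hx

theorem raiseEnd_mem (e : Module.Basis (Fin l →₀ ℕ) R P) (v : Fin l → G) {a : ℕ} {k : ℤ}
    {C : Submodule R (SymmetricAlgebra R F)}
    {x : P ⊗[R] (ExteriorAlgebra R G ⊗[R] SymmetricAlgebra R F)}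
    (hx : x ∈ tensorPiece (homPiece e a) (extZ R G k) C) :
    raiseEnd F e v x ∈ tensorPiece (homPiece e (a + 1)) (extZ R G (k + 1)) C := by
  rw [raiseEnd, LinearMap.sum_apply]
  refine sum_mem fun j _ => ?_
  rw [slot₁_mul_slot₂]
  exact map₃_mem (fun x hx => raise_mem e j hx) (fun y hy => ι_mul_mem_extZ (v j) hy)
    (fun _ h => h) x hx

theorem ιMulti_mul_mem_extZ (v : Fin l → G) {k : ℤ} {y : ExteriorAlgebra R G}
    (hy : y ∈ extZ R G k) : ExteriorAlgebra.ιMulti R l v * y ∈ extZ R G (k + l) := by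
  rw [ExteriorAlgebra.ιMulti_apply]
  induction l with
  | zero => simpa using hy
  | succ l ih =>
    rw [List.ofFn_succ, List.prod_cons, mul_assoc]
    have := ι_mul_mem_extZ (v 0) (ih (fun i => v i.succ))
    rwa [add_assoc] at this

theorem volEnd_mem (v : Fin l → G) {A : Submodule R P} {k : ℤ}
    {C : Submodule R (SymmetricAlgebra R F)}
    {x : P ⊗[R] (ExteriorAlgebra R G ⊗[R] SymmetricAlgebra R F)}
    (hx : x ∈ tensorPiece A (extZ R G k) C) :
    volEnd P F v x ∈ tensorPiece A (extZ R G (k + l)) C := by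
  rw [volEnd_eq]
  exact map₃_mem (fun _ h => h) (fun y hy => ιMulti_mul_mem_extZ v hy) (fun _ h => h) x hx

theorem colEnd_mem (bF : Module.Basis (Fin m) R F) (ψ : G →ₗ[R] F) {A : Submodule R P} {k : ℤ}
    {q : ℕ} {x : P ⊗[R] (ExteriorAlgebra R G ⊗[R] SymmetricAlgebra R F)}
    (hx : x ∈ tensorPiece A (extZ R G k) (symPow R F q)) :
    colEnd P bF ψ x ∈ tensorPiece A (extZ R G (k - 1)) (symPow R F (q + 1)) := by
  rw [colEnd, LinearMap.sum_apply]
  refine sum_mem fun j _ => ?_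
  rw [slot₃_mul_slot₂, ← mulLeft_ι_eq_raise]
  exact map₃_mem (fun _ h => h) (fun y hy => contractLeft_mem_extZ _ hy)
    (fun z hz => ι_mul_mem_symPow (bF j) hz) x hx

end Pieces

section Zero

variable {R H G F : Type*} [CommRing R] [AddCommGroup H] [Module R H] [AddCommGroup G] [Module R G]
  [AddCommGroup F] [Module R F] {l : ℕ}

theorem algebraMap_mem_symPow_zero {M : Type*} [AddCommGroup M] [Module R M] (c : R) :
    algebraMap R (SymmetricAlgebra R M) c ∈ symPow R M 0 := by
  rw [symPow, pow_zero]; exact Submodule.algebraMap_mem c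

theorem mem_symPow_zero {M : Type*} [AddCommGroup M] [Module R M] {x : SymmetricAlgebra R M} :
    x ∈ symPow R M 0 ↔ ∃ c, algebraMap R (SymmetricAlgebra R M) c = x := by
  rw [symPow, pow_zero]; exact Submodule.mem_one

theorem mem_divPow_zero (bH : Module.Basis (Fin l) R H) {x : DividedPowerAlgebra R H} :
    x ∈ divPow R H 0 ↔ ∃ c, algebraMap R (DividedPowerAlgebra R H) c = x := by
  rw [divPow_eq_homPiece bH, homPiece_zero, dpBasis_apply, dpMonomial_zero,
    ← Submodule.one_eq_span, Submodule.mem_one]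

theorem dpAug_eq_zero (bH : Module.Basis (Fin l) R H) {a : ℕ} {x : DividedPowerAlgebra R H}
    (hx : x ∈ divPow R H (a + 1)) : dpAug R H x = 0 := by
  rw [divPow_eq_homPiece bH] at hx
  have : homPiece (dpBasis bH) (a + 1) ≤ LinearMap.ker (dpAug R H).toLinearMap := by
    refine homPiece_induction _ fun α hα => ?_
    rw [LinearMap.mem_ker, AlgHom.toLinearMap_apply, dpBasis_apply, dpAug_dpMonomial, if_neg]
    rintro rfl
    simp at hα
  exact this hx

variable {B : Submodule R (ExteriorAlgebra R G)} {C : Submodule R (SymmetricAlgebra R F)}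

theorem westToEast_mem {A : Submodule R (DividedPowerAlgebra R H)} {u : WestTotal R H G F}
    (hu : u ∈ tensorPiece A B C) : westToEast R H G F u ∈ tensorPiece (symPow R _ 0) B C :=
  map₃_mem (fun _ _ => algebraMap_mem_symPow_zero _) (fun _ h => h) (fun _ h => h) u hu

theorem westToEast_eq_zero (bH : Module.Basis (Fin l) R H) {a : ℕ} {u : WestTotal R H G F}
    (hu : u ∈ tensorPiece (divPow R H (a + 1)) B C) : westToEast R H G F u = 0 :=
  map₃_eq_zero (Or.inl fun x hx => by
    rw [LinearMap.comp_apply, AlgHom.toLinearMap_apply, dpAug_eq_zero bH hx, map_zero]) u hu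

theorem eastToWest_mem (bH : Module.Basis (Fin l) R H)
    {A : Submodule R (SymmetricAlgebra R (Module.Dual R H))} {u : EastTotal R H G F}
    (hu : u ∈ tensorPiece A B C) : eastToWest R H G F u ∈ tensorPiece (divPow R H 0) B C :=
  map₃_mem (fun _ _ => (mem_divPow_zero bH).2 ⟨_, rfl⟩) (fun _ h => h) (fun _ h => h) u hu

theorem westToEast_eastToWest {u : EastTotal R H G F}
    (hu : u ∈ tensorPiece (symPow R _ 0) B C) : westToEast R H G F (eastToWest R H G F u) = u := by
  rw [westToEast, eastToWest, ← LinearMap.comp_apply, map₃, map₃, ← TensorProduct.map_comp,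
    ← TensorProduct.map_comp]
  refine (map₃_congr (f' := LinearMap.id) (g' := LinearMap.id) (h' := LinearMap.id)
    (fun x hx => ?_) (fun _ _ => rfl) (fun _ _ => rfl) u hu).trans ?_
  · obtain ⟨c, rfl⟩ := mem_symPow_zero.1 hx
    simp
  · rw [map₃, TensorProduct.map_id, TensorProduct.map_id, LinearMap.id_apply]

theorem eastToWest_westToEast (bH : Module.Basis (Fin l) R H) {u : WestTotal R H G F}
    (hu : u ∈ tensorPiece (divPow R H 0) B C) :
    eastToWest R H G F (westToEast R H G F u) = u := by
  rw [westToEast, eastToWest, ← LinearMap.comp_apply, map₃, map₃, ← TensorProduct.map_comp,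
    ← TensorProduct.map_comp]
  refine (map₃_congr (f' := LinearMap.id) (g' := LinearMap.id) (h' := LinearMap.id)
    (fun x hx => ?_) (fun _ _ => rfl) (fun _ _ => rfl) u hu).trans ?_
  · obtain ⟨c, rfl⟩ := (mem_divPow_zero bH).1 hx
    simp
  · rw [map₃, TensorProduct.map_id, TensorProduct.map_id, LinearMap.id_apply]

end Zero

/-! ### The cells -/

section Cells

variable {R H G F : Type*} [CommRing R] [AddCommGroup H] [Module R H] [AddCommGroup G] [Module R G]
  [AddCommGroup F] [Module R F] {l m t : ℕ}

theorem cell_west {p : ℕ} (q : ℕ) (h : p ≤ t) : cell R H G F l t p q =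
    (tensorPiece (divPow R H (t - p)) (extZ R G (p - q)) (symPow R F q)).map (inWest R H G F) := by
  rw [cell, if_pos h]
  split_ifs with h'
  · rw [← Nat.cast_sub h', extZ_natCast]
  · rw [extZ_of_neg R G (by omega), tensorPiece_eq_bot, Submodule.map_bot]

theorem cell_east {p : ℕ} (q : ℕ) (h : t < p) : cell R H G F l t p q =
    (tensorPiece (symPow R (Module.Dual R H) (p - t - 1)) (extZ R G (p + l - 1 - q))
      (symPow R F q)).map (inEast R H G F) := by
  rw [cell, if_neg (by omega)]
  split_ifs with h'
  · rw [show (p : ℤ) + l - 1 - q = (p + l - 1 - q : ℕ) by omega, extZ_natCast]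
  · rw [extZ_of_neg R G (by omega), tensorPiece_eq_bot, Submodule.map_bot]

theorem mem_cell_west {p q : ℕ} (h : p ≤ t) {x : Total R H G F} : x ∈ cell R H G F l t p q ↔
    ∃ u ∈ tensorPiece (divPow R H (t - p)) (extZ R G (p - q)) (symPow R F q),
      inWest R H G F u = x := by
  rw [cell_west q h, Submodule.mem_map]

theorem mem_cell_east {p q : ℕ} (h : t < p) {x : Total R H G F} : x ∈ cell R H G F l t p q ↔
    ∃ u ∈ tensorPiece (symPow R (Module.Dual R H) (p - t - 1)) (extZ R G (p + l - 1 - q))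
      (symPow R F q), inEast R H G F u = x := by
  rw [cell_east q h, Submodule.mem_map]

theorem cell_flat {n : ℕ} (bH : Module.Basis (Fin l) R H) (bG : Module.Basis (Fin n) R G)
    (bF : Module.Basis (Fin m) R F) (p q : ℕ) : Module.Flat R (cell R H G F l t p q) := by
  have := Module.Free.of_basis (dpBasis bH)
  have := Module.Free.of_basis bG.ExteriorAlgebra
  have := Module.Free.of_basis bF.symmetricAlgebra
  have := Module.Free.of_basis bH.dualBasis.symmetricAlgebra
  have hF : IsRetract (symPow R F q) := by
    rw [symPow_eq_homPiece bF]; exact isRetract_homPiece _ _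
  rcases le_or_gt p t with h | h
  · rw [cell_west q h]
    have := tensorPiece_flat (A := divPow R H (t - p))
      (by rw [divPow_eq_homPiece bH]; exact isRetract_homPiece _ _)
      (isRetract_extZ (R := R) (G := G) (p - q)) hF
    exact Module.Flat.of_linearEquiv (Submodule.equivMapOfInjective _ inWest_injective _).symm
  · rw [cell_east q h]
    have := tensorPiece_flat (A := symPow R (Module.Dual R H) (p - t - 1))
      (by rw [symPow_eq_homPiece bH.dualBasis]; exact isRetract_homPiece _ _)
      (isRetract_extZ (R := R) (G := G) (p + l - 1 - q)) hF
    exact Module.Flat.of_linearEquiv (Submodule.equivMapOfInjective _ inEast_injective _).symm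

theorem colMap_mem_cell (bF : Module.Basis (Fin m) R F) (ψ : G →ₗ[R] F) {p q : ℕ}
    {x : Total R H G F} (hx : x ∈ cell R H G F l t p q) :
    colMap H bF ψ x ∈ cell R H G F l t p (q + 1) := by
  rcases le_or_gt p t with h | h
  · obtain ⟨u, hu, rfl⟩ := (mem_cell_west h).1 hx
    refine (mem_cell_west h).2 ⟨_, ?_, (colMap_inWest bF ψ u).symm⟩
    rw [show (p : ℤ) - (q + 1 : ℕ) = p - q - 1 by push_cast; ring]
    exact colEnd_mem bF ψ hu
  · obtain ⟨u, hu, rfl⟩ := (mem_cell_east h).1 hx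
    refine (mem_cell_east h).2 ⟨_, ?_, (colMap_inEast bF ψ u).symm⟩
    rw [show (p : ℤ) + l - 1 - (q + 1 : ℕ) = p + l - 1 - q - 1 by push_cast; ring]
    exact colEnd_mem bF ψ hu

variable (bH : Module.Basis (Fin l) R H) (φ : H →ₗ[R] G)
  {B : Submodule R (ExteriorAlgebra R G)} {C : Submodule R (SymmetricAlgebra R F)} {k : ℤ}

theorem dPhiWest_mem {a : ℕ} {u : WestTotal R H G F}
    (hu : u ∈ tensorPiece (divPow R H (a + 1)) (extZ R G k) C) :
    dPhiWest F bH φ u ∈ tensorPiece (divPow R H a) (extZ R G (k + 1)) C := by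
  rw [divPow_eq_homPiece bH] at hu ⊢
  rw [dPhiWest_eq]
  exact lowEnd_mem _ _ hu

theorem dPhiWest_eq_zero {u : WestTotal R H G F}
    (hu : u ∈ tensorPiece (divPow R H 0) B C) : dPhiWest F bH φ u = 0 := by
  rw [divPow_eq_homPiece bH] at hu
  rw [dPhiWest_eq]
  exact lowEnd_eq_zero _ _ hu

theorem nuPhi_eq_zero {a : ℕ} {u : WestTotal R H G F}
    (hu : u ∈ tensorPiece (divPow R H (a + 1)) B C) : nuPhi F bH φ u = 0 := by
  rw [nuPhi_eq, LinearMap.comp_apply, westToEast_eq_zero bH hu, map_zero]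

theorem nuPhi_mem {A : Submodule R (DividedPowerAlgebra R H)} {u : WestTotal R H G F}
    (hu : u ∈ tensorPiece A (extZ R G k) C) :
    nuPhi F bH φ u ∈ tensorPiece (symPow R _ 0) (extZ R G (k + l)) C := by
  rw [nuPhi_eq, LinearMap.comp_apply]
  exact volEnd_mem _ (westToEast_mem hu)

theorem dPhiEast_mem {a : ℕ} {u : EastTotal R H G F}
    (hu : u ∈ tensorPiece (symPow R _ a) (extZ R G k) C) :
    dPhiEast F bH φ u ∈ tensorPiece (symPow R _ (a + 1)) (extZ R G (k + 1)) C := by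
  rw [symPow_eq_homPiece bH.dualBasis] at hu ⊢
  rw [dPhiEast_eq]
  exact raiseEnd_mem _ _ hu

theorem rowMap_mem_cell {p q : ℕ} {x : Total R H G F} (hx : x ∈ cell R H G F l t p q) :
    rowMap bH φ q x ∈ cell R H G F l t (p + 1) q := by
  rcases lt_trichotomy p t with h | h | h
  · obtain ⟨u, hu, rfl⟩ := (mem_cell_west h.le).1 hx
    obtain ⟨a, ha⟩ : ∃ a, t - p = a + 1 := ⟨t - p - 1, by omega⟩
    rw [ha] at hu
    rw [rowMap_inWest, nuPhi_eq_zero bH φ hu, map_zero, smul_zero, add_zero]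
    refine (mem_cell_west h).2 ⟨_, ?_, rfl⟩
    rw [show t - (p + 1) = a by omega, show ((p + 1 : ℕ) : ℤ) - q = p - q + 1 by push_cast; ring]
    exact dPhiWest_mem bH φ hu
  · subst h
    obtain ⟨u, hu, rfl⟩ := (mem_cell_west le_rfl).1 hx
    rw [Nat.sub_self] at hu
    rw [rowMap_inWest, dPhiWest_eq_zero bH φ hu, map_zero, zero_add]
    refine Submodule.smul_mem _ _ ((mem_cell_east (Nat.lt_succ_self p)).2 ⟨_, ?_, rfl⟩)
    rw [show p + 1 - p - 1 = 0 by omega,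
      show ((p + 1 : ℕ) : ℤ) + l - 1 - q = p - q + l by push_cast; ring]
    exact nuPhi_mem bH φ hu
  · obtain ⟨u, hu, rfl⟩ := (mem_cell_east h).1 hx
    rw [rowMap_inEast]
    refine (mem_cell_east (h.trans (Nat.lt_succ_self p))).2 ⟨_, ?_, rfl⟩
    rw [show p + 1 - t - 1 = p - t - 1 + 1 by omega,
      show ((p + 1 : ℕ) : ℤ) + l - 1 - q = p + l - 1 - q + 1 by push_cast; ring]
    exact dPhiEast_mem bH φ hu

/-! ### Exactness of the rows -/

/-- For d > 0 the condition on ν is automatic. At d = 0, where `dPhiWest` vanishes, it says that the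
product of the φ(hⱼ) annihilates u, after the identification of D₀(H) with S₀(H*) has been undone.
-/
theorem dPhiWest_local_exact {a : Fin l → Module.Dual R G} {δ : R}
    (h : ∀ i j, a j (φ (bH i)) = if i = j then δ else 0) {d : ℕ} {u : WestTotal R H G F}
    (hu : u ∈ tensorPiece (divPow R H d) (extZ R G k) C) (h1 : dPhiWest F bH φ u = 0)
    (h2 : nuPhi F bH φ u = 0) :
    ∃ y ∈ tensorPiece (divPow R H (d + 1)) (extZ R G (k - 1)) C,
      dPhiWest F bH φ y = δ ^ l • u := by
  have hK := isGradedKoszulSystem_row (dpBasis bH) h C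
  cases d with
  | zero =>
    have h3 : volEnd _ F (fun j => φ (bH j)) u = 0 := by
      rw [nuPhi_eq', LinearMap.comp_apply] at h2
      rw [← eastToWest_westToEast bH (volEnd_mem _ hu), h2, map_zero]
    rw [divPow_eq_homPiece bH] at hu ⊢
    rw [dPhiWest_eq]
    exact hK.west_exact_zero hu h3
  | succ d =>
    rw [divPow_eq_homPiece bH] at hu ⊢
    rw [dPhiWest_eq] at h1 ⊢
    exact hK.west_exact_succ hu h1

/-- Each row is a lowering complex spliced by ±ν to a raising complex. The cases are p ≤ t, p = t +
1 with preimage under ν, and p > t + 1. -/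
theorem row_local_exact {a : Fin l → Module.Dual R G} {δ : R}
    (h : ∀ i j, a j (φ (bH i)) = if i = j then δ else 0) {p q : ℕ} {x : Total R H G F}
    (hx : x ∈ cell R H G F l t p q) (hd : rowMap bH φ q x = 0) :
    δ ^ l • x ∈ bdry (fun p => cell R H G F l t p q) (fun _ => rowMap bH φ q) p := by
  have hs : (-1 : R) ^ ((l + 1) * q) * (-1 : R) ^ ((l + 1) * q) = 1 := by
    rw [← mul_pow]; simp
  rcases le_or_gt p t with hp | hp
  · obtain ⟨u, hu, rfl⟩ := (mem_cell_west hp).1 hx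
    rw [rowMap_inWest, ← map_smul] at hd
    obtain ⟨h1, h2⟩ := inWest_add_inEast_eq_zero hd
    have h2' : nuPhi F bH φ u = 0 := by
      have := congrArg (fun z => (-1 : R) ^ ((l + 1) * q) • z) h2
      simpa only [smul_smul, hs, one_smul, smul_zero] using this
    obtain ⟨y, hy, e⟩ := dPhiWest_local_exact bH φ h hu h1 h2'
    cases p with
    | zero =>
      -- The preimage would have exterior exponent -q - 1, so it is 0 and δ^l x = 0 at the beginning
      -- of the row.
      rw [extZ_of_neg R G (by omega), tensorPiece_eq_bot, Submodule.mem_bot] at hy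
      rw [← map_smul, ← e, hy, map_zero, map_zero]
      exact zero_mem _
    | succ p =>
      refine ⟨inWest R H G F y, (mem_cell_west (by omega)).2 ⟨y, ?_, rfl⟩, ?_⟩
      · rwa [show t - (p + 1) + 1 = t - p by omega,
          show ((p + 1 : ℕ) : ℤ) - q - 1 = p - q by push_cast; ring] at hy
      · rw [rowMap_inWest, e, nuPhi_eq_zero bH φ hy, map_zero, smul_zero, add_zero, map_smul]
  · obtain ⟨p, rfl⟩ : ∃ p', p = p' + 1 := ⟨p - 1, by omega⟩
    obtain ⟨u, hu, rfl⟩ := (mem_cell_east hp).1 hx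
    rw [rowMap_inEast] at hd
    have hd : dPhiEast F bH φ u = 0 := inEast_injective (hd.trans (map_zero _).symm)
    have hK := isGradedKoszulSystem_row bH.dualBasis.symmetricAlgebra h (symPow R F q)
    rw [dPhiEast_eq] at hd
    rcases Nat.lt_or_ge t p with hp' | hp'
    · rw [show p + 1 - t - 1 = p - t - 1 + 1 by omega, symPow_eq_homPiece bH.dualBasis] at hu
      obtain ⟨y, hy, e⟩ := hK.east_exact_succ hu hd
      refine ⟨inEast R H G F y, (mem_cell_east hp').2 ⟨y, ?_, rfl⟩, ?_⟩
      · rwa [show ((p + 1 : ℕ) : ℤ) + l - 1 - q - 1 = p + l - 1 - q by push_cast; ring,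
          ← symPow_eq_homPiece bH.dualBasis] at hy
      · rw [rowMap_inEast, dPhiEast_eq, ← map_smul]
        exact congrArg _ e
    · obtain rfl : p = t := by omega
      rw [show p + 1 - p - 1 = 0 by omega, symPow_eq_homPiece bH.dualBasis] at hu
      obtain ⟨z, hz, e⟩ := hK.east_exact_zero hu hd
      rw [← symPow_eq_homPiece bH.dualBasis] at hz
      have hz' := eastToWest_mem bH hz
      refine ⟨(-1 : R) ^ ((l + 1) * q) • inWest R H G F (eastToWest R H G F z),
        Submodule.smul_mem _ _ ((mem_cell_west le_rfl).2 ⟨_, ?_, rfl⟩), ?_⟩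
      · rwa [Nat.sub_self, show (p : ℤ) - q = ((p + 1 : ℕ) : ℤ) + l - 1 - q - l by push_cast; ring]
      · rw [map_smul, rowMap_inWest, dPhiWest_eq_zero bH φ hz', map_zero, zero_add, smul_smul, hs,
          one_smul, nuPhi_eq, LinearMap.comp_apply, westToEast_eastToWest hz, ← map_smul]
        exact congrArg _ e

variable {n : ℕ} (bG : Module.Basis (Fin n) R G)

theorem row_torsion {y : R} (hy : y ∈ minorIdeal (LinearMap.toMatrix bH bG φ) l) (p q : ℕ) :
    ∃ N : ℕ, ∀ x ∈ {x | x ∈ cell R H G F l t p q ∧ rowMap bH φ q x = 0},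
      y ^ N • x ∈ bdry (fun p => cell R H G F l t p q) (fun _ => rowMap bH φ q) p := by
  rw [minorIdeal] at hy
  refine exists_pow_smul_mem_of_mem_span ?_ (Ideal.le_radical hy)
  rintro _ ⟨e, f, rfl⟩
  obtain ⟨a, ha⟩ := exists_forms_of_minor bG bH φ e f
  exact ⟨l, fun x hx => row_local_exact bH φ ha hx.1 hx.2⟩

theorem row_exact (bF : Module.Basis (Fin m) R F) {p q : ℕ}
    (hp : (p : ℕ∞) < idealGrade (minorIdeal (LinearMap.toMatrix bH bG φ) l)) :
    ∀ x ∈ cell R H G F l t p q, rowMap bH φ q x = 0 →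
      x ∈ bdry (fun p => cell R H G F l t p q) (fun _ => rowMap bH φ q) p := by
  refine exact_of_lt_idealGrade (K := fun p => cell R H G F l t p q)
    (d := fun _ => rowMap bH φ q) (fun p x hx => rowMap_mem_cell bH φ hx)
    (fun p x _ => rowMap_rowMap bH φ q x) (fun p => cell_flat bH bG bF p q) (fun y hy p => ?_) hp
  obtain ⟨N, hN⟩ := row_torsion (F := F) (t := t) bH φ bG hy p q
  exact ⟨N, fun x hx hd => hN x ⟨hx, hd⟩⟩

end Cells

end KoszulBicomplex

end

/-! ### Spliced Koszul complexes and exactness of the columns -/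

noncomputable section

namespace KoszulBicomplex

open scoped TensorProduct

/-! ### The complexes spliced from the two complexes of a Koszul system -/

namespace IsGradedKoszulSystem

variable {R T : Type*} [CommRing R] [AddCommGroup T] [Module R T] {l : ℕ} {δ : R}
  {A B θ ι : Fin l → Module.End R T} {W : ℕ → ℤ → Submodule R T}

/-- The modules of the spliced complex: the degree in the first variable decreases from `t` to `0`
and then increases. -/
def spliceCell (l : ℕ) (W : ℕ → ℤ → Submodule R T) (t : ℕ) (k : ℤ) (i : ℕ) : Submodule R T :=
  if i ≤ t then W (t - i) (k + i) else W (i - t - 1) (k + i + l - 1)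

/-- The maps of the spliced complex. -/
def spliceMap (A B θ : Fin l → Module.End R T) (t : ℕ) (i : ℕ) : Module.End R T :=
  if i < t then ∑ j, A j * θ j else if i = t then ((List.finRange l).map θ).prod else ∑ j, B j * θ j

variable (h : IsGradedKoszulSystem δ A B θ ι W)

include h

theorem sum_lower_mem {a : ℕ} {k : ℤ} {x : T} (hx : x ∈ W (a + 1) k) :
    (∑ j, A j * θ j) x ∈ W a (k + 1) := by
  rw [LinearMap.sum_apply]
  exact sum_mem fun j _ => h.lower_mem j _ _ _ (h.theta_mem j _ _ _ hx)

theorem sum_raise_mem {a : ℕ} {k : ℤ} {x : T} (hx : x ∈ W a k) :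
    (∑ j, B j * θ j) x ∈ W (a + 1) (k + 1) := by
  rw [LinearMap.sum_apply]
  exact sum_mem fun j _ => h.raise_mem j _ _ _ (h.theta_mem j _ _ _ hx)

theorem list_prod_theta_mem {a : ℕ} {k : ℤ} {x : T} (hx : x ∈ W a k) (L : List (Fin l)) :
    (L.map θ).prod x ∈ W a (k + L.length) := by
  induction L with
  | nil => simpa using hx
  | cons j L ih =>
    rw [List.map_cons, List.prod_cons, Module.End.mul_apply, List.length_cons, Nat.cast_add_one,
      ← add_assoc]
    exact h.theta_mem j _ _ _ ih

theorem sum_lower_mul_self : (∑ j, A j * θ j) * (∑ j, A j * θ j) = 0 :=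
  sum_mul_self_eq_zero h.lower_comm h.lower_theta h.theta_sq h.theta_anti

theorem sum_raise_mul_self : (∑ j, B j * θ j) * (∑ j, B j * θ j) = 0 :=
  sum_mul_self_eq_zero h.raise_comm h.raise_theta h.theta_sq h.theta_anti

theorem prod_theta_mul_sum_lower :
    ((List.finRange l).map θ).prod * (∑ j, A j * θ j) = 0 := by
  rw [Finset.mul_sum]
  refine Finset.sum_eq_zero fun j _ => ?_
  rw [(h.lower_theta j j).eq, ← mul_assoc,
    list_prod_mul_eq_zero h.theta_sq h.theta_anti (List.mem_finRange j), zero_mul]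

theorem sum_raise_mul_prod_theta :
    (∑ j, B j * θ j) * ((List.finRange l).map θ).prod = 0 := by
  rw [Finset.sum_mul]
  refine Finset.sum_eq_zero fun j _ => ?_
  rw [mul_assoc, mul_list_prod_eq_zero h.theta_sq h.theta_anti (List.mem_finRange j), mul_zero]

theorem spliceMap_mem {t : ℕ} {k : ℤ} {i : ℕ} {x : T} (hx : x ∈ spliceCell l W t k i) :
    spliceMap A B θ t i x ∈ spliceCell l W t k (i + 1) := by
  unfold spliceCell spliceMap at *
  rcases lt_trichotomy i t with hi | rfl | hi
  · rw [if_pos hi.le, show t - i = t - (i + 1) + 1 by omega] at hx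
    rw [if_pos hi, if_pos (by omega), Nat.cast_add_one, ← add_assoc]
    exact h.sum_lower_mem hx
  · rw [if_pos le_rfl, Nat.sub_self] at hx
    rw [if_neg (lt_irrefl i), if_pos rfl, if_neg (by omega), show i + 1 - i - 1 = 0 by omega,
      show k + (i + 1 : ℕ) + l - 1 = k + i + (List.finRange l).length by
        rw [List.length_finRange]; push_cast; ring]
    exact h.list_prod_theta_mem hx _
  · rw [if_neg (by omega)] at hx
    rw [if_neg (by omega), if_neg (by omega), if_neg (by omega),
      show i + 1 - t - 1 = i - t - 1 + 1 by omega,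
      show k + (i + 1 : ℕ) + l - 1 = k + i + l - 1 + 1 by push_cast; ring]
    exact h.sum_raise_mem hx

theorem spliceMap_spliceMap (t i : ℕ) (x : T) :
    spliceMap A B θ t (i + 1) (spliceMap A B θ t i x) = 0 := by
  rw [← Module.End.mul_apply]
  unfold spliceMap
  rcases lt_trichotomy (i + 1) t with hi | rfl | hi
  · rw [if_pos hi, if_pos (by omega), h.sum_lower_mul_self, LinearMap.zero_apply]
  · rw [if_neg (by omega), if_pos rfl, if_pos (by omega), h.prod_theta_mul_sum_lower,
      LinearMap.zero_apply]
  · rw [if_neg (by omega), if_neg (by omega), if_neg (by omega)]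
    split_ifs
    · rw [h.sum_raise_mul_prod_theta, LinearMap.zero_apply]
    · rw [h.sum_raise_mul_self, LinearMap.zero_apply]

/-- The local exactness statements fit together along the splice: the degree 0 cycles on the raising
side come from the splicing map, and those on the lowering side lie in its kernel. The hypothesis
`hk` makes the preimage of a cycle at position 0 vanish. -/
theorem splice_local_exact {t : ℕ} {k : ℤ} (hk : ∀ d, W d (k - 1) = ⊥) {i : ℕ} {x : T}
    (hx : x ∈ spliceCell l W t k i) (hd : spliceMap A B θ t i x = 0) :
    δ ^ l • x ∈ bdry (spliceCell l W t k) (spliceMap A B θ t) i := by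
  unfold spliceCell at hx
  unfold spliceMap at hd
  rcases le_or_gt i t with hi | hi
  · rw [if_pos hi] at hx
    have key : ∃ y ∈ W (t - i + 1) (k + i - 1), (∑ j, A j * θ j) y = δ ^ l • x := by
      rcases hi.lt_or_eq with hi | rfl
      · rw [if_pos hi] at hd
        obtain ⟨a, ha⟩ : ∃ a, t - i = a + 1 := ⟨t - i - 1, by omega⟩
        rw [ha] at hx ⊢
        exact h.west_exact_succ hx hd
      · rw [if_neg (lt_irrefl i), if_pos rfl] at hd
        rw [Nat.sub_self] at hx ⊢
        exact h.west_exact_zero hx hd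
    obtain ⟨y, hy, e⟩ := key
    cases i with
    | zero =>
      rw [Nat.cast_zero, add_zero, hk, Submodule.mem_bot] at hy
      rw [← e, hy, map_zero]
      exact zero_mem _
    | succ i =>
      refine ⟨y, ?_, ?_⟩
      · rw [SetLike.mem_coe, spliceCell, if_pos (by omega)]
        rwa [show t - (i + 1) + 1 = t - i by omega,
          show k + ((i + 1 : ℕ) : ℤ) - 1 = k + i by push_cast; ring] at hy
      · rw [spliceMap, if_pos (by omega), e]
  · obtain ⟨i, rfl⟩ : ∃ i', i = i' + 1 := ⟨i - 1, by omega⟩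
    rw [if_neg (by omega)] at hx
    rw [if_neg (by omega), if_neg (by omega)] at hd
    rcases Nat.lt_or_ge t i with hi' | hi'
    · rw [show i + 1 - t - 1 = i - t - 1 + 1 by omega] at hx
      obtain ⟨y, hy, e⟩ := h.east_exact_succ hx hd
      refine ⟨y, ?_, ?_⟩
      · rw [SetLike.mem_coe, spliceCell, if_neg (by omega)]
        rwa [show k + ((i + 1 : ℕ) : ℤ) + l - 1 - 1 = k + i + l - 1 by push_cast; ring] at hy
      · rw [spliceMap, if_neg (by omega), if_neg (by omega), e]
    · obtain rfl : i = t := by omega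
      rw [show i + 1 - i - 1 = 0 by omega] at hx
      obtain ⟨y, hy, e⟩ := h.east_exact_zero hx hd
      refine ⟨y, ?_, ?_⟩
      · rw [SetLike.mem_coe, spliceCell, if_pos le_rfl, Nat.sub_self]
        rwa [show k + ((i + 1 : ℕ) : ℤ) + l - 1 - l = k + i by push_cast; ring] at hy
      · rw [spliceMap, if_neg (lt_irrefl i), if_pos rfl, e]

/-- The raising complex alone, without prolongation: `hk` says that the source of the splicing map
is 0, so δ^l kills even the kernel at position 0. -/
theorem raise_local_exact {k : ℤ} (hk : W 0 (k - l) = ⊥) {q : ℕ} {x : T}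
    (hx : x ∈ W q (k + q)) (hd : (∑ j, B j * θ j) x = 0) :
    δ ^ l • x ∈ bdry (fun q : ℕ => W q (k + q)) (fun _ => ∑ j, B j * θ j) q := by
  cases q with
  | zero =>
    rw [Nat.cast_zero, add_zero] at hx
    obtain ⟨z, hz, e⟩ := h.east_exact_zero hx hd
    rw [hk, Submodule.mem_bot] at hz
    rw [← e, hz, map_zero]
    exact zero_mem _
  | succ q =>
    obtain ⟨y, hy, e⟩ := h.east_exact_succ hx hd
    refine ⟨y, ?_, e⟩
    rwa [show k + ((q + 1 : ℕ) : ℤ) - 1 = k + q by push_cast; ring] at hy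

end IsGradedKoszulSystem

/-! ### Exactness of the columns -/

section Columns

variable {R G F P : Type*} [CommRing R] [AddCommGroup G] [Module R G] [AddCommGroup F] [Module R F]
  [AddCommGroup P] [Module R P] {m n r : ℕ}

/-- The modules of the column `D ⊗ ⋀^(k-q) G ⊗ S_q(F)`. -/
def colPiece (R G F : Type*) [CommRing R] [AddCommGroup G] [Module R G] [AddCommGroup F]
    [Module R F] {P : Type*} [AddCommGroup P] [Module R P] (D : Submodule R P) (k : ℤ) (q : ℕ) :
    Submodule R (P ⊗[R] (ExteriorAlgebra R G ⊗[R] SymmetricAlgebra R F)) :=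
  tensorPiece D (extZ R G (k - q)) (symPow R F q)

variable (bG : Module.Basis (Fin n) R G) (bF : Module.Basis (Fin m) R F) (ψ : G →ₗ[R] F)

theorem flat_tensorPiece_ext_sym [Module.Flat R P] {D : Submodule R P} (hD : IsRetract D) (k : ℤ)
    (q : ℕ) (bG : Module.Basis (Fin n) R G) (bF : Module.Basis (Fin m) R F) :
    Module.Flat R (tensorPiece D (extZ R G k) (symPow R F q)) := by
  have := Module.Free.of_basis bG.ExteriorAlgebra
  have := Module.Free.of_basis bF.symmetricAlgebra
  exact tensorPiece_flat hD (isRetract_extZ k)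
    (by rw [symPow_eq_homPiece bF]; exact isRetract_homPiece _ _)

theorem exists_pow_smul_mem_of_minors {T : Type*} [AddCommGroup T] [Module R T]
    {Z : Set T} {S : Submodule R T} {I : Ideal R}
    (hI : I ≤ (minorIdeal (LinearMap.toMatrix bG bF ψ) m).radical)
    (h : ∀ (v : Fin m → G) (δ : R), (∀ i j, (bF.coord i ∘ₗ ψ) (v j) = if i = j then δ else 0) →
      ∀ x ∈ Z, δ ^ m • x ∈ S) {y : R} (hy : y ∈ I) : ∃ N : ℕ, ∀ x ∈ Z, y ^ N • x ∈ S := by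
  have hy' := hI hy
  rw [minorIdeal] at hy'
  refine exists_pow_smul_mem_of_mem_span ?_ hy'
  rintro _ ⟨e, f, rfl⟩
  obtain ⟨v, hv⟩ := exists_vectors_of_minor bG bF ψ e f
  exact ⟨m, h v _ hv⟩

/-- For k > n - m the exterior power of exponent k + m is 0, so nothing can precede the column and
positions are counted from q = 0. Any ideal I in the radical of the ideal of minors may provide the
grade, because powers of its elements kill the homology too. -/
theorem colEnd_exact_of_large [Module.Flat R P] {D : Submodule R P} (hD : IsRetract D)
    {I : Ideal R} (hI : I ≤ (minorIdeal (LinearMap.toMatrix bG bF ψ) m).radical) {k : ℤ}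
    (hk : (n : ℤ) < k + m) {q : ℕ} (hq : (q : ℕ∞) < idealGrade I) :
    ∀ x ∈ colPiece R G F D k q, colEnd P bF ψ x = 0 →
      x ∈ bdry (colPiece R G F D k) (fun _ => colEnd P bF ψ) q := by
  have key := exact_of_lt_idealGrade (K := colPiece R G F D k) (d := fun _ => colEnd P bF ψ)
    (I := I) (p := q)
    (fun q x hx => by
      have := colEnd_mem bF ψ hx
      rwa [show k - q - 1 = k - (q + 1 : ℕ) by push_cast; ring] at this)
    (fun q x _ => LinearMap.congr_fun (colEnd_mul_self P bF ψ) x)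
    (fun q => flat_tensorPiece_ext_sym hD _ _ bG bF)
    (fun y hy q => by
      obtain ⟨N, hN⟩ := exists_pow_smul_mem_of_minors bG bF ψ
        (Z := {x | x ∈ colPiece R G F D k q ∧ colEnd P bF ψ x = 0})
        (S := bdry (colPiece R G F D k) (fun _ => colEnd P bF ψ) q) hI
        (fun v δ hv x hx => by
          have e := (isGradedKoszulSystem_col bF hv D).raise_local_exact (k := -k) (q := q) (x := x)
            (by rw [extZ_eq_bot_of_lt bG (by omega), tensorPiece_eq_bot])
            (by rw [neg_add', neg_neg]; exact hx.1) hx.2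
          simp only [neg_add', neg_neg] at e
          exact e) hy
      exact ⟨N, fun x hx hd => hN x ⟨hx, hd⟩⟩) hq
  exact key

/-- For k = n - m - t the column is prolonged to the left by the terms ⋀^{n-i}G ⊗ S_{t-i}(F), 0 ≤ i
≤ t, with lowering differentials. They end in ⋀^{k+m}G, from which contraction by all m forms leads
to ⋀^k G. Position q of the column is position q + t + 1 of the prolonged complex. -/
theorem colEnd_exact_of_small [Module.Flat R P] {D : Submodule R P} (hD : IsRetract D)
    {k : ℤ} {t : ℕ} (hk : (n : ℤ) = k + m + t) {q : ℕ}
    (hq : ((q + 1 + t + 1 : ℕ) : ℕ∞) < idealGrade (minorIdeal (LinearMap.toMatrix bG bF ψ) m)) :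
    ∀ x ∈ colPiece R G F D k (q + 1), colEnd P bF ψ x = 0 →
      x ∈ bdry (colPiece R G F D k) (fun _ => colEnd P bF ψ) (q + 1) := by
  let A : Fin m → Module.End R (P ⊗[R] (ExteriorAlgebra R G ⊗[R] SymmetricAlgebra R F)) :=
    fun j => slot₃ R _ _ _ (lower bF.symmetricAlgebra j)
  let B : Fin m → Module.End R (P ⊗[R] (ExteriorAlgebra R G ⊗[R] SymmetricAlgebra R F)) :=
    fun j => slot₃ R _ _ _ (raise bF.symmetricAlgebra j)
  let θ : Fin m → Module.End R (P ⊗[R] (ExteriorAlgebra R G ⊗[R] SymmetricAlgebra R F)) :=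
    fun j => slot₂ R _ _ _ (contract (bF.coord j ∘ₗ ψ))
  let W : ℕ → ℤ → Submodule R (P ⊗[R] (ExteriorAlgebra R G ⊗[R] SymmetricAlgebra R F)) :=
    fun d k => tensorPiece D (extZ R G (-k)) (symPow R F d)
  have hsys : ∀ (v : Fin m → G) (δ : R),
      (∀ i j, (bF.coord i ∘ₗ ψ) (v j) = if i = j then δ else 0) →
      IsGradedKoszulSystem δ A B θ (fun j => slot₂ R _ _ _ (wedge (v j))) W :=
    fun v δ hv => isGradedKoszulSystem_col bF hv D
  -- The zero vectors with δ = 0 form an admissible system; it supplies the complex property, which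
  -- does not depend on δ.
  have h0 := hsys (fun _ => 0) 0 (by simp)
  have hcell : ∀ q : ℕ, IsGradedKoszulSystem.spliceCell m W t (-n) (q + t + 1) =
      colPiece R G F D k q := fun q => by
    rw [IsGradedKoszulSystem.spliceCell, if_neg (by omega), show q + t + 1 - t - 1 = q by omega]
    change tensorPiece D (extZ R G (-(-(n : ℤ) + (q + t + 1 : ℕ) + m - 1))) (symPow R F q) = _
    rw [show -(-(n : ℤ) + (q + t + 1 : ℕ) + m - 1) = k - q by push_cast; omega]
    rfl
  have hmap : ∀ q : ℕ, IsGradedKoszulSystem.spliceMap A B θ t (q + t + 1) = colEnd P bF ψ :=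
    fun q => by
      rw [IsGradedKoszulSystem.spliceMap, if_neg (by omega), if_neg (by omega)]
      rfl
  have key := exact_of_lt_idealGrade (K := IsGradedKoszulSystem.spliceCell m W t (-n))
    (d := IsGradedKoszulSystem.spliceMap A B θ t) (p := q + 1 + t + 1)
    (fun i x hx => h0.spliceMap_mem hx) (fun i x _ => h0.spliceMap_spliceMap t i x)
    (fun i => by
      rcases le_or_gt i t with h | h
      · rw [IsGradedKoszulSystem.spliceCell, if_pos h]
        exact flat_tensorPiece_ext_sym hD _ _ bG bF
      · rw [IsGradedKoszulSystem.spliceCell, if_neg h.not_ge]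
        exact flat_tensorPiece_ext_sym hD _ _ bG bF)
    (fun y hy i => by
      obtain ⟨N, hN⟩ := exists_pow_smul_mem_of_minors bG bF ψ
        (Z := {x | x ∈ IsGradedKoszulSystem.spliceCell m W t (-n) i ∧
          IsGradedKoszulSystem.spliceMap A B θ t i x = 0})
        (S := bdry (IsGradedKoszulSystem.spliceCell m W t (-n))
          (IsGradedKoszulSystem.spliceMap A B θ t) i) Ideal.le_radical
        -- The prolonged complex starts with ⋀^n G, and the exterior power of exponent n + 1 is 0.
        (fun v δ hv x hx => (hsys v δ hv).splice_local_exact (fun d => by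
          change tensorPiece D (extZ R G (-(-(n : ℤ) - 1))) (symPow R F d) = ⊥
          rw [extZ_eq_bot_of_lt bG (by omega), tensorPiece_eq_bot]) hx.1 hx.2) hy
      exact ⟨N, fun x hx hd => hN x ⟨hx, hd⟩⟩) hq
  intro x hx hd
  obtain ⟨y, hy, e⟩ := key x (by rwa [hcell]) (by rwa [hmap])
  rw [show q + 1 + t = q + t + 1 by omega] at hy e
  rw [SetLike.mem_coe, hcell] at hy
  rw [hmap] at e
  exact ⟨y, hy, e⟩

end Columns

end KoszulBicomplex

end

/-! ### Comparison of the two ideals of minors, and exactness of the columns of the bicomplex -/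

noncomputable section

namespace KoszulBicomplex

open scoped TensorProduct

/-! ### The minors of the two maps -/

section Minors

/-- If the maximal minors of a matrix lie in a prime ideal, then the rows are linearly dependent
modulo this ideal. -/
theorem exists_row_relation_of_minorIdeal_le {R : Type*} [CommRing R] {m n : ℕ}
    {A : Matrix (Fin m) (Fin n) R} {Q : Ideal R} [Q.IsPrime] (h : minorIdeal A m ≤ Q) :
    ∃ c : Fin m → R, (∀ k, ∑ i, c i * A i k ∈ Q) ∧ ∃ i, c i ∉ Q := by
  classical
  let K := FractionRing (R ⧸ Q)
  let π : R →+* K := (algebraMap (R ⧸ Q) K).comp (Ideal.Quotient.mk Q)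
  have hπ : ∀ x, π x = 0 ↔ x ∈ Q := fun x => by
    rw [RingHom.comp_apply, FaithfulSMul.algebraMap_eq_zero_iff, Ideal.Quotient.eq_zero_iff_mem]
  let u : Fin n → Fin m → K := fun k i => π (A i k)
  -- If the columns spanned K^m, then m of them would form a basis and give a maximal minor outside
  -- Q.
  have hne : Submodule.span K (Set.range u) ≠ ⊤ := by
    intro htop
    obtain ⟨f, hf, -, hli⟩ := Submodule.exists_fun_fin_finrank_span_eq K (Set.range u)
    have hm : Module.finrank K (Submodule.span K (Set.range u)) = m := by
      rw [htop, finrank_top, Module.finrank_fin_fun]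
    choose κ hκ using hf
    have hM : IsUnit (Matrix.of fun i : Fin m => f (Fin.cast hm.symm i)) :=
      Matrix.linearIndependent_rows_iff_isUnit.1 (hli.comp _ (Fin.cast_injective hm.symm))
    have e : (Matrix.of fun i : Fin m => f (Fin.cast hm.symm i)) =
        ((A.submatrix id fun i => κ (Fin.cast hm.symm i)).map π).transpose := by
      ext i j
      simp [← hκ, u]
    rw [Matrix.isUnit_iff_isUnit_det, e, Matrix.det_transpose] at hM
    have hdet : ((A.submatrix id fun i => κ (Fin.cast hm.symm i)).map π).det = 0 := by
      rw [← RingHom.mapMatrix_apply, ← RingHom.map_det, hπ]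
      exact h (Ideal.subset_span ⟨_, _, rfl⟩)
    rw [hdet] at hM
    exact hM.ne_zero rfl
  -- A nonzero linear form vanishes on all columns. Clearing its denominators and lifting its
  -- coefficients to R gives the relation.
  obtain ⟨f, hf, hle⟩ := Submodule.exists_le_ker_of_lt_top _ (lt_top_iff_ne_top.2 hne)
  obtain ⟨b, hb⟩ := IsLocalization.exist_integer_multiples_of_finite (nonZeroDivisors (R ⧸ Q))
    fun i => f (Pi.single i 1)
  choose c' hc' using hb
  choose c hc using fun i => Ideal.Quotient.mk_surjective (c' i)
  have hbne : algebraMap (R ⧸ Q) K b ≠ 0 := by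
    rw [Ne, FaithfulSMul.algebraMap_eq_zero_iff]
    exact nonZeroDivisors.ne_zero b.2
  have hcπ : ∀ i, π (c i) = algebraMap (R ⧸ Q) K b * f (Pi.single i 1) := fun i => by
    rw [RingHom.comp_apply, hc, hc', Algebra.smul_def]
  have hfu : ∀ k, ∑ i, π (A i k) * f (Pi.single i 1) = 0 := fun k => by
    have h1 : f (u k) = 0 := hle (Submodule.subset_span ⟨k, rfl⟩)
    rw [← Finset.univ_sum_single (u k), map_sum] at h1
    rw [← h1]
    refine Finset.sum_congr rfl fun i _ => ?_
    rw [← smul_eq_mul, ← map_smul, ← Pi.single_smul, smul_eq_mul, mul_one]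
  refine ⟨c, fun k => ?_, ?_⟩
  · rw [← hπ, map_sum]
    simp_rw [map_mul, hcπ, mul_assoc]
    rw [← Finset.mul_sum]
    simp_rw [mul_comm (f _)]
    rw [hfu, mul_zero]
  · by_contra! hall
    refine hf (LinearMap.pi_ext' fun i => LinearMap.ext_ring ?_)
    have h1 := hcπ i
    rw [(hπ _).2 (hall i)] at h1
    simpa [hbne] using h1.symm

variable {R G F : Type*} [CommRing R] [AddCommGroup G] [Module R G] [AddCommGroup F] [Module R F]
  {m n : ℕ}

/-- The linear form on `⋀G ⊗ S(F)` which extends a linear form on `F`. -/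
def evalForm (G : Type*) [AddCommGroup G] [Module R G] (c : Module.Dual R F) :
    R ⊗[R] (ExteriorAlgebra R G ⊗[R] SymmetricAlgebra R F) →ₗ[R] R :=
  (TensorProduct.lid R R).toLinearMap ∘ₗ TensorProduct.map LinearMap.id
    ((TensorProduct.lid R R).toLinearMap ∘ₗ TensorProduct.map
      (ExteriorAlgebra.algebraMapInv).toLinearMap (SymmetricAlgebra.lift c).toLinearMap)

theorem evalForm_tmul (c : Module.Dual R F) (x : R) (y : ExteriorAlgebra R G)
    (z : SymmetricAlgebra R F) : evalForm G c (x ⊗ₜ (y ⊗ₜ z)) =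
      x * (ExteriorAlgebra.algebraMapInv y * SymmetricAlgebra.lift c z) := rfl

theorem algebraMapInv_contractLeft_mem (bG : Module.Basis (Fin n) R G) {Q : Ideal R}
    {a : Module.Dual R G} (ha : ∀ k, a (bG k) ∈ Q) (y : ExteriorAlgebra R G) :
    ExteriorAlgebra.algebraMapInv (CliffordAlgebra.contractLeft a y) ∈ Q := by
  rw [← bG.sum_dual_apply_smul_coord a, map_sum, LinearMap.sum_apply, map_sum]
  refine sum_mem fun k _ => ?_
  rw [map_smul, LinearMap.smul_apply, map_smul]
  exact Q.mul_mem_right _ (ha k)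

/-- Evaluating S(F) at c turns the column map into contraction by c ∘ ψ, a form with values in Q,
followed by the augmentation of ⋀G. -/
theorem evalForm_colEnd_mem (bG : Module.Basis (Fin n) R G) (bF : Module.Basis (Fin m) R F)
    (ψ : G →ₗ[R] F) {Q : Ideal R} {c : Module.Dual R F} (hc : ∀ k, c (ψ (bG k)) ∈ Q)
    (u : R ⊗[R] (ExteriorAlgebra R G ⊗[R] SymmetricAlgebra R F)) :
    evalForm G c (colEnd R bF ψ u) ∈ Q := by
  induction u with
  | zero => rw [map_zero, map_zero]; exact zero_mem _
  | add u v hu hv => rw [map_add, map_add]; exact add_mem hu hv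
  | tmul x u =>
    induction u with
    | zero => rw [TensorProduct.tmul_zero, map_zero, map_zero]; exact zero_mem _
    | add u v hu hv => rw [TensorProduct.tmul_add, map_add, map_add]; exact add_mem hu hv
    | tmul y z =>
      have h := algebraMapInv_contractLeft_mem bG (a := c ∘ₗ ψ) hc y
      have e : c ∘ₗ ψ = ∑ j, c (bF j) • (bF.coord j ∘ₗ ψ) := by
        ext v
        conv_lhs => rw [LinearMap.comp_apply, ← bF.sum_repr (ψ v)]
        simp [mul_comm, -Module.Basis.sum_repr]
      rw [e, map_sum, LinearMap.sum_apply, map_sum] at h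
      have e' : evalForm G c (colEnd R bF ψ (x ⊗ₜ (y ⊗ₜ z))) =
          x * SymmetricAlgebra.lift c z * ∑ j, ExteriorAlgebra.algebraMapInv
            (CliffordAlgebra.contractLeft (c (bF j) • (bF.coord j ∘ₗ ψ)) y) := by
        rw [← map_id_dPsi, TensorProduct.map_tmul, dPsi, LinearMap.sum_apply,
          TensorProduct.tmul_sum, map_sum, Finset.mul_sum]
        refine Finset.sum_congr rfl fun j _ => ?_
        rw [TensorProduct.map_tmul, LinearMap.id_apply, evalForm_tmul, LinearMap.mulLeft_apply,
          map_mul, SymmetricAlgebra.lift_ι_apply, map_smul, LinearMap.smul_apply, map_smul,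
          smul_eq_mul]
        ring
      rw [e']
      exact Q.mul_mem_left _ h

theorem contract_colEnd (a : Module.Dual R G) (bF : Module.Basis (Fin m) R F) (ψ : G →ₗ[R] F) :
    slot₂ R R _ _ (contract a) * colEnd R bF ψ =
      -(colEnd R bF ψ * slot₂ R R _ _ (contract a)) :=
  mul_sum_anti (fun _ => (slot₃_commute_slot₂ _ _).symm)
    fun j => by rw [← map_mul, contract_anti, map_neg, map_mul]

theorem isRetract_top {X : Type*} [AddCommGroup X] [Module R X] :
    IsRetract (⊤ : Submodule R X) :=
  isRetract_of_end 1 (fun _ => trivial) fun _ _ => rfl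

theorem contractLeft_ι_mul_ι (a : Module.Dual R G) (v w : G) :
    CliffordAlgebra.contractLeft a (ExteriorAlgebra.ι R v * ExteriorAlgebra.ι R w) =
      a v • ExteriorAlgebra.ι R w - a w • ExteriorAlgebra.ι R v := by
  rw [ExteriorAlgebra.ι, CliffordAlgebra.contractLeft_ι_mul, CliffordAlgebra.contractLeft_ι,
    ← Algebra.commutes, ← Algebra.smul_def]

/-- Two vectors in the kernel of `ψ`, on which two linear forms take the values of the identity
matrix up to a factor `δ`, force `δ` into the radical of the ideal of maximal minors of `ψ`. -/
theorem mem_of_minorIdeal_le {r : ℕ} (hr1 : 1 ≤ r) (hn : n = m + r)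
    (bG : Module.Basis (Fin n) R G) (bF : Module.Basis (Fin m) R F) (ψ : G →ₗ[R] F)
    (hr : (r : ℕ∞) ≤ idealGrade (minorIdeal (LinearMap.toMatrix bG bF ψ) m)) {v w : G}
    (hv : ψ v = 0) (hw : ψ w = 0) {a b : Module.Dual R G} {δ : R} (hav : a v = δ) (haw : a w = 0)
    (hbw : b w = δ) {Q : Ideal R} [hQ : Q.IsPrime]
    (hle : minorIdeal (LinearMap.toMatrix bG bF ψ) m ≤ Q) : δ ∈ Q := by
  obtain ⟨c, hc, i, hi⟩ := exists_row_relation_of_minorIdeal_le hle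
  -- Below, `r` stands for the original r minus 1.
  obtain ⟨r, rfl⟩ : ∃ r', r = r' + 1 := ⟨r - 1, by omega⟩
  set s : SymmetricAlgebra R F := SymmetricAlgebra.ι R F (bF i) ^ r with hs_def
  have hs : s ∈ symPow R F r := Submodule.pow_mem_pow _ (LinearMap.mem_range_self _ _) r
  have hvw : ExteriorAlgebra.ι R v * ExteriorAlgebra.ι R w ∈ extZ R G ((r + 2 : ℕ) - r) := by
    have h1 : (1 : ExteriorAlgebra R G) ∈ extZ R G (0 : ℕ) := by
      rw [extZ_natCast, ExteriorAlgebra.exteriorPower, pow_zero]; exact Submodule.one_le.1 le_rfl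
    have := ι_mul_mem_extZ v (ι_mul_mem_extZ w h1)
    rw [mul_one] at this
    convert this using 2
    push_cast; ring
  -- As ψ kills v and w, the element v ∧ w ⊗ fᵢ^r is a cycle. It sits at position r of the column
  -- with k = r + 2 > n - m = r + 1, and r is below the grade.
  have hz := colEnd_exact_of_large bG bF ψ (isRetract_top (X := R)) Ideal.le_radical
    (k := (r + 2 : ℕ)) (q := r) (by omega) (lt_of_lt_of_le (by exact_mod_cast Nat.lt_succ_self r) hr)
    _ (tmul_mem_tensorPiece (Submodule.mem_top (x := (1 : R))) hvw hs) (by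
      rw [← map_id_dPsi, TensorProduct.map_tmul, dPsi, LinearMap.sum_apply, Finset.sum_eq_zero,
        TensorProduct.tmul_zero]
      intro j _
      rw [TensorProduct.map_tmul, contractLeft_ι_mul_ι]
      simp [hv, hw])
  obtain ⟨u, hu⟩ : ∃ u, colEnd R bF ψ u =
      (1 : R) ⊗ₜ ((ExteriorAlgebra.ι R v * ExteriorAlgebra.ι R w) ⊗ₜ s) := by
    -- At position 0 exactness means that the cycle itself is 0.
    cases r with
    | zero => exact ⟨0, by rw [map_zero, (Submodule.mem_bot R).1 hz]⟩
    | succ r =>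
      obtain ⟨u, -, hu⟩ := hz
      exact ⟨u, hu⟩
  -- Each contraction anticommutes with the column map and the two signs cancel. Hence δ² ⊗ fᵢ^r is
  -- again in the image, and its value δ² cᵢ^r lies in Q although cᵢ does not.
  have h1 := congrArg (fun x => slot₂ R R _ _ (contract b) (slot₂ R R _ _ (contract a) x)) hu
  have h2 := LinearMap.congr_fun (contract_colEnd a bF ψ) u
  have h3 := LinearMap.congr_fun (contract_colEnd b bF ψ) (slot₂ R R _ _ (contract a) u)
  rw [LinearMap.neg_apply, Module.End.mul_apply, Module.End.mul_apply] at h2 h3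
  simp only [h2, map_neg, h3, neg_neg] at h1
  have h4 := evalForm_colEnd_mem bG bF ψ (Q := Q) (c := bF.constr R c) (fun k => by
    have := hc k
    rw [← bF.sum_repr (ψ (bG k)), map_sum]
    simpa [LinearMap.toMatrix_apply, mul_comm] using this)
    (slot₂ R R _ _ (contract b) (slot₂ R R _ _ (contract a) u))
  rw [h1] at h4
  have h5 : slot₂ R R (ExteriorAlgebra R G) (SymmetricAlgebra R F) (contract b)
      (slot₂ R R _ _ (contract a) ((1 : R) ⊗ₜ
        ((ExteriorAlgebra.ι R v * ExteriorAlgebra.ι R w) ⊗ₜ s))) =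
      1 ⊗ₜ (algebraMap R _ (δ * δ) ⊗ₜ s) := by
    rw [slot₂_apply, slot₂_apply, map₃, map₃, TensorProduct.map_tmul, TensorProduct.map_tmul,
      TensorProduct.map_tmul, TensorProduct.map_tmul, contractLeft_ι_mul_ι, hav, haw, zero_smul,
      sub_zero, map_smul, ExteriorAlgebra.ι, CliffordAlgebra.contractLeft_ι, hbw, Algebra.smul_def,
      ← map_mul]
    rfl
  rw [h5, evalForm_tmul, hs_def, map_pow, SymmetricAlgebra.lift_ι_apply, bF.constr_basis,
    ExteriorAlgebra.algebraMapInv, AlgHom.commutes, one_mul] at h4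
  rcases hQ.mem_or_mem h4 with h | h
  · exact (hQ.mem_or_mem h).elim id id
  · exact absurd (hQ.mem_of_pow_mem _ h) hi

/-- With l > 1 there are two vectors φ(h₁), φ(h₂) in Ker ψ, on which the forms belonging to a minor
δ of φ take the required values. So δ lies in every prime containing I_ψ. -/
theorem minorIdeal_le_radical {H : Type*} [AddCommGroup H] [Module R H] {l r : ℕ} (hl : 1 < l)
    (hr1 : 1 ≤ r) (hn : n = m + r) (bH : Module.Basis (Fin l) R H)
    (bG : Module.Basis (Fin n) R G) (bF : Module.Basis (Fin m) R F) (φ : H →ₗ[R] G)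
    (ψ : G →ₗ[R] F) (hcomplex : ψ ∘ₗ φ = 0)
    (hr : (r : ℕ∞) ≤ idealGrade (minorIdeal (LinearMap.toMatrix bG bF ψ) m)) :
    minorIdeal (LinearMap.toMatrix bH bG φ) l ≤
      (minorIdeal (LinearMap.toMatrix bG bF ψ) m).radical := by
  rw [minorIdeal, Ideal.span_le]
  rintro _ ⟨e, f, rfl⟩
  obtain ⟨a, ha⟩ := exists_forms_of_minor bG bH φ e f
  rw [SetLike.mem_coe, Ideal.radical_eq_sInf, Submodule.mem_sInf]
  rintro Q ⟨hle, hQ⟩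
  have h01 : (⟨1, hl⟩ : Fin l) ≠ ⟨0, by omega⟩ := by simp
  exact mem_of_minorIdeal_le hr1 hn bG bF ψ hr (v := φ (bH ⟨0, by omega⟩)) (w := φ (bH ⟨1, hl⟩))
    (a := a ⟨0, by omega⟩) (b := a ⟨1, hl⟩)
    (LinearMap.congr_fun hcomplex _) (LinearMap.congr_fun hcomplex _)
    ((ha _ _).trans (if_pos rfl)) ((ha _ _).trans (if_neg h01)) ((ha _ _).trans (if_pos rfl)) hle

end Minors

/-! ### Exactness of the columns of the bicomplex -/

section Cells

variable {R H G F P : Type*} [CommRing R] [AddCommGroup H] [Module R H] [AddCommGroup G]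
  [Module R G] [AddCommGroup F] [Module R F] [AddCommGroup P] [Module R P] {l m n r t : ℕ}

/-- For k ≤ r the prolongation has t = r - k, and the required bound q + 1 + t + 1 < r is the
condition that the exterior exponent k - (q+1) be at least 2. For k > r only the grade of I matters.
-/
theorem colEnd_exact [Module.Flat R P] {D : Submodule R P} (hD : IsRetract D) (hn : n = m + r)
    (bG : Module.Basis (Fin n) R G) (bF : Module.Basis (Fin m) R F) (ψ : G →ₗ[R] F)
    (hr : (r : ℕ∞) ≤ idealGrade (minorIdeal (LinearMap.toMatrix bG bF ψ) m)) {I : Ideal R}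
    (hI : I ≤ (minorIdeal (LinearMap.toMatrix bG bF ψ) m).radical) {k : ℤ} {q : ℕ}
    (hk : (q : ℤ) + 3 ≤ k) (hq : ((q + 1 : ℕ) : ℕ∞) < idealGrade I) :
    ∀ x ∈ colPiece R G F D k (q + 1), colEnd P bF ψ x = 0 →
      ∃ y ∈ colPiece R G F D k q, colEnd P bF ψ y = x := by
  rcases le_or_gt k r with h | h
  · obtain ⟨s, hs⟩ := Int.eq_ofNat_of_zero_le (sub_nonneg.2 h)
    refine colEnd_exact_of_small bG bF ψ hD (t := s) (by rw [hn]; push_cast; omega)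
      (lt_of_lt_of_le ?_ hr)
    have : q + 1 + s + 1 < r := by omega
    exact_mod_cast this
  · exact colEnd_exact_of_large bG bF ψ hD hI (by rw [hn]; push_cast; omega) hq

/-- Both `hwest` and `heast` say that the exterior exponent at C^{p,q+1} is at least 2. -/
theorem column_exact (bH : Module.Basis (Fin l) R H) (hn : n = m + r)
    (bG : Module.Basis (Fin n) R G) (bF : Module.Basis (Fin m) R F) (ψ : G →ₗ[R] F)
    (hr : (r : ℕ∞) ≤ idealGrade (minorIdeal (LinearMap.toMatrix bG bF ψ) m)) {I : Ideal R}
    (hI : I ≤ (minorIdeal (LinearMap.toMatrix bG bF ψ) m).radical) {p q : ℕ}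
    (hwest : p ≤ t → q + 3 ≤ p) (heast : t < p → q + 4 ≤ p + l)
    (hq : ((q + 1 : ℕ) : ℕ∞) < idealGrade I) {x : Total R H G F}
    (hx : x ∈ cell R H G F l t p (q + 1)) (hd : colMap H bF ψ x = 0) :
    ∃ y ∈ cell R H G F l t p q, colMap H bF ψ y = x := by
  rcases le_or_gt p t with h | h
  · have := Module.Free.of_basis (dpBasis bH)
    obtain ⟨u, hu, rfl⟩ := (mem_cell_west h).1 hx
    rw [colMap_inWest] at hd
    obtain ⟨y, hy, e⟩ := colEnd_exact (D := divPow R H (t - p))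
      (by rw [divPow_eq_homPiece bH]; exact isRetract_homPiece _ _) hn bG bF ψ hr hI (k := p) (q := q)
      (by have := hwest h; omega) hq u hu (inWest_injective (hd.trans (map_zero _).symm))
    exact ⟨_, (mem_cell_west h).2 ⟨y, hy, rfl⟩, by rw [colMap_inWest, e]⟩
  · have := Module.Free.of_basis bH.dualBasis.symmetricAlgebra
    obtain ⟨u, hu, rfl⟩ := (mem_cell_east h).1 hx
    rw [colMap_inEast] at hd
    obtain ⟨y, hy, e⟩ := colEnd_exact (D := symPow R (Module.Dual R H) (p - t - 1))
      (by rw [symPow_eq_homPiece bH.dualBasis]; exact isRetract_homPiece _ _) hn bG bF ψ hr hI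
      (k := p + l - 1) (q := q)
      (by have := heast h; omega) hq u hu (inEast_injective (hd.trans (map_zero _).symm))
    exact ⟨_, (mem_cell_east h).2 ⟨y, hy, rfl⟩, by rw [colMap_inEast, e]⟩

end Cells

end KoszulBicomplex

end

/-! ### Symmetric powers of the cokernel and the corner modules -/

noncomputable section

namespace KoszulBicomplex

open scoped TensorProduct

/-! ### The grading of the symmetric algebra -/

section SymGrading

variable {R : Type*} [CommRing R] {M : Type*} [AddCommGroup M] [Module R M]

/-- The homomorphism `S(M) → S(M)[X]` which multiplies the elements of degree `k` by `X ^ k`. -/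
def symGrading (R M : Type*) [CommRing R] [AddCommGroup M] [Module R M] :
    SymmetricAlgebra R M →ₐ[R] Polynomial (SymmetricAlgebra R M) :=
  SymmetricAlgebra.lift
    (LinearMap.mulLeft R Polynomial.X ∘ₗ (Polynomial.CAlgHom (R := R)).toLinearMap ∘ₗ
      SymmetricAlgebra.ι R M)

/-- The component of degree `k` of an element of the symmetric algebra. -/
def symComponent (R M : Type*) [CommRing R] [AddCommGroup M] [Module R M] (k : ℕ) :
    Module.End R (SymmetricAlgebra R M) :=
  (Polynomial.lcoeff (SymmetricAlgebra R M) k).restrictScalars R ∘ₗ (symGrading R M).toLinearMap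

theorem symGrading_ι (x : M) : symGrading R M (SymmetricAlgebra.ι R M x) =
    Polynomial.X * Polynomial.C (SymmetricAlgebra.ι R M x) := by
  rw [symGrading, SymmetricAlgebra.lift_ι_apply]; rfl

theorem symComponent_apply (k : ℕ) (s : SymmetricAlgebra R M) :
    symComponent R M k s = (symGrading R M s).coeff k := rfl

theorem symComponent_succ_ι_mul (k : ℕ) (x : M) (s : SymmetricAlgebra R M) :
    symComponent R M (k + 1) (SymmetricAlgebra.ι R M x * s) =
      SymmetricAlgebra.ι R M x * symComponent R M k s := by
  rw [symComponent_apply, map_mul, symGrading_ι, mul_assoc, Polynomial.coeff_X_mul,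
    Polynomial.coeff_C_mul, symComponent_apply]

theorem symComponent_mem (k : ℕ) (s : SymmetricAlgebra R M) :
    symComponent R M k s ∈ symPow R M k := by
  induction s using SymmetricAlgebra.induction generalizing k with
  | algebraMap c =>
    rw [symComponent_apply, AlgHom.commutes, Polynomial.algebraMap_apply, Polynomial.coeff_C]
    split_ifs with h
    · subst h; exact algebraMap_mem_symPow_zero c
    · exact zero_mem _
  | ι x =>
    rw [symComponent_apply, symGrading_ι, Polynomial.X_mul_C, Polynomial.coeff_C_mul_X]
    split_ifs with h
    · subst h
      rw [symPow, pow_one]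
      exact LinearMap.mem_range_self _ x
    · exact zero_mem _
  | mul a b ha hb =>
    rw [symComponent_apply, map_mul, Polynomial.coeff_mul]
    refine sum_mem fun ij hij => ?_
    rw [← Finset.HasAntidiagonal.mem_antidiagonal.1 hij, symPow, pow_add]
    exact Submodule.mul_mem_mul (ha _) (hb _)
  | add a b ha hb => rw [map_add]; exact add_mem (ha k) (hb k)

theorem symComponent_of_mem {k : ℕ} {s : SymmetricAlgebra R M} (hs : s ∈ symPow R M k) :
    symComponent R M k s = s := by
  induction k generalizing s with
  | zero =>
    obtain ⟨c, rfl⟩ := mem_symPow_zero.1 hs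
    rw [symComponent_apply, AlgHom.commutes, Polynomial.algebraMap_apply, Polynomial.coeff_C_zero]
  | succ k ih =>
    rw [symPow_succ] at hs
    induction hs using Submodule.mul_induction_on' with
    | mem_mul_mem x hx s hs =>
      obtain ⟨x, rfl⟩ := hx
      rw [symComponent_succ_ι_mul, ih hs]
    | add x _ y _ hx hy => rw [map_add, hx, hy]

/-- No freeness is assumed, since this is needed for S_k(C) with C = Coker ψ. -/
theorem isRetract_symPow (k : ℕ) : IsRetract (symPow R M k) :=
  isRetract_of_end (symComponent R M k) (symComponent_mem k) fun _ => symComponent_of_mem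

/-! ### The symmetric powers of a quotient -/

/-- By the universal property, M/N → S(M)/(N) extends to S(M/N); composed with S(M) → S(M/N) it is
the quotient map, which therefore kills s. -/
theorem mem_span_of_symMap_mkQ_eq_zero (N : Submodule R M) {s : SymmetricAlgebra R M}
    (hs : symMap N.mkQ s = 0) : s ∈ Ideal.span (SymmetricAlgebra.ι R M '' N) := by
  let J := Ideal.span (SymmetricAlgebra.ι R M '' (N : Set M))
  let θ : SymmetricAlgebra R (M ⧸ N) →ₐ[R] SymmetricAlgebra R M ⧸ J :=
    SymmetricAlgebra.lift (N.liftQ ((Ideal.Quotient.mkₐ R J).toLinearMap ∘ₗ SymmetricAlgebra.ι R M)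
      fun x hx => by
        rw [LinearMap.mem_ker, LinearMap.comp_apply]
        exact Ideal.Quotient.eq_zero_iff_mem.2 (Ideal.subset_span ⟨x, hx, rfl⟩))
  have hθ : θ.comp (symMap N.mkQ) = Ideal.Quotient.mkₐ R J := by
    refine SymmetricAlgebra.algHom_ext (LinearMap.ext fun x => ?_)
    simp [θ, symMap]
  have := AlgHom.congr_fun hθ s
  rw [AlgHom.comp_apply, hs, map_zero] at this
  exact Ideal.Quotient.eq_zero_iff_mem.1 this.symm

theorem mem_mul_symPow_of_mem_span (N : Submodule R M) {k : ℕ} {s : SymmetricAlgebra R M}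
    (hs : s ∈ symPow R M (k + 1)) (hJ : s ∈ Ideal.span (SymmetricAlgebra.ι R M '' N)) :
    s ∈ N.map (SymmetricAlgebra.ι R M) * symPow R M k := by
  -- Allowing an arbitrary multiplier makes the claim stable under multiplication by ring elements,
  -- as induction over an ideal requires.
  have key : ∀ a : SymmetricAlgebra R M, symComponent R M (k + 1) (a * s) ∈
      N.map (SymmetricAlgebra.ι R M) * symPow R M k := by
    clear hs
    induction hJ using Submodule.span_induction with
    | mem x hx =>
      obtain ⟨x, hx, rfl⟩ := hx
      intro a
      rw [mul_comm a, symComponent_succ_ι_mul]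
      exact Submodule.mul_mem_mul ⟨x, hx, rfl⟩ (symComponent_mem k a)
    | zero => intro a; rw [mul_zero, map_zero]; exact zero_mem _
    | add x y _ _ hx hy => intro a; rw [mul_add, map_add]; exact add_mem (hx a) (hy a)
    | smul b x _ hx => intro a; rw [smul_eq_mul, ← mul_assoc]; exact hx _
  have := key 1
  rwa [one_mul, symComponent_of_mem hs] at this

theorem symPowMap_surjective {M' : Type*} [AddCommGroup M'] [Module R M'] {f : M →ₗ[R] M'}
    (hf : Function.Surjective f) (k : ℕ) : Function.Surjective (symPowMap f k) := by
  have h : symPow R M' k ≤ (symPow R M k).map (symMap f).toLinearMap := by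
    rw [symPow, symPow, Submodule.map_pow]
    refine pow_le_pow_left' ?_ k
    rintro _ ⟨x, rfl⟩
    obtain ⟨x, rfl⟩ := hf x
    exact ⟨_, ⟨x, rfl⟩, by simp [symMap]⟩
  rintro ⟨s, hs⟩
  obtain ⟨s', hs', e⟩ := h hs
  exact ⟨⟨s', hs'⟩, Subtype.ext e⟩

end SymGrading

/-! ### The corner modules -/

section Corner

variable {R G F P : Type*} [CommRing R] [AddCommGroup G] [Module R G] [AddCommGroup F] [Module R F]
  [AddCommGroup P] [Module R P] {m : ℕ}

/-- The inclusion of `D ⊗ S_k(F) = D ⊗ ⋀^0 G ⊗ S_k(F)` into `P ⊗ ⋀G ⊗ S(F)`. -/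
def cornerIncl (G F : Type*) [AddCommGroup G] [Module R G] [AddCommGroup F] [Module R F]
    (D : Submodule R P) (k : ℕ) :
    D ⊗[R] symPow R F k →ₗ[R] P ⊗[R] (ExteriorAlgebra R G ⊗[R] SymmetricAlgebra R F) :=
  TensorProduct.map D.subtype
    (TensorProduct.mk R (ExteriorAlgebra R G) (SymmetricAlgebra R F) 1 ∘ₗ (symPow R F k).subtype)

theorem mem_extZ_zero {y : ExteriorAlgebra R G} :
    y ∈ extZ R G 0 ↔ ∃ c, algebraMap R (ExteriorAlgebra R G) c = y := by
  rw [← Nat.cast_zero, extZ_natCast, ExteriorAlgebra.exteriorPower, pow_zero]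
  exact Submodule.mem_one

theorem range_cornerIncl (D : Submodule R P) (k : ℕ) :
    LinearMap.range (cornerIncl G F D k) = tensorPiece D (extZ R G 0) (symPow R F k) := by
  apply le_antisymm
  · rintro _ ⟨u, rfl⟩
    induction u with
    | zero => rw [map_zero]; exact zero_mem _
    | add u v hu hv => rw [map_add]; exact add_mem hu hv
    | tmul x z =>
      exact tmul_mem_tensorPiece x.2 (mem_extZ_zero.2 ⟨1, map_one _⟩) z.2
  · refine tensorPiece_le fun x hx y hy z hz => ?_
    obtain ⟨c, rfl⟩ := mem_extZ_zero.1 hy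
    refine ⟨⟨x, hx⟩ ⊗ₜ (c • ⟨z, hz⟩), ?_⟩
    simp [cornerIncl, Algebra.algebraMap_eq_smul_one, TensorProduct.smul_tmul]

/-- The projection of `P ⊗ ⋀G ⊗ S(F)` onto `P ⊗ S(C)`, `C = Coker ψ`. -/
def cornerProj (P : Type*) [AddCommGroup P] [Module R P] (ψ : G →ₗ[R] F) :
    P ⊗[R] (ExteriorAlgebra R G ⊗[R] SymmetricAlgebra R F) →ₗ[R]
      P ⊗[R] SymmetricAlgebra R (Coker ψ) :=
  TensorProduct.map LinearMap.id ((TensorProduct.lid R _).toLinearMap ∘ₗ TensorProduct.map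
    (ExteriorAlgebra.algebraMapInv).toLinearMap (symMap (LinearMap.range ψ).mkQ).toLinearMap)

theorem cornerProj_tmul (ψ : G →ₗ[R] F) (x : P) (y : ExteriorAlgebra R G)
    (z : SymmetricAlgebra R F) : cornerProj P ψ (x ⊗ₜ (y ⊗ₜ z)) =
      x ⊗ₜ (ExteriorAlgebra.algebraMapInv y • symMap (LinearMap.range ψ).mkQ z) := rfl

theorem colEnd_tmul_ι_tmul (bF : Module.Basis (Fin m) R F) (ψ : G →ₗ[R] F) (x : P) (v : G)
    (z : SymmetricAlgebra R F) : colEnd P bF ψ (x ⊗ₜ (ExteriorAlgebra.ι R v ⊗ₜ z)) =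
      x ⊗ₜ (1 ⊗ₜ (SymmetricAlgebra.ι R F (ψ v) * z)) := by
  rw [← map_id_dPsi, TensorProduct.map_tmul, LinearMap.id_apply, dPsi, LinearMap.sum_apply]
  congr 1
  conv_rhs => rw [← bF.sum_repr (ψ v), map_sum, Finset.sum_mul, TensorProduct.tmul_sum]
  refine Finset.sum_congr rfl fun j _ => ?_
  rw [TensorProduct.map_tmul, ExteriorAlgebra.ι, CliffordAlgebra.contractLeft_ι,
    Algebra.algebraMap_eq_smul_one, TensorProduct.smul_tmul, map_smul, smul_mul_assoc]
  rfl

theorem cornerProj_colEnd (bF : Module.Basis (Fin m) R F) (ψ : G →ₗ[R] F) {D : Submodule R P}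
    {C : Submodule R (SymmetricAlgebra R F)}
    {u : P ⊗[R] (ExteriorAlgebra R G ⊗[R] SymmetricAlgebra R F)}
    (hu : u ∈ tensorPiece D (extZ R G 1) C) : cornerProj P ψ (colEnd P bF ψ u) = 0 := by
  have h : tensorPiece D (extZ R G 1) C ≤ LinearMap.ker (cornerProj P ψ ∘ₗ colEnd P bF ψ) := by
    refine tensorPiece_le fun x _ y hy z _ => ?_
    rw [← Nat.cast_one, extZ_natCast, ExteriorAlgebra.exteriorPower, pow_one] at hy
    obtain ⟨v, rfl⟩ := hy
    rw [LinearMap.mem_ker, LinearMap.comp_apply, colEnd_tmul_ι_tmul, cornerProj_tmul, map_mul]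
    have : (LinearMap.range ψ).mkQ (ψ v) = 0 := by simp
    rw [symMap, SymmetricAlgebra.lift_ι_apply, LinearMap.comp_apply, this, map_zero, zero_mul,
      smul_zero, TensorProduct.tmul_zero]
  exact h hu

theorem cornerProj_cornerIncl (ψ : G →ₗ[R] F) (D : Submodule R P) (k : ℕ)
    (w : D ⊗[R] symPow R F k) : cornerProj P ψ (cornerIncl G F D k w) =
      TensorProduct.map D.subtype (symPow R (Coker ψ) k).subtype (toCoker D ψ k w) := by
  induction w with
  | zero => simp only [map_zero]
  | add u v hu hv => simp only [map_add, hu, hv]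
  | tmul x z =>
    change cornerProj P ψ ((x : P) ⊗ₜ (1 ⊗ₜ (z : SymmetricAlgebra R F))) = _
    rw [cornerProj_tmul, map_one, one_smul]
    rfl

theorem toCoker_surjective (A : Type*) [AddCommGroup A] [Module R A] (ψ : G →ₗ[R] F) (k : ℕ) :
    Function.Surjective (toCoker A ψ k) :=
  TensorProduct.map_surjective Function.surjective_id
    (symPowMap_surjective (Submodule.mkQ_surjective _) k)

theorem exists_lTensor_ker_eq {D N N' : Type*} [AddCommGroup D] [Module R D] [AddCommGroup N]
    [Module R N] [AddCommGroup N'] [Module R N'] {g : N →ₗ[R] N'} (hg : Function.Surjective g)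
    {w : D ⊗[R] N} (h : TensorProduct.map LinearMap.id g w = 0) :
    ∃ w' : D ⊗[R] LinearMap.ker g, (LinearMap.ker g).subtype.lTensor D w' = w :=
  (lTensor_exact D (LinearMap.exact_subtype_ker_map g) hg w).1 h

/-- The kernel of S(F) → S(C) in degree k + 1 is ψ(G) · S_k(F), the image of the last column map,
and tensoring with D is right exact. Conversely, D ⊗ S(C) in degree k + 1 embeds into P ⊗ S(C) as
both factors are direct summands. -/
theorem toCoker_eq_zero_iff (bF : Module.Basis (Fin m) R F) (ψ : G →ₗ[R] F) {D : Submodule R P}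
    (hD : IsRetract D) (k : ℕ) (w : D ⊗[R] symPow R F (k + 1)) :
    toCoker D ψ (k + 1) w = 0 ↔ ∃ u ∈ tensorPiece D (extZ R G 1) (symPow R F k),
      colEnd P bF ψ u = cornerIncl G F D (k + 1) w := by
  constructor
  · intro h
    let K := LinearMap.ker (symPowMap (LinearMap.range ψ).mkQ (k + 1))
    obtain ⟨w, rfl⟩ := exists_lTensor_ker_eq (symPowMap_surjective
      (Submodule.mkQ_surjective (LinearMap.range ψ)) (k + 1)) h
    clear h
    have hle : ∀ w : D ⊗[R] K, cornerIncl G F D (k + 1) (K.subtype.lTensor D w) ∈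
        (tensorPiece D (extZ R G 1) (symPow R F k)).map (colEnd P bF ψ) := by
      intro w
      induction w with
      | zero => rw [map_zero, map_zero]; exact zero_mem _
      | add u v hu hv => rw [map_add, map_add]; exact add_mem hu hv
      | tmul x s =>
        have hs : ((s : symPow R F (k + 1)) : SymmetricAlgebra R F) ∈
            (LinearMap.range ψ).map (SymmetricAlgebra.ι R F) * symPow R F k :=
          mem_mul_symPow_of_mem_span _ s.1.2 (mem_span_of_symMap_mkQ_eq_zero _
            (congrArg Subtype.val (LinearMap.mem_ker.1 s.2)))
        change (x : P) ⊗ₜ[R] ((1 : ExteriorAlgebra R G) ⊗ₜ[R]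
          ((s : symPow R F (k + 1)) : SymmetricAlgebra R F)) ∈ _
        generalize ((s : symPow R F (k + 1)) : SymmetricAlgebra R F) = s' at hs
        induction hs using Submodule.mul_induction_on' with
        | mem_mul_mem y hy z hz =>
          obtain ⟨_, ⟨v, rfl⟩, rfl⟩ := hy
          refine ⟨(x : P) ⊗ₜ (ExteriorAlgebra.ι R v ⊗ₜ z), tmul_mem_tensorPiece x.2 ?_ hz,
            colEnd_tmul_ι_tmul bF ψ _ v z⟩
          rw [← Nat.cast_one, extZ_natCast, ExteriorAlgebra.exteriorPower, pow_one]
          exact LinearMap.mem_range_self _ v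
        | add y _ z _ hy hz =>
          rw [TensorProduct.tmul_add, TensorProduct.tmul_add]
          exact add_mem hy hz
    exact hle w
  · rintro ⟨u, hu, e⟩
    have h := cornerProj_colEnd bF ψ hu
    rw [e, cornerProj_cornerIncl] at h
    obtain ⟨pD, hpD⟩ := hD
    obtain ⟨pC, hpC⟩ := isRetract_symPow (R := R) (M := Coker ψ) (k + 1)
    have h' := congrArg (TensorProduct.map pD pC) h
    rw [← LinearMap.comp_apply, ← TensorProduct.map_comp,
      show pD ∘ₗ D.subtype = LinearMap.id from LinearMap.ext hpD,
      show pC ∘ₗ (symPow R (Coker ψ) (k + 1)).subtype = LinearMap.id from LinearMap.ext hpC,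
      TensorProduct.map_id, map_zero] at h'
    exact h'

end Corner

section Total

variable {R H G F : Type*} [CommRing R] [AddCommGroup H] [Module R H] [AddCommGroup G]
  [Module R G] [AddCommGroup F] [Module R F] {l m t : ℕ}

theorem westCorner_apply (a k : ℕ) (w : divPow R H a ⊗[R] symPow R F k) :
    westCorner H G F a k w = inWest R H G F (cornerIncl G F (divPow R H a) k w) := rfl

theorem eastCorner_apply (a k : ℕ) (w : symPow R (Module.Dual R H) a ⊗[R] symPow R F k) :
    eastCorner H G F a k w =
      inEast R H G F (cornerIncl G F (symPow R (Module.Dual R H) a) k w) := rfl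

theorem mem_range_westCorner {q : ℕ} (hq : q ≤ t) (x : Total R H G F) :
    x ∈ cell R H G F l t q q ↔ ∃ w, westCorner H G F (t - q) q w = x := by
  rw [mem_cell_west hq, sub_self, ← range_cornerIncl]
  simp [westCorner_apply]

theorem mem_range_eastCorner {p q : ℕ} (hp : t < p) (hq : q + 1 = p + l) (x : Total R H G F) :
    x ∈ cell R H G F l t p q ↔ ∃ w, eastCorner H G F (p - t - 1) q w = x := by
  rw [mem_cell_east hp, show (p : ℤ) + l - 1 - q = 0 by omega, ← range_cornerIncl]
  simp [eastCorner_apply]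

theorem toCoker_west_eq_zero_iff (bH : Module.Basis (Fin l) R H) (bF : Module.Basis (Fin m) R F)
    (ψ : G →ₗ[R] F) {q : ℕ} (hq : q + 1 ≤ t)
    (w : divPow R H (t - (q + 1)) ⊗[R] symPow R F (q + 1)) :
    toCoker _ ψ (q + 1) w = 0 ↔ westCorner H G F (t - (q + 1)) (q + 1) w ∈
      (cell R H G F l t (q + 1) q).map (colMap H bF ψ) := by
  rw [toCoker_eq_zero_iff bF ψ (by rw [divPow_eq_homPiece bH]; exact isRetract_homPiece _ _)]
  constructor
  · rintro ⟨u, hu, e⟩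
    refine ⟨_, (mem_cell_west hq).2 ⟨u, ?_, rfl⟩, by rw [colMap_inWest, e, westCorner_apply]⟩
    rwa [show ((q + 1 : ℕ) : ℤ) - q = 1 by omega]
  · rintro ⟨_, hx, e⟩
    obtain ⟨u, hu, rfl⟩ := (mem_cell_west hq).1 hx
    rw [show ((q + 1 : ℕ) : ℤ) - q = 1 by omega] at hu
    rw [colMap_inWest, westCorner_apply] at e
    exact ⟨u, hu, inWest_injective e⟩

theorem toCoker_east_eq_zero_iff (bF : Module.Basis (Fin m) R F)
    (ψ : G →ₗ[R] F) {p q : ℕ} (hp : t < p) (hq : q + 1 + 1 = p + l)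
    (w : symPow R (Module.Dual R H) (p - t - 1) ⊗[R] symPow R F (q + 1)) :
    toCoker _ ψ (q + 1) w = 0 ↔ eastCorner H G F (p - t - 1) (q + 1) w ∈
      (cell R H G F l t p q).map (colMap H bF ψ) := by
  rw [toCoker_eq_zero_iff bF ψ (isRetract_symPow _)]
  constructor
  · rintro ⟨u, hu, e⟩
    refine ⟨_, (mem_cell_east hp).2 ⟨u, ?_, rfl⟩, by rw [colMap_inEast, e, eastCorner_apply]⟩
    rwa [show (p : ℤ) + l - 1 - q = 1 by omega]
  · rintro ⟨_, hx, e⟩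
    obtain ⟨u, hu, rfl⟩ := (mem_cell_east hp).1 hx
    rw [show (p : ℤ) + l - 1 - q = 1 by omega] at hu
    rw [colMap_inEast, eastCorner_apply] at e
    exact ⟨u, hu, inEast_injective e⟩

end Total

end KoszulBicomplex

end

/-! ### Diagram chases along staircases in an abstract bicomplex -/

noncomputable section

namespace KoszulBicomplex

/-! ### Staircases in a bicomplex -/

section Chase

variable {R T : Type*} [CommRing R] [AddCommGroup T] [Module R T]

/-- A bicomplex with anticommuting squares, whose modules `C p q` are submodules of one module. -/
structure IsBicomplex (C : ℕ → ℕ → Submodule R T) (d : ℕ → T →ₗ[R] T) (c : T →ₗ[R] T) :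
    Prop where
  row_mem : ∀ {p q x}, x ∈ C p q → d q x ∈ C (p + 1) q
  col_mem : ∀ {p q x}, x ∈ C p q → c x ∈ C p (q + 1)
  row_row : ∀ q x, d q (d q x) = 0
  col_col : ∀ x, c (c x) = 0
  row_col : ∀ q x, d (q + 1) (c x) = -c (d q x)

/-- The staircase relation in a bicomplex, on the antidiagonal `p + q = N`. -/
def Stair (C : ℕ → ℕ → Submodule R T) (d : ℕ → T →ₗ[R] T) (c : T →ₗ[R] T) (N q : ℕ) (x z : T) :
    Prop :=
  ∃ y : ℕ → T, (∀ j ≤ q, y j ∈ C (N - j) j) ∧ d 0 (y 0) = x ∧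
    (∀ j < q, c (y j) = d (j + 1) (y (j + 1))) ∧ y q = z

variable {C : ℕ → ℕ → Submodule R T} {d : ℕ → T →ₗ[R] T} {c : T →ₗ[R] T} {N q : ℕ} {x z : T}

theorem stair_zero : Stair C d c N 0 x z ↔ z ∈ C N 0 ∧ d 0 z = x := by
  constructor
  · rintro ⟨y, h1, h2, -, rfl⟩
    exact ⟨h1 0 le_rfl, h2⟩
  · rintro ⟨h1, h2⟩
    exact ⟨fun _ => z, fun j hj => by obtain rfl : j = 0 := by omega
                                      exact h1, h2, fun j hj => absurd hj (by omega), rfl⟩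

theorem stair_succ : Stair C d c N (q + 1) x z ↔ ∃ z', Stair C d c N q x z' ∧
    z ∈ C (N - (q + 1)) (q + 1) ∧ c z' = d (q + 1) z := by
  constructor
  · rintro ⟨y, h1, h2, h3, rfl⟩
    exact ⟨y q, ⟨y, fun j hj => h1 j (by omega), h2, fun j hj => h3 j (by omega), rfl⟩,
      h1 _ le_rfl, h3 q (by omega)⟩
  · rintro ⟨z', ⟨y, h1, h2, h3, rfl⟩, h4, h5⟩
    refine ⟨fun j => if j ≤ q then y j else z, fun j hj => ?_, ?_, fun j hj => ?_, ?_⟩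
    · dsimp only
      split_ifs with h
      · exact h1 j h
      · obtain rfl : j = q + 1 := by omega
        exact h4
    · simpa using h2
    · rcases Nat.lt_succ_iff_lt_or_eq.1 hj with h | rfl
      · simp only [if_pos h.le, if_pos (Nat.succ_le_of_lt h)]
        exact h3 j h
      · simpa using h5
    · simp

theorem Stair.mem (h : Stair C d c N q x z) : z ∈ C (N - q) q := by
  obtain ⟨y, h1, -, -, rfl⟩ := h
  exact h1 q le_rfl

theorem Stair.add {x' z' : T} (h : Stair C d c N q x z) (h' : Stair C d c N q x' z') :
    Stair C d c N q (x + x') (z + z') := by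
  obtain ⟨y, h1, h2, h3, rfl⟩ := h
  obtain ⟨y', h1', h2', h3', rfl⟩ := h'
  refine ⟨y + y', fun j hj => add_mem (h1 j hj) (h1' j hj), ?_, fun j hj => ?_, rfl⟩
  · rw [Pi.add_apply, map_add, h2, h2']
  · rw [Pi.add_apply, Pi.add_apply, map_add, map_add, h3 j hj, h3' j hj]

theorem Stair.smul (a : R) (h : Stair C d c N q x z) : Stair C d c N q (a • x) (a • z) := by
  obtain ⟨y, h1, h2, h3, rfl⟩ := h
  refine ⟨a • y, fun j hj => Submodule.smul_mem _ a (h1 j hj), ?_, fun j hj => ?_, rfl⟩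
  · rw [Pi.smul_apply, map_smul, h2]
  · rw [Pi.smul_apply, Pi.smul_apply, map_smul, map_smul, h3 j hj]

/-- A staircase of positive length is not affected by a boundary of the kernel complex. -/
theorem stair_row_of_mem_ker {n : T} (hq : 1 ≤ q) (hn : n ∈ C N 0) (hcn : c n = 0) :
    Stair C d c N q (d 0 n) 0 := by
  refine ⟨fun j => if j = 0 then n else 0, fun j _ => ?_, by simp, fun j _ => ?_, ?_⟩
  · dsimp only
    split_ifs with h
    · subst h; exact hn
    · exact zero_mem _
  · by_cases h : j = 0 <;> simp [h, hcn]
  · simp [show q ≠ 0 by omega]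

/-- The boundaries of the columns. -/
def colBdry (C : ℕ → ℕ → Submodule R T) (c : T →ₗ[R] T) (p : ℕ) : ℕ → Submodule R T :=
  bdry (C p) (fun _ => c)

/-- The boundaries of the rows. -/
def rowBdry (C : ℕ → ℕ → Submodule R T) (d : ℕ → T →ₗ[R] T) (q : ℕ) : ℕ → Submodule R T :=
  bdry (fun p => C p q) (fun _ => d q)

theorem Stair.row_mem_colBdry (hq : q + 1 ≤ N) (h : Stair C d c N (q + 1) x z) :
    d (q + 1) z ∈ colBdry C c (N - (q + 1) + 1) (q + 1) := by
  obtain ⟨z', hz', -, e⟩ := stair_succ.1 h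
  refine ⟨z', ?_, e⟩
  rw [show N - (q + 1) + 1 = N - q by omega]
  exact hz'.mem

variable (hC : IsBicomplex C d c)

include hC

theorem col_eq_zero_of_mem_colBdry {p : ℕ} (hx : x ∈ colBdry C c p q) : c x = 0 := by
  cases q with
  | zero => rw [(Submodule.mem_bot R).1 hx, map_zero]
  | succ q =>
    obtain ⟨y, -, rfl⟩ := hx
    exact hC.col_col y

theorem row_eq_zero_of_mem_rowBdry {p : ℕ} (hx : x ∈ rowBdry C d q p) : d q x = 0 := by
  cases p with
  | zero => rw [(Submodule.mem_bot R).1 hx, map_zero]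
  | succ p =>
    obtain ⟨y, -, rfl⟩ := hx
    exact hC.row_row q y

theorem Stair.row_col_eq_zero (hcx : c x = 0) (h : Stair C d c N q x z) :
    d (q + 1) (c z) = 0 := by
  cases q with
  | zero =>
    obtain ⟨-, rfl⟩ := stair_zero.1 h
    rw [hC.row_col, hcx, neg_zero]
  | succ q =>
    obtain ⟨z', -, -, e⟩ := stair_succ.1 h
    rw [hC.row_col, ← e, hC.col_col, neg_zero]

theorem Stair.cycle (h : Stair C d c N (q + 1) x z) :
    x ∈ C (N + 1) 0 ∧ c x = 0 ∧ d 0 x = 0 := by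
  obtain ⟨y, h1, rfl, h3, -⟩ := h
  refine ⟨hC.row_mem (h1 0 (by omega)), ?_, hC.row_row 0 _⟩
  have := hC.row_col 0 (y 0)
  rw [h3 0 (by omega), hC.row_row] at this
  exact neg_eq_zero.1 this.symm

/-- Exactness of the rows extends a staircase: the column image of its end is a row cycle, hence the
row image of the next element. -/
theorem exists_stair (hrow : ∀ p ≤ N + 1, ∀ q, ∀ x ∈ C p q, d q x = 0 → x ∈ rowBdry C d q p)
    (hx : x ∈ C (N + 1) 0) (hcx : c x = 0) (hdx : d 0 x = 0) (hq : q ≤ N) :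
    ∃ z, Stair C d c N q x z := by
  induction q with
  | zero =>
    obtain ⟨z, hz, e⟩ := hrow _ le_rfl 0 x hx hdx
    exact ⟨z, stair_zero.2 ⟨hz, e⟩⟩
  | succ q ih =>
    obtain ⟨z, hz⟩ := ih (by omega)
    have h := hrow (N - q) (by omega) (q + 1) (c z) (hC.col_mem hz.mem)
      (hz.row_col_eq_zero hC hcx)
    rw [show N - q = N - (q + 1) + 1 by omega] at h
    obtain ⟨z', hz', e⟩ := h
    exact ⟨z', stair_succ.2 ⟨z, hz, hz', e.symm⟩⟩

/-- This bounds the indeterminacy of the end of a staircase. If the previous entry is d w plus a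
column boundary, then z + c w is a row cycle and hence a row boundary. -/
theorem Stair.mem_bdry (hrow : ∀ p ≤ N, ∀ q, ∀ x ∈ C p q, d q x = 0 → x ∈ rowBdry C d q p)
    (hq : q ≤ N) (h : Stair C d c N q 0 z) :
    z ∈ rowBdry C d q (N - q) ⊔ colBdry C c (N - q) q := by
  induction q generalizing z with
  | zero =>
    obtain ⟨hz, e⟩ := stair_zero.1 h
    exact Submodule.mem_sup_left (hrow _ le_rfl 0 z hz e)
  | succ q ih =>
    obtain ⟨z', hz', hz, e⟩ := stair_succ.1 h
    obtain ⟨b, hb, b', hb', rfl⟩ := Submodule.mem_sup.1 (ih (by omega) hz')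
    rw [show N - q = N - (q + 1) + 1 by omega] at hb
    obtain ⟨w, hw, rfl⟩ := hb
    rw [map_add, col_eq_zero_of_mem_colBdry hC hb', add_zero] at e
    have h1 : d (q + 1) (z + c w) = 0 := by
      rw [map_add, ← e, hC.row_col, add_neg_cancel]
    have h2 := hrow (N - (q + 1)) (by omega) (q + 1) (z + c w) (add_mem hz (hC.col_mem hw)) h1
    have h3 : c w ∈ colBdry C c (N - (q + 1)) (q + 1) := ⟨w, hw, rfl⟩
    rw [← add_sub_cancel_right z (c w)]
    exact sub_mem (Submodule.mem_sup_left h2) (Submodule.mem_sup_right h3)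

/-- Descending from z, choose z' with c z' = d z. Then d z' is a column cycle on the next
antidiagonal, and exactness of the column there permits the next step. -/
theorem exists_stair_of_row_mem
    (hcol : ∀ j, 1 ≤ j → j < q → ∀ x ∈ C (N + 1 - j) j, c x = 0 → x ∈ colBdry C c (N + 1 - j) j)
    (hq : q ≤ N) (hz : z ∈ C (N - q) q) (hdz : q = 0 ∨ d q z ∈ colBdry C c (N - q + 1) q) :
    ∃ x, Stair C d c N q x z := by
  induction q generalizing z with
  | zero => exact ⟨_, stair_zero.2 ⟨hz, rfl⟩⟩
  | succ q ih =>
    obtain ⟨z', hz', e⟩ := hdz.resolve_left (by omega)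
    rw [SetLike.mem_coe, show N - (q + 1) + 1 = N - q by omega] at hz'
    obtain ⟨x, hx⟩ := ih (fun j h1 h2 => hcol j h1 (by omega)) (by omega) hz' (by
      rcases Nat.eq_zero_or_pos q with h | h
      · exact Or.inl h
      · have := hcol q h (by omega) (d q z') (by
          rw [show N + 1 - q = N - q + 1 by omega]
          exact hC.row_mem hz') (by
          rw [← neg_eq_zero, ← hC.row_col, e, hC.row_row])
        rw [show N + 1 - q = N - q + 1 by omega] at this
        exact Or.inr this)
    exact ⟨x, stair_succ.2 ⟨z', hx, hz, e⟩⟩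

/-- If z is c v plus a row boundary, then z' + d v is a column cycle, where z' is the previous
entry. Exactness of the column moves the hypothesis down to z'; at the bottom z' + d v lies in the
kernel complex and has row image x. -/
theorem Stair.mem_row_ker
    (hcol : ∀ j, 1 ≤ j → j < q → ∀ x ∈ C (N - j) j, c x = 0 → x ∈ colBdry C c (N - j) j)
    (hq : q ≤ N) (h : Stair C d c N q x z)
    (hz : z ∈ rowBdry C d q (N - q) ⊔ colBdry C c (N - q) q) :
    ∃ n ∈ C N 0, c n = 0 ∧ d 0 n = x := by
  induction q generalizing z with
  | zero =>
    obtain ⟨-, rfl⟩ := stair_zero.1 h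
    refine ⟨0, zero_mem _, map_zero _, ?_⟩
    obtain ⟨b, hb, b', hb', rfl⟩ := Submodule.mem_sup.1 hz
    rw [(Submodule.mem_bot R).1 hb', add_zero, map_zero, row_eq_zero_of_mem_rowBdry hC hb]
  | succ q ih =>
    obtain ⟨z', hz', -, e⟩ := stair_succ.1 h
    obtain ⟨b, hb, b', hb', rfl⟩ := Submodule.mem_sup.1 hz
    obtain ⟨v, hv, rfl⟩ := hb'
    rw [map_add, row_eq_zero_of_mem_rowBdry hC hb, zero_add, hC.row_col] at e
    have h1 : c (z' + d q v) = 0 := by rw [map_add, e, neg_add_cancel]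
    have hdv : d q v ∈ C (N - q) q := by
      rw [show N - q = N - (q + 1) + 1 by omega]
      exact hC.row_mem hv
    have h2 : z' + d q v ∈ C (N - q) q := add_mem hz'.mem hdv
    rcases Nat.eq_zero_or_pos q with h0 | h0
    · subst h0
      obtain ⟨-, rfl⟩ := stair_zero.1 hz'
      exact ⟨_, h2, h1, by rw [map_add, hC.row_row, add_zero]⟩
    · refine ih (fun j h1 h2 => hcol j h1 (by omega)) (by omega) hz' ?_
      rw [← add_sub_cancel_right z' (d q v)]
      refine sub_mem (Submodule.mem_sup_right (hcol q h0 (by omega) _ h2 h1))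
        (Submodule.mem_sup_left ?_)
      rw [show N - q = N - (q + 1) + 1 by omega]
      exact ⟨v, hv, rfl⟩

end Chase

/-- A linear relation which is total and functional is the graph of a linear map. -/
theorem exists_linearMap_of_relation {R X Y : Type*} [CommRing R] [AddCommGroup X] [Module R X]
    [AddCommGroup Y] [Module R Y] (Γ : X → Y → Prop) (hadd : ∀ x y x' y', Γ x y → Γ x' y' →
      Γ (x + x') (y + y')) (hsmul : ∀ (a : R) x y, Γ x y → Γ (a • x) (a • y))
    (htotal : ∀ x, ∃ y, Γ x y) (hfun : ∀ y, Γ 0 y → y = 0) :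
    ∃ f : X →ₗ[R] Y, ∀ x y, f x = y ↔ Γ x y := by
  have huniq : ∀ x y y', Γ x y → Γ x y' → y = y' := fun x y y' h h' => by
    have h1 := hadd _ _ _ _ h (hsmul (-1) _ _ h')
    rw [neg_one_smul, neg_one_smul, add_neg_cancel] at h1
    exact sub_eq_zero.1 ((sub_eq_add_neg y y').trans (hfun _ h1))
  choose f hf using htotal
  refine ⟨⟨⟨f, fun x x' => ?_⟩, fun a x => ?_⟩, fun x y => ⟨?_, fun h => huniq _ _ _ (hf x) h⟩⟩
  · exact huniq _ _ _ (hf _) (hadd _ _ _ _ (hf x) (hf x'))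
  · exact huniq _ _ _ (hf _) (hsmul a _ _ (hf x))
  · rintro rfl
    exact hf x

end KoszulBicomplex

end

/-! ### The staircase maps, their kernels and images -/

noncomputable section

namespace KoszulBicomplex

open scoped TensorProduct

/-! ### The natural maps -/

section Natural

variable {R H G F : Type*} [CommRing R] [AddCommGroup H] [Module R H] [AddCommGroup G]
  [Module R G] [AddCommGroup F] [Module R F] {l m t : ℕ} {bH : Module.Basis (Fin l) R H}
  {bF : Module.Basis (Fin m) R F} {φ : H →ₗ[R] G} {ψ : G →ₗ[R] F}

theorem isBicomplex_cell (h : ψ ∘ₗ φ = 0) :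
    IsBicomplex (cell R H G F l t) (rowMap bH φ) (colMap H bF ψ) where
  row_mem := rowMap_mem_cell bH φ
  col_mem := colMap_mem_cell bF ψ
  row_row := rowMap_rowMap bH φ
  col_col := colMap_colMap bF ψ
  row_col := rowMap_colMap bH h

theorem staircase_iff {N q : ℕ} {x z : Total R H G F} :
    Staircase bH bF φ ψ t (N + 1) q x z ↔
      Stair (cell R H G F l t) (rowMap bH φ) (colMap H bF ψ) N q x z := Iff.rfl

theorem mem_cyclesN {i : ℕ} {x : Total R H G F} : x ∈ cyclesN bH bF φ ψ t i ↔
    (x ∈ cell R H G F l t i 0 ∧ colMap H bF ψ x = 0) ∧ rowMap bH φ 0 x = 0 := Iff.rfl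

theorem mk_eq_zero_iff_mem_boundariesN {i : ℕ} {x : cyclesN bH bF φ ψ t i} :
    (Submodule.Quotient.mk x : HBar bH bF φ ψ t i) = 0 ↔
      (x : Total R H G F) ∈ boundariesN bH bF φ ψ t i :=
  Submodule.Quotient.mk_eq_zero _

theorem mk_eq_zero_iff_mem_boundariesPsi {p q : ℕ} {z : cyclesPsi H l bF ψ t p q} :
    (Submodule.Quotient.mk z : HPsi H l bF ψ t p q) = 0 ↔
      (z : Total R H G F) ∈ boundariesPsi H l bF ψ t p q :=
  Submodule.Quotient.mk_eq_zero _

theorem mem_boundariesN_succ {N : ℕ} {x : Total R H G F} :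
    x ∈ boundariesN bH bF φ ψ t (N + 1) ↔
      ∃ n ∈ cell R H G F l t N 0, colMap H bF ψ n = 0 ∧ rowMap bH φ 0 n = x := by
  constructor
  · rintro ⟨n, ⟨h1, h2⟩, e⟩
    exact ⟨n, h1, h2, e⟩
  · rintro ⟨n, h1, h2, e⟩
    exact ⟨n, ⟨h1, h2⟩, e⟩

/-- The data of a corner of the bicomplex: a parametrization of `C^{p,q}` by `A ⊗ S_q(F)`, such that
`A ⊗ S_q(C)` is the cokernel of the column map into `C^{p,q}`, and the row map into `C^{p,q}`
vanishes. -/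
structure IsCorner (bH : Module.Basis (Fin l) R H) (bF : Module.Basis (Fin m) R F)
    (φ : H →ₗ[R] G) (ψ : G →ₗ[R] F) (t p q : ℕ) {A : Type*} [AddCommGroup A] [Module R A]
    (incl : A ⊗[R] symPow R F q →ₗ[R] Total R H G F) : Prop where
  mem_iff : ∀ x, x ∈ cell R H G F l t p q ↔ ∃ w, incl w = x
  toCoker_eq_zero : ∀ w, toCoker A ψ q w = 0 ↔
    incl w ∈ colBdry (cell R H G F l t) (colMap H bF ψ) p q
  rowBdry_eq_bot : rowBdry (cell R H G F l t) (rowMap bH φ) q p = ⊥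
  cell_succ_eq_bot : cell R H G F l t p (q + 1) = ⊥

/-- Exactness of the rows at `C^{p,q}` for `p ≤ N`. -/
def RowsExact (bH : Module.Basis (Fin l) R H) (F : Type*) [AddCommGroup F] [Module R F]
    (φ : H →ₗ[R] G) (t N : ℕ) : Prop :=
  ∀ p ≤ N, ∀ q, ∀ x ∈ cell R H G F l t p q, rowMap bH φ q x = 0 →
    x ∈ rowBdry (cell R H G F l t) (rowMap bH φ) q p

/-- Exactness of the columns at `C^{N-j,j}` for `1 ≤ j < q`. -/
def ColumnsExact (H : Type*) [AddCommGroup H] [Module R H] (l : ℕ) (bF : Module.Basis (Fin m) R F)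
    (ψ : G →ₗ[R] F) (t N q : ℕ) : Prop :=
  ∀ j, 1 ≤ j → j < q → ∀ x ∈ cell R H G F l t (N - j) j, colMap H bF ψ x = 0 →
    x ∈ colBdry (cell R H G F l t) (colMap H bF ψ) (N - j) j

theorem RowsExact.mono {N N' : ℕ} (h : RowsExact bH F φ t N) (hN : N' ≤ N) :
    RowsExact bH F φ t N' := fun p hp => h p (hp.trans hN)

section Corner

variable {A : Type*} [AddCommGroup A] [Module R A] {N p q : ℕ}
  {incl : A ⊗[R] symPow R F (q + 1) →ₗ[R] Total R H G F}

/-- Staircases are not unique, so the map is obtained from a linear relation. It is functional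
because no row boundaries enter at a corner, so the indeterminacy consists of column boundaries,
which vanish in A ⊗ S(C). -/
theorem IsCorner.exists_staircaseToCorner (hC : ψ ∘ₗ φ = 0)
    (hcor : IsCorner bH bF φ ψ t p (q + 1) incl) (hN : N = p + (q + 1))
    (hrow : RowsExact bH F φ t (N + 1)) :
    ∃ f : HBar bH bF φ ψ t (N + 1) →ₗ[R] A ⊗[R] symPow R (Coker ψ) (q + 1),
      IsStaircaseToCorner bH bF φ ψ t (N + 1) (q + 1) incl f := by
  have hB := isBicomplex_cell (bH := bH) (bF := bF) (t := t) hC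
  have hp : N - (q + 1) = p := by omega
  have hfun : ∀ w, Stair (cell R H G F l t) (rowMap bH φ) (colMap H bF ψ) N (q + 1) 0 (incl w) →
      toCoker A ψ (q + 1) w = 0 := fun w hw => by
    have h := hw.mem_bdry hB (hrow.mono (Nat.le_succ N)) (by omega)
    rw [hp, hcor.rowBdry_eq_bot, bot_sup_eq] at h
    exact (hcor.toCoker_eq_zero w).2 h
  obtain ⟨f, hf⟩ := exists_linearMap_of_relation (R := R) (X := cyclesN bH bF φ ψ t (N + 1))
    (fun x c => ∃ w, toCoker A ψ (q + 1) w = c ∧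
      Stair (cell R H G F l t) (rowMap bH φ) (colMap H bF ψ) N (q + 1) x (incl w))
    (by
      rintro x _ x' _ ⟨w, rfl, h⟩ ⟨w', rfl, h'⟩
      exact ⟨w + w', map_add _ _ _, by rw [map_add]; exact h.add h'⟩)
    (by
      rintro a x _ ⟨w, rfl, h⟩
      exact ⟨a • w, map_smul _ _ _, by rw [map_smul]; exact h.smul a⟩)
    (fun x => by
      obtain ⟨⟨h1, h2⟩, h3⟩ := mem_cyclesN.1 x.2
      obtain ⟨z, hz⟩ := exists_stair hB hrow h1 h2 h3 (q := q + 1) (by omega)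
      have := hz.mem
      rw [hp] at this
      obtain ⟨w, rfl⟩ := (hcor.mem_iff z).1 this
      exact ⟨_, w, rfl, hz⟩)
    (by
      rintro _ ⟨w, rfl, h⟩
      exact hfun w h)
  refine ⟨Submodule.liftQ _ f fun x hx => ?_, fun x c => hf x c⟩
  obtain ⟨n, hn, hcn, e⟩ := mem_boundariesN_succ.1 (show (x : Total R H G F) ∈ _ from hx)
  rw [LinearMap.mem_ker, hf]
  refine ⟨0, map_zero _, ?_⟩
  rw [← e, map_zero]
  exact stair_row_of_mem_ker (by omega) hn hcn

theorem IsCorner.injective (hC : ψ ∘ₗ φ = 0) (hcor : IsCorner bH bF φ ψ t p (q + 1) incl)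
    (hN : N = p + (q + 1)) (hcol : ColumnsExact H l bF ψ t N (q + 1))
    {f : HBar bH bF φ ψ t (N + 1) →ₗ[R] A ⊗[R] symPow R (Coker ψ) (q + 1)}
    (hf : IsStaircaseToCorner bH bF φ ψ t (N + 1) (q + 1) incl f) : Function.Injective f := by
  have hB := isBicomplex_cell (bH := bH) (bF := bF) (t := t) hC
  have hp : N - (q + 1) = p := by omega
  rw [injective_iff_map_eq_zero]
  intro ξ hξ
  obtain ⟨x, rfl⟩ := Submodule.Quotient.mk_surjective _ ξ
  obtain ⟨w, hw, h⟩ := (hf x 0).1 hξ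
  rw [mk_eq_zero_iff_mem_boundariesN, mem_boundariesN_succ]
  refine (staircase_iff.1 h).mem_row_ker hB hcol (by omega) (Submodule.mem_sup_right ?_)
  rw [hp]
  exact (hcor.toCoker_eq_zero w).1 hw

theorem IsCorner.col_incl (hcor : IsCorner bH bF φ ψ t p (q + 1) incl)
    (w : A ⊗[R] symPow R F (q + 1)) : colMap H bF ψ (incl w) = 0 := by
  have := colMap_mem_cell (H := H) bF ψ ((hcor.mem_iff _).2 ⟨w, rfl⟩)
  rw [hcor.cell_succ_eq_bot] at this
  exact (Submodule.mem_bot R).1 this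

/-- The class of `w` lies in the image of the staircase map iff the row map sends `w` to a boundary
of the next column. -/
theorem IsCorner.mem_range_iff (hC : ψ ∘ₗ φ = 0) (hcor : IsCorner bH bF φ ψ t p (q + 1) incl)
    (hN : N = p + (q + 1)) (hcol : ColumnsExact H l bF ψ t (N + 1) (q + 1))
    {f : HBar bH bF φ ψ t (N + 1) →ₗ[R] A ⊗[R] symPow R (Coker ψ) (q + 1)}
    (hf : IsStaircaseToCorner bH bF φ ψ t (N + 1) (q + 1) incl f)
    (w : A ⊗[R] symPow R F (q + 1)) :
    (∃ ξ, f ξ = toCoker A ψ (q + 1) w) ↔ rowMap bH φ (q + 1) (incl w) ∈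
      colBdry (cell R H G F l t) (colMap H bF ψ) (p + 1) (q + 1) := by
  have hB := isBicomplex_cell (bH := bH) (bF := bF) (t := t) hC
  have hp : N - (q + 1) = p := by omega
  constructor
  · rintro ⟨ξ, hξ⟩
    obtain ⟨x, rfl⟩ := Submodule.Quotient.mk_surjective _ ξ
    obtain ⟨w', hw', h⟩ := (hf x _).1 hξ
    have h1 := (staircase_iff.1 h).row_mem_colBdry (by omega)
    rw [hp] at h1
    have h2 : toCoker A ψ (q + 1) (w - w') = 0 := by rw [map_sub, hw', sub_self]
    obtain ⟨u, hu, e⟩ := (hcor.toCoker_eq_zero _).1 h2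
    have h3 : rowMap bH φ (q + 1) (incl (w - w')) ∈
        colBdry (cell R H G F l t) (colMap H bF ψ) (p + 1) (q + 1) := by
      rw [← e, hB.row_col]
      exact neg_mem ⟨_, hB.row_mem hu, rfl⟩
    rw [map_sub, map_sub] at h3
    simpa using add_mem h3 h1
  · intro h
    obtain ⟨x, hx⟩ := exists_stair_of_row_mem hB (N := N) (q := q + 1) (z := incl w) hcol
      (by omega) (by rw [hp]; exact (hcor.mem_iff _).2 ⟨w, rfl⟩) (by rw [hp]; exact Or.inr h)
    obtain ⟨h1, h2, h3⟩ := hx.cycle hB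
    exact ⟨Submodule.Quotient.mk ⟨x, ⟨h1, h2⟩, h3⟩, (hf _ _).2 ⟨w, rfl, staircase_iff.2 hx⟩⟩

theorem IsCorner.exists_inducedByRowMap (hC : ψ ∘ₗ φ = 0)
    (hcor : IsCorner bH bF φ ψ t p (q + 1) incl) :
    ∃ g : A ⊗[R] symPow R (Coker ψ) (q + 1) →ₗ[R] HPsi H l bF ψ t (p + 1) (q + 1),
      IsInducedByRowMap bH bF φ ψ t (p + 1) (q + 1) incl g ∧ ∀ w,
        g (toCoker A ψ (q + 1) w) = 0 ↔ rowMap bH φ (q + 1) (incl w) ∈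
          colBdry (cell R H G F l t) (colMap H bF ψ) (p + 1) (q + 1) := by
  have hB := isBicomplex_cell (bH := bH) (bF := bF) (t := t) hC
  have hmem : ∀ w, rowMap bH φ (q + 1) (incl w) ∈ cyclesPsi H l bF ψ t (p + 1) (q + 1) :=
    fun w => ⟨hB.row_mem ((hcor.mem_iff _).2 ⟨w, rfl⟩), by
      rw [SetLike.mem_coe, LinearMap.mem_ker, ← neg_eq_zero, ← hB.row_col, hcor.col_incl, map_zero]⟩
  let g₀ : A ⊗[R] symPow R F (q + 1) →ₗ[R] HPsi H l bF ψ t (p + 1) (q + 1) :=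
    Submodule.mkQ _ ∘ₗ (rowMap bH φ (q + 1) ∘ₗ incl).codRestrict _ hmem
  have hg₀ : ∀ w, g₀ w = Submodule.Quotient.mk ⟨_, hmem w⟩ := fun w => rfl
  have hker : ∀ w, g₀ w = 0 ↔ rowMap bH φ (q + 1) (incl w) ∈
      colBdry (cell R H G F l t) (colMap H bF ψ) (p + 1) (q + 1) := fun w => by
    rw [hg₀, mk_eq_zero_iff_mem_boundariesPsi]
    rfl
  obtain ⟨g, hg⟩ := exists_linearMap_of_relation (R := R)
    (fun c ζ => ∃ w, toCoker A ψ (q + 1) w = c ∧ g₀ w = ζ)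
    (by
      rintro _ _ _ _ ⟨w, rfl, rfl⟩ ⟨w', rfl, rfl⟩
      exact ⟨w + w', map_add _ _ _, map_add _ _ _⟩)
    (by
      rintro a _ _ ⟨w, rfl, rfl⟩
      exact ⟨a • w, map_smul _ _ _, map_smul _ _ _⟩)
    (fun c => by
      obtain ⟨w, rfl⟩ := toCoker_surjective A ψ (q + 1) c
      exact ⟨_, w, rfl, rfl⟩)
    (by
      rintro _ ⟨w, hw, rfl⟩
      obtain ⟨u, hu, e⟩ := (hcor.toCoker_eq_zero w).1 hw
      rw [hker, ← e, hB.row_col]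
      exact neg_mem ⟨_, hB.row_mem hu, rfl⟩)
  have hgw : ∀ w, g (toCoker A ψ (q + 1) w) = g₀ w := fun w => (hg _ _).2 ⟨w, rfl, rfl⟩
  exact ⟨g, fun w => ⟨⟨_, hmem w⟩, rfl, hgw w⟩, fun w => by rw [hgw, hker]⟩

end Corner

section Column

variable {N p q : ℕ}

/-- `hcol'` serves to descend from a column cycle to the bottom row, including the first step at
C^{p+2,q+1}; `hcol` makes the resulting class independent of the choices. -/
theorem exists_staircaseFromColumn (hC : ψ ∘ₗ φ = 0) (hN : N = p + 1 + (q + 1))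
    (hcol : ColumnsExact H l bF ψ t N (q + 1)) (hcol' : ColumnsExact H l bF ψ t (N + 1) (q + 2)) :
    ∃ e : HPsi H l bF ψ t (p + 1) (q + 1) →ₗ[R] HBar bH bF φ ψ t (N + 1),
      IsStaircaseFromColumn bH bF φ ψ t (p + 1) (q + 1) (N + 1) e := by
  have hB := isBicomplex_cell (bH := bH) (bF := bF) (t := t) hC
  have hp : N - (q + 1) = p + 1 := by omega
  have hfun : ∀ (x : Total R H G F) (z : Total R H G F),
      z ∈ colBdry (cell R H G F l t) (colMap H bF ψ) (p + 1) (q + 1) →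
      Stair (cell R H G F l t) (rowMap bH φ) (colMap H bF ψ) N (q + 1) x z →
      x ∈ boundariesN bH bF φ ψ t (N + 1) := fun x z hz h => by
    refine mem_boundariesN_succ.2 (h.mem_row_ker hB hcol (by omega) (Submodule.mem_sup_right ?_))
    rwa [hp]
  have htotal : ∀ z ∈ cyclesPsi H l bF ψ t (p + 1) (q + 1), ∃ x : cyclesN bH bF φ ψ t (N + 1),
      Stair (cell R H G F l t) (rowMap bH φ) (colMap H bF ψ) N (q + 1) x z := by
    rintro z ⟨hz, hcz⟩
    obtain ⟨x, hx⟩ := exists_stair_of_row_mem hB (N := N) (q := q + 1) (z := z)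
      (fun j h1 h2 => hcol' j h1 (by omega)) (by omega) (by rwa [hp]) (by
        have := hcol' (q + 1) (by omega) (by omega) (rowMap bH φ (q + 1) z)
        rw [show N + 1 - (q + 1) = p + 1 + 1 by omega] at this
        rw [hp]
        refine Or.inr (this (hB.row_mem hz) ?_)
        rw [← neg_eq_zero, ← hB.row_col, LinearMap.mem_ker.1 hcz, map_zero])
    obtain ⟨h1, h2, h3⟩ := hx.cycle hB
    exact ⟨⟨x, ⟨h1, h2⟩, h3⟩, hx⟩
  obtain ⟨e, he⟩ := exists_linearMap_of_relation (R := R)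
    (X := cyclesPsi H l bF ψ t (p + 1) (q + 1)) (Y := HBar bH bF φ ψ t (N + 1))
    (fun z c => ∃ x : cyclesN bH bF φ ψ t (N + 1), Submodule.Quotient.mk x = c ∧
      Stair (cell R H G F l t) (rowMap bH φ) (colMap H bF ψ) N (q + 1) x z)
    (by
      rintro z _ z' _ ⟨x, rfl, h⟩ ⟨x', rfl, h'⟩
      exact ⟨x + x', rfl, h.add h'⟩)
    (by
      rintro a z _ ⟨x, rfl, h⟩
      exact ⟨a • x, rfl, h.smul a⟩)
    (fun z => by
      obtain ⟨x, hx⟩ := htotal z z.2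
      exact ⟨_, x, rfl, hx⟩)
    (by
      rintro _ ⟨x, rfl, h⟩
      exact mk_eq_zero_iff_mem_boundariesN.2 (hfun _ _ (zero_mem _) h))
  refine ⟨Submodule.liftQ _ e fun z hz => ?_, fun z c => he z c⟩
  obtain ⟨x, hx⟩ := htotal z z.2
  rw [LinearMap.mem_ker, he]
  exact ⟨x, mk_eq_zero_iff_mem_boundariesN.2 (hfun _ _ hz hx), hx⟩

/-- A staircase climbed from x ends in some z with c z a row cycle. Its preimage would lie in the
zero module C^{p,q+2}, so z is a column cycle. -/
theorem staircaseFromColumn_surjective (hC : ψ ∘ₗ φ = 0) (hN : N = p + 1 + (q + 1))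
    (hrow : RowsExact bH F φ t (N + 1)) (hbot : cell R H G F l t p (q + 2) = ⊥)
    {e : HPsi H l bF ψ t (p + 1) (q + 1) →ₗ[R] HBar bH bF φ ψ t (N + 1)}
    (he : IsStaircaseFromColumn bH bF φ ψ t (p + 1) (q + 1) (N + 1) e) :
    Function.Surjective e := by
  have hB := isBicomplex_cell (bH := bH) (bF := bF) (t := t) hC
  have hp : N - (q + 1) = p + 1 := by omega
  intro c
  obtain ⟨x, rfl⟩ := Submodule.Quotient.mk_surjective _ c
  obtain ⟨⟨h1, h2⟩, h3⟩ := mem_cyclesN.1 x.2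
  obtain ⟨z, hz⟩ := exists_stair hB hrow h1 h2 h3 (q := q + 1) (by omega)
  have hmem := hz.mem
  rw [hp] at hmem
  obtain ⟨y, hy, hyz⟩ := hrow (p + 1) (by omega) (q + 2) _ (hB.col_mem hmem)
    (hz.row_col_eq_zero hB h2)
  have hy : y ∈ cell R H G F l t p (q + 2) := hy
  rw [hbot, Submodule.mem_bot] at hy
  rw [hy, map_zero] at hyz
  exact ⟨Submodule.Quotient.mk ⟨z, hmem, hyz.symm⟩, (he _ _).2 ⟨x, rfl, staircase_iff.2 hz⟩⟩

/-- Subtracting the trivial staircase of a boundary reduces to a staircase starting at 0. The row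
boundaries at C^{p+1,q+1} are the images of the corner, which gives exactness at H_ψ. -/
theorem staircaseFromColumn_eq_zero_iff (hC : ψ ∘ₗ φ = 0) (hN : N = p + 1 + (q + 1))
    (hrow : RowsExact bH F φ t N) (hcol : ColumnsExact H l bF ψ t N (q + 1))
    {e : HPsi H l bF ψ t (p + 1) (q + 1) →ₗ[R] HBar bH bF φ ψ t (N + 1)}
    (he : IsStaircaseFromColumn bH bF φ ψ t (p + 1) (q + 1) (N + 1) e)
    (z : cyclesPsi H l bF ψ t (p + 1) (q + 1)) :
    e (Submodule.Quotient.mk z) = 0 ↔ (z : Total R H G F) ∈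
      rowBdry (cell R H G F l t) (rowMap bH φ) (q + 1) (p + 1) ⊔
        colBdry (cell R H G F l t) (colMap H bF ψ) (p + 1) (q + 1) := by
  have hB := isBicomplex_cell (bH := bH) (bF := bF) (t := t) hC
  have hp : N - (q + 1) = p + 1 := by omega
  constructor
  · intro h
    obtain ⟨x, hx, hst⟩ := (he z 0).1 h
    rw [mk_eq_zero_iff_mem_boundariesN] at hx
    obtain ⟨n, hn, hcn, hnx⟩ := mem_boundariesN_succ.1 hx
    have h1 := (staircase_iff.1 hst).add
      ((stair_row_of_mem_ker (q := q + 1) (d := rowMap bH φ) (by omega) hn hcn).smul (-1 : R))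
    rw [hnx, smul_zero, neg_one_smul, add_neg_cancel, add_zero] at h1
    have h2 := h1.mem_bdry hB hrow (by omega)
    rwa [hp] at h2
  · intro h
    obtain ⟨x, hx, hst⟩ := (he z _).1 rfl
    rw [← hx, mk_eq_zero_iff_mem_boundariesN]
    refine mem_boundariesN_succ.2 ((staircase_iff.1 hst).mem_row_ker hB hcol (by omega) ?_)
    rwa [hp]

end Column

theorem IsCorner.hasNaturalSequence {A : Type*} [AddCommGroup A] [Module R A] {N p q : ℕ}
    {incl : A ⊗[R] symPow R F (q + 1) →ₗ[R] Total R H G F} (hC : ψ ∘ₗ φ = 0)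
    (hcor : IsCorner bH bF φ ψ t p (q + 1) incl) (hN : N = p + (q + 1))
    (hrow : RowsExact bH F φ t (N + 2)) (hbot : cell R H G F l t p (q + 2) = ⊥)
    (hcol : ColumnsExact H l bF ψ t N (q + 1)) (hcol' : ColumnsExact H l bF ψ t (N + 1) (q + 1))
    (hcol'' : ColumnsExact H l bF ψ t (N + 2) (q + 2)) :
    HasNaturalSequence bH bF φ ψ t (N + 1) (p + 1) (q + 1) incl := by
  have hB := isBicomplex_cell (bH := bH) (bF := bF) (t := t) hC
  obtain ⟨f, hf⟩ := hcor.exists_staircaseToCorner hC hN (hrow.mono (by omega))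
  obtain ⟨g, hg, hg0⟩ := hcor.exists_inducedByRowMap hC
  obtain ⟨e, he⟩ := exists_staircaseFromColumn (bH := bH) (N := N + 1) (p := p) hC (by omega)
    hcol' hcol''
  refine ⟨f, g, e, hcor.injective hC hN hcol hf, fun c => ?_, fun ζ => ?_,
    staircaseFromColumn_surjective (N := N + 1) hC (by omega) hrow hbot he, hf, hg, he⟩
  · obtain ⟨w, rfl⟩ := toCoker_surjective A ψ (q + 1) c
    rw [hg0, ← hcor.mem_range_iff hC hN hcol' hf]
    rfl
  · obtain ⟨z, rfl⟩ := Submodule.Quotient.mk_surjective _ ζ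
    rw [staircaseFromColumn_eq_zero_iff (N := N + 1) hC (by omega) (hrow.mono (Nat.le_succ _)) hcol' he]
    constructor
    · intro h
      obtain ⟨_, ⟨y, hy, rfl⟩, b, hb, e⟩ := Submodule.mem_sup.1 h
      obtain ⟨w, rfl⟩ := (hcor.mem_iff y).1 hy
      refine ⟨toCoker A ψ (q + 1) w, ?_⟩
      obtain ⟨z', hz', e'⟩ := hg w
      rw [e', ← sub_eq_zero, ← Submodule.Quotient.mk_sub, mk_eq_zero_iff_mem_boundariesPsi]
      have : ((z' - z : cyclesPsi H l bF ψ t (p + 1) (q + 1)) : Total R H G F) = -b := by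
        rw [Submodule.coe_sub, hz', ← e]
        abel
      rw [this]
      exact neg_mem hb
    · rintro ⟨c, hc⟩
      obtain ⟨w, rfl⟩ := toCoker_surjective A ψ (q + 1) c
      obtain ⟨z', hz', e'⟩ := hg w
      rw [e', ← sub_eq_zero, ← Submodule.Quotient.mk_sub, mk_eq_zero_iff_mem_boundariesPsi] at hc
      have h1 : (z : Total R H G F) = rowMap bH φ (q + 1) (incl w) +
          -((z' - z : cyclesPsi H l bF ψ t (p + 1) (q + 1)) : Total R H G F) := by
        rw [Submodule.coe_sub, hz']
        abel
      rw [h1]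
      exact add_mem (Submodule.mem_sup_left ⟨_, (hcor.mem_iff _).2 ⟨w, rfl⟩, rfl⟩)
        (Submodule.mem_sup_right (neg_mem hc))

end Natural

end KoszulBicomplex

end

/-! ### Numerical ranges and proof of the theorem -/

noncomputable section

namespace KoszulBicomplex

open scoped TensorProduct

section Main

variable {R H G F : Type*} [CommRing R] [AddCommGroup H] [Module R H] [AddCommGroup G]
  [Module R G] [AddCommGroup F] [Module R F] {l m n r t : ℕ}

theorem cell_eq_bot_of_west {p q : ℕ} (hp : p ≤ t) (h : p < q) : cell R H G F l t p q = ⊥ := by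
  rw [cell, if_pos hp, if_neg (by omega)]

theorem cell_eq_bot_of_east {p q : ℕ} (hp : t < p) (h : p + l ≤ q) :
    cell R H G F l t p q = ⊥ := by
  rw [cell, if_neg (by omega), if_neg (by omega)]

variable (bH : Module.Basis (Fin l) R H) (bF : Module.Basis (Fin m) R F) (φ : H →ₗ[R] G)
  (ψ : G →ₗ[R] F)

theorem rowBdry_succ_eq_bot {p q : ℕ} (h : cell R H G F l t p q = ⊥) :
    rowBdry (cell R H G F l t) (rowMap bH φ) q (p + 1) = ⊥ := by
  change (cell R H G F l t p q).map (rowMap bH φ q) = ⊥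
  rw [h, Submodule.map_bot]

theorem isCorner_westCorner {q : ℕ} (hq : q + 1 ≤ t) :
    IsCorner bH bF φ ψ t (q + 1) (q + 1) (A := divPow R H (t - (q + 1)))
      (westCorner H G F (t - (q + 1)) (q + 1)) where
  mem_iff := mem_range_westCorner hq
  toCoker_eq_zero := toCoker_west_eq_zero_iff bH bF ψ hq
  rowBdry_eq_bot := rowBdry_succ_eq_bot bH φ (cell_eq_bot_of_west (by omega) (by omega))
  cell_succ_eq_bot := cell_eq_bot_of_west hq (by omega)

theorem isCorner_eastCorner {p q : ℕ} (hl : 1 ≤ l) (hp : t ≤ p) (hq : q + 1 = p + l) :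
    IsCorner bH bF φ ψ t (p + 1) (q + 1) (eastCorner H G F (p + 1 - t - 1) (q + 1)) where
  mem_iff := mem_range_eastCorner (by omega) (by omega)
  toCoker_eq_zero := toCoker_east_eq_zero_iff bF ψ (by omega) (by omega)
  rowBdry_eq_bot := rowBdry_succ_eq_bot bH φ (by
    rcases hp.lt_or_eq with h | rfl
    · exact cell_eq_bot_of_east h (by omega)
    · exact cell_eq_bot_of_west le_rfl (by omega))
  cell_succ_eq_bot := cell_eq_bot_of_east (by omega) (by omega)

variable {bH bF φ ψ}

theorem rowsExact (bF : Module.Basis (Fin m) R F) (bG : Module.Basis (Fin n) R G) {N : ℕ}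
    (hN : (N : ℕ∞) < idealGrade (minorIdeal (LinearMap.toMatrix bH bG φ) l)) :
    RowsExact bH F φ t N := fun p hp _ =>
  row_exact bH φ bG bF (lt_of_le_of_lt (by exact_mod_cast hp) hN)

/-- The condition `h` states that the exterior exponents on the antidiagonal are at least 2, one
position lower than where exactness is asserted, namely at j + 1. -/
theorem columnsExact (bH : Module.Basis (Fin l) R H) (hn : n = m + r) (bG : Module.Basis (Fin n) R G)
    (hr : (r : ℕ∞) ≤ idealGrade (minorIdeal (LinearMap.toMatrix bG bF ψ) m)) {I : Ideal R}
    (hI : I ≤ (minorIdeal (LinearMap.toMatrix bG bF ψ) m).radical) {N q : ℕ}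
    (h : ∀ j, j < q → (N - j ≤ t → j + 2 ≤ N - j) ∧ (t < N - j → j + 3 ≤ N - j + l))
    (hq : ∀ j, j < q → (j : ℕ∞) < idealGrade I) : ColumnsExact H l bF ψ t N q := by
  intro j h1 h2 x hx hcx
  obtain ⟨j, rfl⟩ : ∃ j', j = j' + 1 := ⟨j - 1, by omega⟩
  obtain ⟨h3, h4⟩ := h _ h2
  exact column_exact bH hn bG bF ψ hr hI (fun hp => by have := h3 hp; omega)
    (fun hp => by have := h4 hp; omega) (hq _ h2) hx hcx

theorem subsingleton_HBar {i : ℕ}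
    (h : ∀ x ∈ cyclesN bH bF φ ψ t i, x ∈ boundariesN bH bF φ ψ t i) :
    Subsingleton (HBar bH bF φ ψ t i) := by
  refine subsingleton_of_forall_eq 0 fun ξ => ?_
  obtain ⟨x, rfl⟩ := Submodule.Quotient.mk_surjective _ ξ
  exact mk_eq_zero_iff_mem_boundariesN.2 (h x x.2)

theorem HBar_zero_subsingleton (hrow : RowsExact bH F φ t 0) :
    Subsingleton (HBar bH bF φ ψ t 0) :=
  subsingleton_HBar fun x hx => hrow 0 le_rfl 0 x (mem_cyclesN.1 hx).1.1 (mem_cyclesN.1 hx).2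

/-- The vanishing of the homology, when the staircases end in a column where the column map is
injective. -/
theorem HBar_succ_subsingleton (hC : ψ ∘ₗ φ = 0) {N p q : ℕ} (hN : N = p + q)
    (hrow : RowsExact bH F φ t (N + 1))
    (hbot : rowBdry (cell R H G F l t) (rowMap bH φ) (q + 1) p = ⊥)
    (hcol : ColumnsExact H l bF ψ t N (q + 1)) : Subsingleton (HBar bH bF φ ψ t (N + 1)) := by
  have hB := isBicomplex_cell (bH := bH) (bF := bF) (t := t) hC
  refine subsingleton_HBar fun x hx => mem_boundariesN_succ.2 ?_
  obtain ⟨⟨h1, h2⟩, h3⟩ := mem_cyclesN.1 hx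
  obtain ⟨z, hz⟩ := exists_stair hB hrow h1 h2 h3 (q := q) (by omega)
  have hmem := hz.mem
  have hp : N - q = p := by omega
  rw [hp] at hmem
  have h4 := hrow p (by omega) (q + 1) _ (hB.col_mem hmem) (hz.row_col_eq_zero hB h2)
  rw [hbot, Submodule.mem_bot] at h4
  rcases Nat.eq_zero_or_pos q with h | h
  · subst h
    obtain ⟨h5, h6⟩ := stair_zero.1 hz
    exact ⟨z, h5, h4, h6⟩
  · refine hz.mem_row_ker hB (fun j h1 h2 => hcol j h1 (by omega)) (by omega)
      (Submodule.mem_sup_right ?_)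
    exact hcol q h (by omega) z (by rwa [hp]) h4

/-- The staircase stops in the bottom row: C^{i-1,1} receives no nonzero row image for i ≤ 2,
because C^{0,1} = 0. -/
theorem HBar_subsingleton_of_le_two (hC : ψ ∘ₗ φ = 0) {i : ℕ} (hi : i ≤ 2)
    (hrow : RowsExact bH F φ t i) : Subsingleton (HBar bH bF φ ψ t i) := by
  cases i with
  | zero => exact HBar_zero_subsingleton hrow
  | succ N =>
    refine HBar_succ_subsingleton hC (p := N) (q := 0) rfl hrow ?_
      fun j h1 h2 => absurd h1 (by omega)
    obtain rfl | rfl : N = 0 ∨ N = 1 := by omega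
    · rfl
    · exact rowBdry_succ_eq_bot bH φ (cell_eq_bot_of_west (by omega) (by omega))

variable (hcomplex : ψ ∘ₗ φ = 0) (bG : Module.Basis (Fin n) R G) (hn : n = m + r)
  (hr : (r : ℕ∞) ≤ idealGrade (minorIdeal (LinearMap.toMatrix bG bF ψ) m))

include hcomplex hn hr

/-- The corner is C^{q+1,q+1} with i = 2q + 3. The columns need j < r ≤ g for the symmetric degrees
j ≤ q + 1, and the rows must be exact up to i + 1. -/
theorem hasNaturalSequence_west (hl : 1 ≤ l) {q : ℕ} (hqt : q + 1 ≤ t) (hqr : q + 1 < r)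
    (hq : ((2 * q + 4 : ℕ) : ℕ∞) < idealGrade (minorIdeal (LinearMap.toMatrix bH bG φ) l)) :
    HasNaturalSequence bH bF φ ψ t (2 * q + 3) (q + 2) (q + 1)
      (westCorner H G F (t - (q + 1)) (q + 1)) := by
  have hg : ∀ j, j < q + 2 → (j : ℕ∞) < idealGrade (minorIdeal (LinearMap.toMatrix bG bF ψ) m) :=
    fun j hj => lt_of_lt_of_le (by exact_mod_cast (by omega : j < r)) hr
  exact (isCorner_westCorner bH bF φ ψ hqt).hasNaturalSequence (N := 2 * q + 2) hcomplex (by omega)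
    (rowsExact bF bG hq) (cell_eq_bot_of_west hqt (by omega))
    (columnsExact bH hn bG hr Ideal.le_radical (fun j hj => by omega) fun j hj => hg j (by omega))
    (columnsExact bH hn bG hr Ideal.le_radical (fun j hj => by omega) fun j hj => hg j (by omega))
    (columnsExact bH hn bG hr Ideal.le_radical (fun j hj => by omega) fun j hj => hg j (by omega))

/-- The corner is C^{p+1,q+1} with q + 1 = p + l, where the exterior exponent vanishes on the side p
> t. -/
theorem hasNaturalSequence_east (hl : 1 ≤ l) {p q : ℕ} (hp : t ≤ p) (hpq : q + 1 = p + l)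
    (hqr : q + 1 < r)
    (hq : ((p + q + 4 : ℕ) : ℕ∞) < idealGrade (minorIdeal (LinearMap.toMatrix bH bG φ) l)) :
    HasNaturalSequence bH bF φ ψ t (p + q + 2 + 1) (p + 2) (q + 1)
      (eastCorner H G F (p + 1 - t - 1) (q + 1)) := by
  have hg : ∀ j, j < q + 2 → (j : ℕ∞) < idealGrade (minorIdeal (LinearMap.toMatrix bG bF ψ) m) :=
    fun j hj => lt_of_lt_of_le (by exact_mod_cast (by omega : j < r)) hr
  exact (isCorner_eastCorner bH bF φ ψ hl hp hpq).hasNaturalSequence (N := p + q + 2) hcomplex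
    (by omega) (rowsExact bF bG hq) (cell_eq_bot_of_east (by omega) (by omega))
    (columnsExact bH hn bG hr Ideal.le_radical (fun j hj => by omega) fun j hj => hg j (by omega))
    (columnsExact bH hn bG hr Ideal.le_radical (fun j hj => by omega) fun j hj => hg j (by omega))
    (columnsExact bH hn bG hr Ideal.le_radical (fun j hj => by omega) fun j hj => hg j (by omega))

variable (hl : 1 < l) (hr1 : 1 ≤ r)

include hl hr1

/-- For `l > 1` the columns are exact in a range given by the grade of the ideal of `φ`. -/
theorem columnsExact_of_one_lt {N q : ℕ}
    (h : ∀ j, j < q → (N - j ≤ t → j + 2 ≤ N - j) ∧ (t < N - j → j + 3 ≤ N - j + l))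
    (hq : (q : ℕ∞) < idealGrade (minorIdeal (LinearMap.toMatrix bH bG φ) l)) :
    ColumnsExact H l bF ψ t N q :=
  columnsExact bH hn bG hr (minorIdeal_le_radical hl hr1 hn bH bG bF φ ψ hcomplex hr) h
    fun _ hj => lt_trans (by exact_mod_cast hj) hq

/-- Beyond the corner C^{t,t} lies C^{t+1,t}, with exterior exponent l ≥ 2. The column is exact
there, so every element of the corner extends to a staircase. -/
theorem exists_HBar_equiv_corner (ht : 1 ≤ t)
    (hq : ((2 * t + 1 : ℕ) : ℕ∞) < idealGrade (minorIdeal (LinearMap.toMatrix bH bG φ) l)) :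
    ∃ f : HBar bH bF φ ψ t (2 * t + 1) ≃ₗ[R] divPow R H 0 ⊗[R] symPow R (Coker ψ) t,
      IsStaircaseToCorner bH bF φ ψ t (2 * t + 1) t (westCorner H G F 0 t) f := by
  obtain ⟨q, rfl⟩ : ∃ q, t = q + 1 := ⟨t - 1, by omega⟩
  have hlt : ∀ j, j < 2 * (q + 1) + 1 →
      (j : ℕ∞) < idealGrade (minorIdeal (LinearMap.toMatrix bH bG φ) l) :=
    fun j hj => lt_trans (by exact_mod_cast hj) hq
  have hB := isBicomplex_cell (bH := bH) (bF := bF) (t := q + 1) hcomplex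
  have hcor := isCorner_westCorner bH bF φ ψ (le_refl (q + 1))
  rw [Nat.sub_self] at hcor
  have hcol := columnsExact_of_one_lt hcomplex bG hn hr hl hr1 (t := q + 1) (N := 2 * (q + 1))
    (q := q + 1) (fun j hj => by omega) (hlt _ (by omega))
  have hcol' := columnsExact_of_one_lt hcomplex bG hn hr hl hr1 (t := q + 1) (N := 2 * (q + 1) + 1)
    (q := q + 2) (fun j hj => by omega) (hlt _ (by omega))
  obtain ⟨f, hf⟩ := hcor.exists_staircaseToCorner hcomplex (N := 2 * (q + 1)) (by omega)
    (rowsExact bF bG hq)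
  refine ⟨LinearEquiv.ofBijective f ⟨hcor.injective hcomplex (by omega) hcol hf, fun c => ?_⟩, hf⟩
  obtain ⟨w, rfl⟩ := toCoker_surjective (divPow R H 0) ψ (q + 1) c
  refine (hcor.mem_range_iff hcomplex (by omega) (fun j h1 h2 => hcol' j h1 (by omega)) hf w).2 ?_
  have h := hcol' (q + 1) (by omega) (by omega) (rowMap bH φ (q + 1) (westCorner H G F 0 (q + 1) w))
  rw [show 2 * (q + 1) + 1 - (q + 1) = q + 1 + 1 by omega] at h
  refine h (hB.row_mem ((hcor.mem_iff _).2 ⟨w, rfl⟩)) ?_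
  rw [← neg_eq_zero, ← hB.row_col, hcor.col_incl, map_zero]

/-- The staircase is stopped in column t + 1, at q = i - t - 2 ≥ t. Row images at C^{t+1,q+1} vanish
because C^{t,q+1} = 0, and i < 2t + l + 1 makes the exterior exponent t + l - q at least 2. -/
theorem HBar_subsingleton_of_middle {i : ℕ} (hi : 2 * t + 2 ≤ i) (hil : i < 2 * t + l + 1)
    (hq : (i : ℕ∞) < idealGrade (minorIdeal (LinearMap.toMatrix bH bG φ) l)) :
    Subsingleton (HBar bH bF φ ψ t i) := by
  obtain ⟨q, rfl⟩ : ∃ q, i = t + 1 + q + 1 := ⟨i - t - 2, by omega⟩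
  have hlt : ∀ j, j < t + 1 + q + 1 →
      (j : ℕ∞) < idealGrade (minorIdeal (LinearMap.toMatrix bH bG φ) l) :=
    fun j hj => lt_trans (by exact_mod_cast hj) hq
  exact HBar_succ_subsingleton hcomplex (p := t + 1) (q := q) rfl (rowsExact bF bG hq)
    (rowBdry_succ_eq_bot bH φ (cell_eq_bot_of_west le_rfl (by omega)))
    (columnsExact_of_one_lt hcomplex bG hn hr hl hr1 (fun j hj => by omega) (hlt _ (by omega)))

/-- Here the exterior exponent is 1, but column t is zero at heights t + l - 1 and t + l. Hence no
corner contributes, and the staircase map is bijective. -/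
theorem exists_HPsi_equiv_HBar
    (hq : ((2 * t + l + 1 : ℕ) : ℕ∞) < idealGrade (minorIdeal (LinearMap.toMatrix bH bG φ) l)) :
    ∃ e : HPsi H l bF ψ t (t + 1) (t + l - 1) ≃ₗ[R] HBar bH bF φ ψ t (2 * t + l + 1),
      IsStaircaseFromColumn bH bF φ ψ t (t + 1) (t + l - 1) (2 * t + l + 1) e := by
  obtain ⟨q, hql⟩ : ∃ q, t + l = q + 2 := ⟨t + l - 2, by omega⟩
  have hlt : ∀ j, j < 2 * t + l + 1 →
      (j : ℕ∞) < idealGrade (minorIdeal (LinearMap.toMatrix bH bG φ) l) :=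
    fun j hj => lt_trans (by exact_mod_cast hj) hq
  rw [show t + l - 1 = q + 1 by omega]
  have hcol := columnsExact_of_one_lt hcomplex bG hn hr hl hr1 (t := t) (N := 2 * t + l)
    (q := q + 1) (fun j hj => by omega) (hlt _ (by omega))
  have hcol' := columnsExact_of_one_lt hcomplex bG hn hr hl hr1 (t := t) (N := 2 * t + l + 1)
    (q := q + 2) (fun j hj => by omega) (hlt _ (by omega))
  have hrow := rowsExact (bH := bH) (φ := φ) (t := t) bF bG hq
  obtain ⟨e, he⟩ := exists_staircaseFromColumn (bH := bH) (N := 2 * t + l) (p := t) (q := q)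
    hcomplex (by omega) hcol hcol'
  refine ⟨LinearEquiv.ofBijective e ⟨?_, staircaseFromColumn_surjective hcomplex (by omega) hrow
    (cell_eq_bot_of_west le_rfl (by omega)) he⟩, he⟩
  rw [injective_iff_map_eq_zero]
  intro ζ hζ
  obtain ⟨z, rfl⟩ := Submodule.Quotient.mk_surjective _ ζ
  rw [staircaseFromColumn_eq_zero_iff hcomplex (N := 2 * t + l) (by omega)
    (hrow.mono (Nat.le_succ _)) hcol he,
    rowBdry_succ_eq_bot bH φ (cell_eq_bot_of_west le_rfl (by omega)), bot_sup_eq] at hζ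
  exact mk_eq_zero_iff_mem_boundariesPsi.2 hζ

end Main

end KoszulBicomplex

end

theorem theorem2p2 {R : Type*} [CommRing R] [IsNoetherianRing R]
    {H G F : Type*} [AddCommGroup H] [Module R H] [AddCommGroup G] [Module R G]
    [AddCommGroup F] [Module R F] {l n m r : ℕ}
    (bH : Module.Basis (Fin l) R H) (bG : Module.Basis (Fin n) R G)
    (bF : Module.Basis (Fin m) R F)
    (φ : H →ₗ[R] G) (ψ : G →ₗ[R] F) (hcomplex : ψ ∘ₗ φ = 0)
    (hl : 1 ≤ l) (hln : l ≤ n) (hr : n = m + r)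
    (g h : ℕ∞)
    (hg : g = KoszulBicomplex.idealGrade
      (KoszulBicomplex.minorIdeal (LinearMap.toMatrix bG bF ψ) m))
    (hh : h = KoszulBicomplex.idealGrade
      (KoszulBicomplex.minorIdeal (LinearMap.toMatrix bH bG φ) l))
    (hr1 : 1 ≤ r) (hrg : (r : ℕ∞) ≤ g) (t : ℕ) :
    -- the vanishing in low degrees
    (∀ i : ℕ, i ≤ 2 → (i : ℕ∞) < h →
      Subsingleton (KoszulBicomplex.HBar bH bF φ ψ t i)) ∧
    -- the natural exact sequences for odd `i`
    (∀ i : ℕ, Odd i → 3 ≤ i → (i : ℕ∞) + 1 < h → i < 2 * r → i < 2 * t + 2 →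
      KoszulBicomplex.HasNaturalSequence bH bF φ ψ t i ((i + 1) / 2) ((i - 1) / 2)
        (KoszulBicomplex.westCorner H G F (t - (i - 1) / 2) ((i - 1) / 2))) ∧
    -- the intermediate range, for `l > 1`
    (1 < l →
      (3 ≤ 2 * t + 1 → ((2 * t + 1 : ℕ) : ℕ∞) < h →
        ∃ f : KoszulBicomplex.HBar bH bF φ ψ t (2 * t + 1) ≃ₗ[R]
            TensorProduct R (KoszulBicomplex.divPow R H 0)
              (KoszulBicomplex.symPow R (KoszulBicomplex.Coker ψ) t),
          KoszulBicomplex.IsStaircaseToCorner bH bF φ ψ t (2 * t + 1) t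
            (KoszulBicomplex.westCorner H G F 0 t) f) ∧
      (∀ i : ℕ, 2 * t + 2 ≤ i → (i : ℕ∞) < h → i < 2 * t + l + 1 →
        Subsingleton (KoszulBicomplex.HBar bH bF φ ψ t i)) ∧
      (((2 * t + l + 1 : ℕ) : ℕ∞) < h →
        ∃ e : KoszulBicomplex.HPsi H l bF ψ t (t + 1) (t + l - 1) ≃ₗ[R]
            KoszulBicomplex.HBar bH bF φ ψ t (2 * t + l + 1),
          KoszulBicomplex.IsStaircaseFromColumn bH bF φ ψ t (t + 1) (t + l - 1)
            (2 * t + l + 1) e)) ∧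
    -- the natural exact sequences for `i - l` even
    (∀ i : ℕ, Even ((i : ℤ) - l) → 2 * t + l + 2 ≤ i → (i : ℕ∞) + 1 < h → i + l < 2 * r + 2 →
      KoszulBicomplex.HasNaturalSequence bH bF φ ψ t i ((i - l) / 2 + 1) ((i + l) / 2 - 1)
        (KoszulBicomplex.eastCorner H G F ((i - l) / 2 - t - 1) ((i + l) / 2 - 1))) := by
  subst hg hh
  open KoszulBicomplex in
  refine ⟨fun i hi hih => HBar_subsingleton_of_le_two hcomplex hi (rowsExact bF bG hih),
    fun i hodd hi hih hir hit => ?_, fun hl1 => ⟨fun ht hh => exists_HBar_equiv_corner hcomplex bG hr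
      hrg hl1 hr1 (by omega) hh, fun i hi hih hil => HBar_subsingleton_of_middle hcomplex bG hr hrg
      hl1 hr1 hi hil hih, fun hh => exists_HPsi_equiv_HBar hcomplex bG hr hrg hl1 hr1 hh⟩,
    fun i hev hi hih hir => ?_⟩
  -- In terms of q the bounds i < 2r and i < 2t + 2 become q + 1 < r and q + 1 ≤ t.
  · obtain ⟨q, rfl⟩ : ∃ q, i = 2 * q + 3 := by
      obtain ⟨k, rfl⟩ := hodd
      exact ⟨k - 1, by omega⟩
    rw [show (2 * q + 3 + 1) / 2 = q + 2 by omega, show (2 * q + 3 - 1) / 2 = q + 1 by omega]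
    exact hasNaturalSequence_west hcomplex bG hr hrg hl (by omega) (by omega)
      (by exact_mod_cast hih)
  -- With q + 1 = p + l, the bounds become t ≤ p and q + 1 < r.
  · obtain ⟨p, rfl⟩ : ∃ p, i = 2 * p + l + 2 := by
      obtain ⟨k, hk⟩ := hev
      exact ⟨(k - 1).toNat, by omega⟩
    obtain ⟨q, hq⟩ : ∃ q, p + l = q + 1 := ⟨p + l - 1, by omega⟩
    rw [show (2 * p + l + 2 - l) / 2 = p + 1 by omega,
      show (2 * p + l + 2 + l) / 2 - 1 = q + 1 by omega,
      show 2 * p + l + 2 = p + q + 2 + 1 by omega]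
    refine hasNaturalSequence_east hcomplex bG hr hrg hl (by omega) hq.symm (by omega) ?_
    rw [show p + q + 4 = 2 * p + l + 2 + 1 by omega]
    exact_mod_cast hih
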